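/- Let $H$ be a complex Hilbert space (not necessarily separable) with $\dim H\ge 2$, and let $\mathcal E(H)=\{A\in\mathcal B(H): A=A^*,\ 0\le A\le I\}$ be its effect algebra, where $\mathcal B(H)$ is the set of bounded operators on $H$. For $A\in\mathcal E(H)$ write $A^\perp=I-A$, and call $A$ scalar if $A=tI$ for some $t\in[0,1]$. Effects $A,B$ are called coexistent, written $A\sim B$, if there are $E,F,G\in\mathcal E(H)$ with $A=E+G$, $B=F+G$ and $E+F+G\in\mathcal E(H)$. Let $\phi\colon\mathcal E(H)\to\mathcal E(H)$ be a bijection such that $$A\sim B\iff\phi(A)\sim\phi(B)\qquad(A,B\in\mathcal E(H)).$$ Then there exist a unitary or antiunitary operator $U\colon H\to H$ and a bijection $g\colon[0,1]\to[0,1]$ such that $$\{\phi(A),\phi(A^\perp)\}=\{UAU^*,\,UA^\perp U^*\}\quad\text{for every non-scalar } A\in\mathcal E(H),$$ $$\phi(tI)=g(t)I\quad\text{for every } t\in[0,1].$$ Conversely, every map $\phi\colon\mathcal E(H)\to\mathcal E(H)$ of this form, for some unitary or antiunitary $U$ and some bijection $g$ of $[0,1]$, preserves coexistence in both directions, that is,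 $A\sim B\iff\phi(A)\sim\phi(B)$ for all $A,B\in\mathcal E(H)$. -/

import Mathlib

/-- The Hilbert space effect algebra: all bounded operators `A` on `H` with `0 ≤ A ≤ I`, for the
order `A ≤ B ↔ B - A` is positive (which includes self-adjointness). -/
def Effect (H : Type*) [NormedAddCommGroup H] [InnerProductSpace ℂ H] [CompleteSpace H] : Type _ :=
  {A : H →L[ℂ] H // 0 ≤ A ∧ A ≤ 1}

namespace Effect

variable {H : Type*} [NormedAddCommGroup H] [InnerProductSpace ℂ H] [CompleteSpace H]

/-- The bounded operator underlying an effect. -/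
def op (A : Effect H) : H →L[ℂ] H := A.1

/-- Effects are exactly the self-adjoint operators whose spectrum lies in `[0,1]`. -/
theorem exists_op_eq_iff (T : H →L[ℂ] H) :
    (∃ A : Effect H, A.op = T) ↔ IsSelfAdjoint T ∧ spectrum ℝ T ⊆ Set.Icc 0 1 := by
  constructor
  · rintro ⟨A, rfl⟩
    have hsa : IsSelfAdjoint A.op := IsSelfAdjoint.of_nonneg A.2.1
    refine ⟨hsa, fun x hx => ⟨spectrum_nonneg_of_nonneg A.2.1 hx, ?_⟩⟩
    have h1 : A.op ≤ algebraMap ℝ (H →L[ℂ] H) 1 := by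
      rw [map_one]; exact A.2.2
    exact (le_algebraMap_iff_spectrum_le (ha := hsa)).1 h1 x hx
  · rintro ⟨hsa, hs⟩
    refine ⟨⟨T, ?_, ?_⟩, rfl⟩
    · have h0 : algebraMap ℝ (H →L[ℂ] H) 0 ≤ T :=
        (algebraMap_le_iff_le_spectrum (ha := hsa)).2 fun x hx => (hs hx).1
      rwa [map_zero] at h0
    · have h1 : T ≤ algebraMap ℝ (H →L[ℂ] H) 1 :=
        (le_algebraMap_iff_spectrum_le (ha := hsa)).2 fun x hx => (hs hx).2
      rwa [map_one] at h1

/-- The ortho-complement `I - A` of an effect `A`. -/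
def ortho (A : Effect H) : Effect H :=
  ⟨1 - A.op, sub_nonneg.2 A.2.2, sub_le_self 1 A.2.1⟩

/-- The scalar effect `t I`, for `t ∈ [0,1]`. -/
noncomputable def scalar (t : unitInterval) : Effect H :=
  ⟨(t : ℝ) • (1 : H →L[ℂ] H), smul_nonneg t.2.1 zero_le_one,
    smul_le_of_le_one_left zero_le_one t.2.2⟩

/-- An effect is scalar if it is `t I` for some `t ∈ [0,1]`. -/
def IsScalar (A : Effect H) : Prop := ∃ t : unitInterval, A = scalar t

/-- `A` and `B` are coexistent if there are effects `E, F, G` such that `A = E + G`, `B = F + G`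
and `E + F + G` is an effect. -/
def Coexistent (A B : Effect H) : Prop :=
  ∃ E F G S : Effect H,
    A.op = E.op + G.op ∧ B.op = F.op + G.op ∧ S.op = E.op + F.op + G.op

/-- `A ∼ B` if and only if `φ A ∼ φ B`, for all effects `A` and `B`. -/
def PreservesCoexistence (φ : Effect H → Effect H) : Prop :=
  ∀ A B : Effect H, Coexistent A B ↔ Coexistent (φ A) (φ B)

/-- The operator `U T U*`, where `U` is a surjective `σ`-linear isometry: a unitary operator when
`σ = id`, an antiunitary operator when `σ` is complex conjugation. In both cases `U*` is `U⁻¹`. -/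
def conjBy {σ σ' : ℂ →+* ℂ} [RingHomInvPair σ σ'] [RingHomInvPair σ' σ]
    (U : H ≃ₛₗᵢ[σ] H) (T : H →L[ℂ] H) : H →L[ℂ] H :=
  U.toContinuousLinearEquiv.toContinuousLinearMap.comp
    (T.comp U.symm.toContinuousLinearEquiv.toContinuousLinearMap)

/-- `{φ(A), φ(I - A)} = {U A U*, U (I - A) U*}` for every non-scalar effect `A`. -/
def ImplementedOffScalars {σ σ' : ℂ →+* ℂ} [RingHomInvPair σ σ'] [RingHomInvPair σ' σ]
    (φ : Effect H → Effect H) (U : H ≃ₛₗᵢ[σ] H) : Prop :=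
  ∀ A : Effect H, ¬ IsScalar A →
    ({(φ A).op, (φ A.ortho).op} : Set (H →L[ℂ] H)) = {conjBy U A.op, conjBy U A.ortho.op}

end Effect

/-!
Coexistence of effects can be tested on rank-one effects: `A` is coexistent with `s |x⟩⟨x|` if and
only if `s` is at most the sum of the strengths of `A` and of `1 - A` along `x`
(`coex_smul_ray_iff_str`), where the strength of `A` along `x` is the largest `a` such that
`a |x⟩⟨x| ≤ A`, that is, `1 / ⟨A⁻¹x, x⟩` (`smul_ray_le_iff`). A non-scalar effect `A` is
determined, up to passing to `1 - A`, by these sums together with the projections it commutes with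
(`eq_or_eq_compl_of_str_add`): along vectors with a component on either side of a spectral cut of
`A`, the sum is a rational function of the relative size of the components, whose poles can be
matched. For projections the sums alone suffice (`eq_or_eq_compl_of_not_finite`). As commuting with
a projection is the same as being coexistent with it, an automorphism of the coexistence relation is
the identity up to complements on non-scalar effects as soon as it is so on the multiples of
rank-one projections (`CoexAut.eq_or_eq_compl`). It remains to see that every automorphism acts on
these by a unitary or antiunitary operator.

Rank-one projections are recognized up to complements: among the non-scalar effects, they are those
`A` whose coexistence relation never pins down an effect `B` coexistent with `A` up to finitely
many possibilities (`isRayLike_iff`). Write `Finer A B` if everything coexistent with `A` is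
coexistent with `B`. Above a rank-one projection `R` in this order lie exactly the combinations of
`R` and `1 - R` (`finer_ray_iff`), and among them the multiples `t R` and `t (1 - R)` and their
complements are recognized by the chains they span (`IsBranch.exists_eq`). So an automorphism takes
the multiples of `R` to those of `R'` or of `1 - R'`. The second possibility is excluded by the
effect with eigenvalues `1, 1/2, 0` along three orthogonal vectors (`CoexAut.not_flip`); in
dimension two `1 - R'` itself has rank one.

An automorphism therefore induces a map `ψ` of rays and maps `τ` of the factors. In the parameters
`u = 1/t - 1` and `v = 1/s - 1`, coexistence of `t |x⟩⟨x|` and `s |y⟩⟨y|`, for rays neither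
equal nor orthogonal, means `|⟨x, y⟩|² ≤ u v` (`coex_smul_ray_smul_ray`). This gives a functional
equation forcing the maps of parameters to be power functions up to constants, with
`|⟨ψx, ψy⟩|²` a constant times a power of `|⟨x, y⟩|²`; since the overlaps
with two orthogonal rays in a plane sum to one, the exponents and constants are `1`
(`RayMap.ov_eq`). So the factors do not change and overlaps are preserved, and Wigner's theorem
(`PreservesAbsInner.exists_unitary`) provides the unitary or antiunitary operator. Scalars are the
effects coexistent with everything (`isScalarOp_iff`), hence are permuted.

The converse holds because coexistence with `A` and with `1 - A` are the same, conjugation preserves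
coexistence, and scalars are coexistent with everything.
-/

set_option linter.unusedSectionVars false

/-! ### Quadratic forms of operators -/

namespace Effect

variable {H : Type*} [NormedAddCommGroup H] [InnerProductSpace ℂ H] [CompleteSpace H]

/-- A shortcut for instance search. -/
noncomputable instance instAlgebraRealOperator : Algebra ℝ (H →L[ℂ] H) := inferInstance

/-- The quadratic form `z ↦ ⟨Az, z⟩` of an operator; real parts are harmless, as the form is only
used for self-adjoint operators. -/
noncomputable def qf (A : H →L[ℂ] H) (z : H) : ℝ := (inner ℂ (A z) z).re

/-- The positive operator `|x⟩⟨x|`, a projection when `x` is a unit vector. -/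
noncomputable abbrev ray (x : H) : H →L[ℂ] H := InnerProductSpace.rankOne ℂ x x

lemma qf_add (A B : H →L[ℂ] H) (z : H) : qf (A + B) z = qf A z + qf B z := by
  simp [qf]

lemma qf_sub (A B : H →L[ℂ] H) (z : H) : qf (A - B) z = qf A z - qf B z := by
  simp [qf]

lemma qf_smul (t : ℝ) (A : H →L[ℂ] H) (z : H) : qf (t • A) z = t * qf A z := by
  simp [qf, inner_smul_left_eq_smul]

lemma qf_one (z : H) : qf (1 : H →L[ℂ] H) z = ‖z‖ ^ 2 := by
  simp only [qf, one_apply_eq_self]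
  exact inner_self_eq_norm_sq (𝕜 := ℂ) z

lemma qf_zero (z : H) : qf (0 : H →L[ℂ] H) z = 0 := by simp [qf]

lemma qf_ray (x z : H) : qf (ray x) z = ‖inner ℂ x z‖ ^ 2 := by
  simp only [qf, ray, InnerProductSpace.rankOne_apply, inner_smul_left]
  rw [Complex.conj_mul']
  norm_cast

lemma ray_nonneg (x : H) : 0 ≤ ray x := by
  rw [ContinuousLinearMap.nonneg_iff_isPositive]
  exact InnerProductSpace.isPositive_rankOne_self x

lemma ray_isSelfAdjoint (x : H) : IsSelfAdjoint (ray x) := .of_nonneg (ray_nonneg x)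

lemma isSelfAdjoint_real_smul {A : H →L[ℂ] H} (t : ℝ) (hA : IsSelfAdjoint A) :
    IsSelfAdjoint (t • A) := (IsSelfAdjoint.all t).smul hA

lemma nonneg_iff_qf {A : H →L[ℂ] H} (hA : IsSelfAdjoint A) : 0 ≤ A ↔ ∀ z, 0 ≤ qf A z := by
  rw [ContinuousLinearMap.nonneg_iff_isPositive, ContinuousLinearMap.isPositive_def']
  simp only [hA, true_and]
  rfl

lemma le_iff_qf {A B : H →L[ℂ] H} (hA : IsSelfAdjoint A) (hB : IsSelfAdjoint B) :
    A ≤ B ↔ ∀ z, qf A z ≤ qf B z := by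
  rw [← sub_nonneg, nonneg_iff_qf (hB.sub hA)]
  simp [qf_sub]

lemma qf_nonneg {A : H →L[ℂ] H} (hA : 0 ≤ A) (z : H) : 0 ≤ qf A z :=
  (nonneg_iff_qf (.of_nonneg hA)).1 hA z

lemma qf_mono {A B : H →L[ℂ] H} (h : A ≤ B) (z : H) : qf A z ≤ qf B z := by
  have := qf_nonneg (sub_nonneg.2 h) z
  rw [qf_sub] at this
  linarith

lemma ext_qf {A B : H →L[ℂ] H} (hA : IsSelfAdjoint A) (hB : IsSelfAdjoint B)
    (h : ∀ z, qf A z = qf B z) : A = B :=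
  le_antisymm ((le_iff_qf hA hB).2 fun z => (h z).le) ((le_iff_qf hB hA).2 fun z => (h z).ge)

lemma inner_apply_comm {A : H →L[ℂ] H} (hA : IsSelfAdjoint A) (x y : H) :
    inner ℂ (A x) y = inner ℂ x (A y) := hA.isSymmetric x y

/-- The Cauchy–Schwarz inequality for a positive operator. -/
lemma norm_inner_apply_sq_le {A : H →L[ℂ] H} (hA : 0 ≤ A) (x y : H) :
    ‖inner ℂ (A x) y‖ ^ 2 ≤ qf A x * qf A y := by
  set S := CFC.sqrt A with hS
  have hS0 : 0 ≤ S := CFC.sqrt_nonneg A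
  have hsa : IsSelfAdjoint S := .of_nonneg hS0
  have hmul : S * S = A := CFC.sqrt_mul_sqrt_self A hA
  have key : ∀ u v, inner ℂ (A u) v = inner ℂ (S u) (S v) := fun u v => by
    rw [← hmul, mul_apply_eq_comp, inner_apply_comm hsa]
  have hq : ∀ u, qf A u = ‖S u‖ ^ 2 := fun u => by
    rw [qf, key]
    exact inner_self_eq_norm_sq (𝕜 := ℂ) _
  rw [hq, hq, key, ← mul_pow]
  gcongr
  exact norm_inner_le_norm _ _

lemma apply_eq_zero_of_qf {A : H →L[ℂ] H} (hA : 0 ≤ A) {z : H} (h : qf A z = 0) : A z = 0 := by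
  have := norm_inner_apply_sq_le hA z (A z)
  rw [h, zero_mul, inner_self_eq_norm_sq_to_K] at this
  simpa using this

lemma apply_eq_zero_of_le {A G : H →L[ℂ] H} (hG : 0 ≤ G) (h : G ≤ A) {z : H} (hz : A z = 0) :
    G z = 0 := by
  refine apply_eq_zero_of_qf hG (le_antisymm ?_ (qf_nonneg hG z))
  have := qf_mono h z
  simpa [qf, hz] using this

lemma mul_eq_zero_of_le {A G X : H →L[ℂ] H} (hG : 0 ≤ G) (h : G ≤ A) (hX : A * X = 0) :
    G * X = 0 := by
  ext z
  have : A (X z) = 0 := by rw [← mul_apply_eq_comp, hX]; rfl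
  simpa using apply_eq_zero_of_le hG h this

/-- A positive operator below a multiple of `|x⟩⟨x|` is itself a multiple of it. -/
lemma eq_smul_ray_of_le {G : H →L[ℂ] H} {y : H} {s : ℝ} (hy : y ≠ 0) (hG : 0 ≤ G)
    (h : G ≤ s • ray y) : ∃ a : ℝ, 0 ≤ a ∧ G = a • ray y := by
  have hn : (0 : ℝ) < ‖y‖ ^ 2 := by positivity
  have hsa : IsSelfAdjoint G := .of_nonneg hG
  refine ⟨qf G y / (‖y‖ ^ 2) ^ 2, div_nonneg (qf_nonneg hG y) (by positivity), ?_⟩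
  refine ext_qf hsa (isSelfAdjoint_real_smul _ (ray_isSelfAdjoint y)) fun z => ?_
  set w := z - (inner ℂ y z / (‖y‖ ^ 2 : ℂ)) • y with hw
  have hyy : (inner ℂ y y : ℂ) = (‖y‖ : ℂ) ^ 2 := inner_self_eq_norm_sq_to_K y
  have hne : (‖y‖ : ℂ) ^ 2 ≠ 0 := by exact_mod_cast hn.ne'
  have hyw : inner ℂ y w = 0 := by
    rw [hw, inner_sub_right, inner_smul_right, hyy, div_mul_cancel₀ _ hne, sub_self]
  have hGw : G w = 0 := apply_eq_zero_of_le hG h (by simp [InnerProductSpace.rankOne_apply, hyw])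
  have hz : G z = (inner ℂ y z / (‖y‖ ^ 2 : ℂ)) • G y := by
    have : z = w + (inner ℂ y z / (‖y‖ ^ 2 : ℂ)) • y := by rw [hw]; abel
    conv_lhs => rw [this]
    rw [map_add, hGw, zero_add, map_smul]
  set c := inner ℂ y z / (‖y‖ ^ 2 : ℂ) with hc
  have hq : qf G z = ‖c‖ ^ 2 * qf G y := by
    have : inner ℂ (G z) z = ((‖c‖ ^ 2 : ℝ) : ℂ) * inner ℂ (G y) y := by
      rw [inner_apply_comm hsa, hz, inner_smul_right, ← inner_apply_comm hsa, hz, inner_smul_left,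
        ← mul_assoc, Complex.mul_conj']
      push_cast
      rfl
    rw [qf, this, Complex.re_ofReal_mul, qf]
  rw [hq, qf_smul, qf_ray, hc, norm_div]
  simp only [norm_pow, Complex.norm_real, norm_norm]
  field_simp

lemma ray_isStarProjection {x : H} (hx : ‖x‖ = 1) : IsStarProjection (ray x) :=
  InnerProductSpace.isStarProjection_rankOne_self hx

lemma _root_.IsStarProjection.zero_le {P : H →L[ℂ] H} (hP : IsStarProjection P) : 0 ≤ P := by
  have := star_mul_self_nonneg P
  rwa [hP.isSelfAdjoint.star_eq, hP.isIdempotentElem.eq] at this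

lemma _root_.IsStarProjection.le_one' {P : H →L[ℂ] H} (hP : IsStarProjection P) : P ≤ 1 :=
  sub_nonneg.1 hP.one_sub.zero_le

lemma qf_projection {P : H →L[ℂ] H} (hP : IsStarProjection P) (z : H) : qf P z = ‖P z‖ ^ 2 := by
  have : inner ℂ (P z) z = inner ℂ (P z) (P z) := by
    rw [← inner_apply_comm hP.isSelfAdjoint, ← mul_apply_eq_comp,
      hP.isIdempotentElem.eq]
  rw [qf, this]
  exact inner_self_eq_norm_sq (𝕜 := ℂ) _

lemma projection_apply_apply {P : H →L[ℂ] H} (hP : IsStarProjection P) (z : H) : P (P z) = P z := by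
  rw [← mul_apply_eq_comp, hP.isIdempotentElem.eq]

lemma norm_sq_projection {P : H →L[ℂ] H} (hP : IsStarProjection P) (z : H) :
    ‖z‖ ^ 2 = ‖P z‖ ^ 2 + ‖z - P z‖ ^ 2 := by
  have h1 := qf_projection hP z
  have h2 := qf_projection hP.one_sub z
  rw [qf_sub, qf_one] at h2
  simp only [sub_apply, one_apply_eq_self] at h2
  linarith

lemma ray_apply_self {x : H} (hx : ‖x‖ = 1) : ray x x = x := by
  simp [InnerProductSpace.rankOne_apply, inner_self_eq_norm_sq_to_K, hx]

/-! ### Coexistence of operators -/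

/-- Coexistence at the level of operators: `B` splits as a sum of a part below `1 - A` and a part
below `A`. -/
def Coex (A B : H →L[ℂ] H) : Prop :=
  ∃ F G : H →L[ℂ] H, 0 ≤ F ∧ F ≤ 1 - A ∧ 0 ≤ G ∧ G ≤ A ∧ B = F + G

lemma coexistent_iff (A B : Effect H) : Coexistent A B ↔ Coex A.op B.op := by
  constructor
  · rintro ⟨E, F, G, S, h1, h2, h3⟩
    refine ⟨F.op, G.op, F.2.1, ?_, G.2.1, ?_, h2⟩
    · have : S.op ≤ 1 := S.2.2
      rw [h3] at this
      rw [h1, le_sub_iff_add_le]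
      calc F.op + (E.op + G.op) = E.op + F.op + G.op := by abel
        _ ≤ 1 := this
    · rw [h1]; exact le_add_of_nonneg_left E.2.1
  · rintro ⟨F, G, hF, hF', hG, hG', h⟩
    have hA : A.op ≤ 1 := A.2.2
    have hA0 : 0 ≤ A.op := A.2.1
    have h1 : A.op + F ≤ 1 := by rw [add_comm]; exact le_sub_iff_add_le.1 hF'
    refine ⟨⟨A.op - G, sub_nonneg.2 hG', (sub_le_self _ hG).trans hA⟩,
      ⟨F, hF, hF'.trans (sub_le_self _ hA0)⟩, ⟨G, hG, hG'.trans hA⟩,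
      ⟨A.op + F, add_nonneg hA0 hF, h1⟩, ?_, h, ?_⟩ <;> simp only [op] <;> abel

lemma Coex.symm {A B : H →L[ℂ] H} (h : Coex A B) : Coex B A := by
  obtain ⟨F, G, hF, hF', hG, hG', rfl⟩ := h
  refine ⟨A - G, G, sub_nonneg.2 hG', ?_, hG, le_add_of_nonneg_left hF, by abel⟩
  rw [le_sub_iff_add_le] at hF' ⊢
  calc A - G + (F + G) = F + A := by abel
    _ ≤ 1 := hF'

lemma coex_comm {A B : H →L[ℂ] H} : Coex A B ↔ Coex B A := ⟨Coex.symm, Coex.symm⟩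

lemma coex_compl_left {A B : H →L[ℂ] H} : Coex (1 - A) B ↔ Coex A B := by
  constructor
  · rintro ⟨F, G, hF, hF', hG, hG', rfl⟩
    exact ⟨G, F, hG, hG', hF, by rwa [sub_sub_cancel] at hF', add_comm _ _⟩
  · rintro ⟨F, G, hF, hF', hG, hG', rfl⟩
    exact ⟨G, F, hG, by rwa [sub_sub_cancel], hF, hF', add_comm _ _⟩

lemma coex_compl_right {A B : H →L[ℂ] H} : Coex A (1 - B) ↔ Coex A B := by
  rw [coex_comm, coex_compl_left, coex_comm]

lemma coex_of_commute {A B : H →L[ℂ] H} (hA : 0 ≤ A) (hA' : A ≤ 1) (hB : 0 ≤ B) (hB' : B ≤ 1)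
    (h : Commute A B) : Coex A B := by
  have h1 : Commute (1 - A) B := (Commute.one_left B).sub_left h
  have h2 : Commute A (1 - B) := (Commute.one_right A).sub_right h
  have h3 : Commute (1 - A) (1 - B) := (Commute.one_right _).sub_right h1
  refine ⟨(1 - A) * B, A * B, Commute.mul_nonneg (sub_nonneg.2 hA') hB h1, ?_,
    Commute.mul_nonneg hA hB h, ?_, by noncomm_ring⟩
  · have := Commute.mul_nonneg (sub_nonneg.2 hA') (sub_nonneg.2 hB') h3
    rwa [mul_sub, mul_one, sub_nonneg] at this
  · have := Commute.mul_nonneg hA (sub_nonneg.2 hB') h2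
    rwa [mul_sub, mul_one, sub_nonneg] at this

lemma coex_scalar {B : H →L[ℂ] H} {t : ℝ} (ht : 0 ≤ t) (ht' : t ≤ 1) (hB : 0 ≤ B) (hB' : B ≤ 1) :
    Coex (t • (1 : H →L[ℂ] H)) B :=
  coex_of_commute (smul_nonneg ht zero_le_one) (smul_le_of_le_one_left zero_le_one ht') hB hB'
    ((Commute.one_left B).smul_left t)

lemma mul_projection_eq_self_of_le {P G : H →L[ℂ] H} (hP : IsStarProjection P) (hG : 0 ≤ G)
    (h : G ≤ P) : G * P = G ∧ P * G = G := by
  have h1 : G * (1 - P) = 0 := mul_eq_zero_of_le hG h hP.mul_one_sub_self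
  have h2 : G * P = G := by rw [mul_sub, mul_one, sub_eq_zero] at h1; exact h1.symm
  refine ⟨h2, ?_⟩
  have := congrArg star h2
  rwa [star_mul, hP.isSelfAdjoint.star_eq, (IsSelfAdjoint.of_nonneg hG).star_eq] at this

lemma commute_of_coex_projection {P B : H →L[ℂ] H} (hP : IsStarProjection P) (h : Coex P B) :
    Commute P B := by
  obtain ⟨F, G, hF, hF', hG, hG', rfl⟩ := h
  obtain ⟨h1, h2⟩ := mul_projection_eq_self_of_le hP hG hG'
  obtain ⟨h3, h4⟩ := mul_projection_eq_self_of_le hP.one_sub hF hF'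
  have h5 : F * P = 0 := by rw [mul_sub, mul_one, sub_eq_self] at h3; exact h3
  have h6 : P * F = 0 := by rw [sub_mul, one_mul, sub_eq_self] at h4; exact h4
  rw [Commute, SemiconjBy, mul_add, add_mul, h1, h2, h5, h6]

lemma coex_projection_iff {P B : H →L[ℂ] H} (hP : IsStarProjection P) (hB : 0 ≤ B) (hB' : B ≤ 1) :
    Coex P B ↔ Commute P B :=
  ⟨commute_of_coex_projection hP, coex_of_commute hP.zero_le hP.le_one' hB hB'⟩

lemma coex_smul_ray_iff {A : H →L[ℂ] H} {y : H} {s : ℝ} (hy : y ≠ 0) :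
    Coex A (s • ray y) ↔
      ∃ a b : ℝ, 0 ≤ a ∧ 0 ≤ b ∧ a + b = s ∧ a • ray y ≤ A ∧ b • ray y ≤ 1 - A := by
  constructor
  · rintro ⟨F, G, hF, hF', hG, hG', h⟩
    obtain ⟨b, hb, rfl⟩ := eq_smul_ray_of_le hy hF (h ▸ le_add_of_nonneg_right hG)
    obtain ⟨a, ha, rfl⟩ := eq_smul_ray_of_le hy hG (h ▸ le_add_of_nonneg_left hF)
    refine ⟨a, b, ha, hb, ?_, hG', hF'⟩
    rw [← add_smul] at h
    have hne : ray y ≠ 0 := InnerProductSpace.rankOne_ne_zero hy hy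
    rw [add_comm]
    exact (smul_left_injective ℝ hne h).symm
  · rintro ⟨a, b, ha, hb, rfl, h1, h2⟩
    exact ⟨b • ray y, a • ray y, smul_nonneg hb (ray_nonneg y), h2, smul_nonneg ha (ray_nonneg y),
      h1, by rw [← add_smul, add_comm]⟩

/-- A projection reducing two coexistent operators, one of which is scalar on its range, puts no
condition on the other one there: both may be changed on its range. -/
lemma Coex.change_block {W A A' B B' : H →L[ℂ] H} {a : ℝ} (hW : IsStarProjection W)
    (hA : A' * (1 - W) = A * (1 - W)) (hA1 : A' * W = a • W) (ha : 0 ≤ a) (ha' : a ≤ 1)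
    (hAW : Commute W A) (hBW : Commute W B)
    (hB : B' * (1 - W) = B * (1 - W)) (hBW' : Commute W B') (hB0 : 0 ≤ B') (hB1 : B' ≤ 1)
    (h : Coex A B) : Coex A' B' := by
  obtain ⟨F, G, hF, hF', hG, hG', rfl⟩ := h
  set V := 1 - W with hV
  have hVp : IsStarProjection V := hW.one_sub
  have hWV : W + V = 1 := by rw [hV]; abel
  have hVA : Commute V A := (Commute.one_left A).sub_left hAW
  have hVB : Commute V (F + G) := (Commute.one_left _).sub_left hBW
  have hVV : V * V = V := hVp.isIdempotentElem.eq
  have hWW : W * W = W := hW.isIdempotentElem.eq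
  have hA' : A' = a • W + V * A * V := by
    calc A' = A' * W + A' * V := by rw [← mul_add, hWV, mul_one]
      _ = a • W + V * A * V := by rw [hA1, hA, hVA.eq, mul_assoc, hVV]
  have hWB : W * B' * W = B' * W := by rw [hBW'.eq, mul_assoc, hWW]
  have hW0 : 0 ≤ W * B' * W := hW.isSelfAdjoint.conjugate_nonneg hB0
  have hW1 : W * B' * W ≤ W := by
    have := hW.isSelfAdjoint.conjugate_le_conjugate hB1
    rwa [mul_one, hWW] at this
  refine ⟨(1 - a) • (W * B' * W) + V * F * V, a • (W * B' * W) + V * G * V, ?_, ?_, ?_, ?_, ?_⟩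
  · exact add_nonneg (smul_nonneg (by linarith) hW0) (hVp.isSelfAdjoint.conjugate_nonneg hF)
  · have h1 := hVp.isSelfAdjoint.conjugate_le_conjugate hF'
    have h2 : V * (1 - A) * V = V - V * A * V := by
      rw [mul_sub V, sub_mul (V * 1), mul_one, hVV]
    have h3 : (1 : H →L[ℂ] H) - A' = (1 - a) • W + (V - V * A * V) := by
      rw [hA', ← hWV, sub_smul, one_smul]; abel
    rw [h3, ← h2]
    exact add_le_add (smul_le_smul_of_nonneg_left hW1 (by linarith)) h1
  · exact add_nonneg (smul_nonneg ha hW0) (hVp.isSelfAdjoint.conjugate_nonneg hG)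
  · rw [hA']
    exact add_le_add (smul_le_smul_of_nonneg_left hW1 ha)
      (hVp.isSelfAdjoint.conjugate_le_conjugate hG')
  · calc B' = B' * W + B' * V := by rw [← mul_add, hWV, mul_one]
      _ = W * B' * W + V * (F + G) * V := by rw [hWB, hB, hVB.eq, mul_assoc, hVV]
      _ = _ := by rw [sub_smul, one_smul]; noncomm_ring

end Effect

/-! ### Spectral projections -/

namespace Effect

variable {H : Type*} [NormedAddCommGroup H] [InnerProductSpace ℂ H] [CompleteSpace H]

/-- The support projection of an operator: the orthogonal projection onto `(ker S)ᗮ`. -/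
noncomputable def suppProj (S : H →L[ℂ] H) : H →L[ℂ] H := (S.kerᗮ).starProjection

lemma suppProj_isStarProjection (S : H →L[ℂ] H) : IsStarProjection (suppProj S) :=
  isStarProjection_starProjection

lemma suppProj_apply_eq_zero_iff (S : H →L[ℂ] H) (x : H) : suppProj S x = 0 ↔ S x = 0 := by
  have hc : IsClosed (S.ker : Set H) := S.isClosed_ker
  have : CompleteSpace S.ker := hc.completeSpace_coe
  rw [suppProj, Submodule.starProjection_apply_eq_zero_iff, Submodule.orthogonal_orthogonal]
  rfl

lemma apply_suppProj (S : H →L[ℂ] H) (x : H) : S (suppProj S x) = S x := by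
  have h : suppProj S (x - suppProj S x) = 0 := by
    rw [map_sub, projection_apply_apply (suppProj_isStarProjection S), sub_self]
  rw [suppProj_apply_eq_zero_iff, map_sub, sub_eq_zero] at h
  exact h.symm

lemma eq_zero_of_suppProj {S : H →L[ℂ] H} {x : H} (hx : suppProj S x = x) (h : S x = 0) :
    x = 0 := by
  rw [← hx]
  exact (suppProj_apply_eq_zero_iff S x).2 h

lemma suppProj_mul_eq_zero {S Y : H →L[ℂ] H} (h : S * Y = 0) : suppProj S * Y = 0 := by
  ext x
  have : S (Y x) = 0 := by rw [← mul_apply_eq_comp, h]; rfl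
  simpa using (suppProj_apply_eq_zero_iff S _).2 this

lemma suppProj_commute {S X : H →L[ℂ] H} (hS : IsSelfAdjoint S) (h : Commute X S) :
    Commute X (suppProj S) := by
  have hE := suppProj_isStarProjection S
  set E := suppProj S with hEdef
  have key : ∀ Y : H →L[ℂ] H, Commute Y S → E * Y * (1 - E) = 0 := fun Y hY => by
    have h0 : S * (1 - E) = 0 := by
      ext x
      simp [hEdef, apply_suppProj]
    rw [mul_assoc]
    refine suppProj_mul_eq_zero ?_
    rw [← mul_assoc, ← hY.eq, mul_assoc, h0, mul_zero]
  have h1 := key X h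
  have h2 := key (star X) (by
    have := congrArg star h.eq
    rw [star_mul, star_mul, hS.star_eq] at this
    exact this.symm)
  have h3 : (1 - E) * X * E = 0 := by
    have := congrArg star h2
    rwa [star_mul, star_mul, star_star, hE.isSelfAdjoint.star_eq, hE.one_sub.isSelfAdjoint.star_eq,
      star_zero, ← mul_assoc] at this
  rw [mul_sub, mul_one, sub_eq_zero] at h1
  rw [sub_mul, one_mul, sub_mul, sub_eq_zero] at h3
  rw [Commute, SemiconjBy, h3, ← h1]

/-- The spectral projection of a self-adjoint operator for the interval `(0, ∞)`. -/
noncomputable def specProj (T : H →L[ℂ] H) : H →L[ℂ] H := suppProj T⁺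

lemma specProj_isStarProjection (T : H →L[ℂ] H) : IsStarProjection (specProj T) :=
  suppProj_isStarProjection _

lemma posPart_isSelfAdjoint (T : H →L[ℂ] H) : IsSelfAdjoint T⁺ :=
  .of_nonneg (CFC.posPart_nonneg T)

lemma specProj_mul_posPart (T : H →L[ℂ] H) : specProj T * T⁺ = T⁺ := by
  have h : T⁺ * specProj T = T⁺ := by
    ext x
    simp [specProj, apply_suppProj]
  have := congrArg star h
  rwa [star_mul, (posPart_isSelfAdjoint T).star_eq,
    (specProj_isStarProjection T).isSelfAdjoint.star_eq] at this

lemma specProj_mul_negPart (T : H →L[ℂ] H) : specProj T * T⁻ = 0 :=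
  suppProj_mul_eq_zero (CFC.posPart_mul_negPart T)

lemma specProj_commute {T X : H →L[ℂ] H} (h : Commute X T) : Commute X (specProj T) := by
  refine suppProj_commute (posPart_isSelfAdjoint T) ?_
  rw [CFC.posPart_def]
  exact (h.symm.cfcₙ_real _).symm

lemma specProj_mul_self {T : H →L[ℂ] H} (hT : IsSelfAdjoint T) : specProj T * T = T⁺ := by
  calc specProj T * T = specProj T * (T⁺ - T⁻) := by rw [CFC.posPart_sub_negPart T hT]
    _ = T⁺ := by rw [mul_sub, specProj_mul_posPart, specProj_mul_negPart, sub_zero]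

lemma one_sub_specProj_mul_self {T : H →L[ℂ] H} (hT : IsSelfAdjoint T) :
    (1 - specProj T) * T = -T⁻ := by
  rw [sub_mul, one_mul, specProj_mul_self hT]
  nth_rewrite 1 [← CFC.posPart_sub_negPart T hT]
  abel

/-- An operator commuting with all the projections in the bicommutant of an effect `A` commutes
with `A`. Subtracting half of the spectral projection for `(1/2, 1]` leaves twice as small an
operator of the same kind, so the commutator is bounded by `2 ‖C‖ / 2 ^ n` for all `n`. -/
lemma commute_of_forall_projection {A C : H →L[ℂ] H} (hA : 0 ≤ A) (hA' : A ≤ 1)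
    (h : ∀ E, IsStarProjection E → (∀ X, Commute X A → Commute X E) → Commute C E) :
    Commute C A := by
  have main : ∀ n : ℕ, ∀ A : H →L[ℂ] H, 0 ≤ A → A ≤ 1 →
      (∀ E, IsStarProjection E → (∀ X, Commute X A → Commute X E) → Commute C E) →
      ‖C * A - A * C‖ ≤ 2 * ‖C‖ / 2 ^ n := by
    intro n
    induction n with
    | zero =>
      intro A hA hA' _
      have hn : ‖A‖ ≤ 1 := (CStarAlgebra.norm_le_one_iff_of_nonneg A hA).2 hA'
      calc ‖C * A - A * C‖ ≤ ‖C * A‖ + ‖A * C‖ := norm_sub_le _ _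
        _ ≤ ‖C‖ * ‖A‖ + ‖A‖ * ‖C‖ := add_le_add (norm_mul_le _ _) (norm_mul_le _ _)
        _ ≤ ‖C‖ * 1 + 1 * ‖C‖ := by gcongr
        _ = 2 * ‖C‖ / 2 ^ 0 := by ring
    | succ n ih =>
      intro A hA hA' h
      set T : H →L[ℂ] H := A - (1 / 2 : ℝ) • 1 with hT
      have hTsa : IsSelfAdjoint T :=
        (IsSelfAdjoint.of_nonneg hA).sub (isSelfAdjoint_real_smul _ (.one _))
      set E := specProj T with hEdef
      have hE : IsStarProjection E := specProj_isStarProjection T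
      have hEA : ∀ X, Commute X A → Commute X E := fun X hX =>
        specProj_commute (hX.sub_right ((Commute.one_right X).smul_right _))
      have hEE := hE.isIdempotentElem.eq
      have hcom : Commute E A := (hEA A rfl).symm
      set D : H →L[ℂ] H := (2 : ℝ) • A - E with hD
      have hA2 : A = (1 / 2 : ℝ) • D + (1 / 2 : ℝ) • E := by
        rw [hD, smul_sub, smul_smul]; norm_num
      have e1 : E * A = T⁺ + (1 / 2 : ℝ) • E := by
        have : A = T + (1 / 2 : ℝ) • 1 := by rw [hT]; abel
        nth_rewrite 1 [this]
        rw [mul_add, specProj_mul_self hTsa, mul_smul_comm, mul_one]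
      have e2 : (1 - E) * A = -T⁻ + (1 / 2 : ℝ) • (1 - E) := by
        have : A = T + (1 / 2 : ℝ) • 1 := by rw [hT]; abel
        nth_rewrite 1 [this]
        rw [mul_add, one_sub_specProj_mul_self hTsa, mul_smul_comm, mul_one]
      have hcom' : Commute (1 - E) A := (Commute.one_left A).sub_left hcom
      have hD0 : 0 ≤ D := by
        have h1 : D = (2 : ℝ) • ((1 - E) * A) + (2 : ℝ) • T⁺ := by
          have : T⁺ = E * A - (1 / 2 : ℝ) • E := by rw [e1]; abel
          rw [hD, this, sub_mul, one_mul, smul_sub, smul_sub, smul_smul]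
          norm_num
        rw [h1]
        exact add_nonneg (smul_nonneg zero_le_two
          (Commute.mul_nonneg hE.one_sub.zero_le hA hcom'))
          (smul_nonneg zero_le_two (CFC.posPart_nonneg T))
      have hD1 : D ≤ 1 := by
        have h1 : 1 - D = (2 : ℝ) • (E * (1 - A)) + (2 : ℝ) • T⁻ := by
          have : T⁻ = (1 / 2 : ℝ) • (1 - E) - (1 - E) * A := by rw [e2]; abel
          rw [hD, this, sub_mul, one_mul, mul_sub, mul_one]
          module
        rw [← sub_nonneg, h1]
        exact add_nonneg (smul_nonneg zero_le_two
          (Commute.mul_nonneg hE.zero_le (sub_nonneg.2 hA')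
            ((Commute.one_right E).sub_right hcom)))
          (smul_nonneg zero_le_two (CFC.negPart_nonneg T))
      have hCE : Commute C E := h E hE hEA
      have hDA : ∀ X, Commute X A → Commute X D := fun X hX =>
        (hX.smul_right _).sub_right (hEA X hX)
      have := ih D hD0 hD1 fun F hF hF' => h F hF fun X hX => hF' X (hDA X hX)
      have h2 : C * A - A * C = (1 / 2 : ℝ) • (C * D - D * C) := by
        have : C * E = E * C := hCE.eq
        rw [hA2, mul_add, add_mul, mul_smul_comm, mul_smul_comm, smul_mul_assoc, smul_mul_assoc,
          this, smul_sub]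
        abel
      rw [h2, norm_smul, pow_succ]
      calc ‖(1 / 2 : ℝ)‖ * ‖C * D - D * C‖ ≤ (1 / 2) * (2 * ‖C‖ / 2 ^ n) := by
            rw [Real.norm_of_nonneg (by norm_num)]; gcongr
        _ = 2 * ‖C‖ / (2 ^ n * 2) := by field_simp
  have hle : ∀ n : ℕ, ‖C * A - A * C‖ ≤ 2 * ‖C‖ / 2 ^ n := fun n => main n A hA hA' h
  have hlim : Filter.Tendsto (fun n : ℕ => 2 * ‖C‖ / 2 ^ n) Filter.atTop (nhds 0) := by
    have := (tendsto_pow_atTop_nhds_zero_of_lt_one (r := (1 / 2 : ℝ)) (by norm_num)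
      (by norm_num)).const_mul (2 * ‖C‖)
    simpa [div_eq_mul_inv] using this
  have h0 : ‖C * A - A * C‖ ≤ 0 := ge_of_tendsto' hlim hle
  exact sub_eq_zero.1 (norm_le_zero_iff.1 h0)

lemma qf_real_smul_one (c : ℝ) (z : H) : qf (c • (1 : H →L[ℂ] H)) z = c * ‖z‖ ^ 2 := by
  rw [qf_smul, qf_one]

lemma isSelfAdjoint_smul_one (c : ℝ) : IsSelfAdjoint (c • (1 : H →L[ℂ] H)) :=
  isSelfAdjoint_real_smul _ (.one _)

lemma exists_not_comparable_scalar {A : H →L[ℂ] H} (hA : 0 ≤ A) (hA' : A ≤ 1)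
    (hns : ¬ ∃ t : ℝ, 0 ≤ t ∧ t ≤ 1 ∧ A = t • 1) :
    ∃ c : ℝ, 0 < c ∧ c < 1 ∧ ¬ A ≤ c • 1 ∧ ¬ c • 1 ≤ A := by
  by_contra! hcon
  have hsa : IsSelfAdjoint A := .of_nonneg hA
  have hcon' : ∀ c : ℝ, ¬ A ≤ c • 1 → c • 1 ≤ A := by
    intro c hc
    by_cases h0 : 0 < c
    · by_cases h1 : c < 1
      · exact hcon c h0 h1 hc
      · refine absurd (hA'.trans ?_) hc
        rw [le_iff_qf (.one _) (isSelfAdjoint_smul_one c)]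
        intro z
        rw [qf_one, qf_real_smul_one]
        nlinarith [sq_nonneg ‖z‖]
    · refine le_trans ?_ hA
      rw [le_iff_qf (isSelfAdjoint_smul_one c) (.zero _)]
      intro z
      rw [qf_zero, qf_real_smul_one]
      nlinarith [sq_nonneg ‖z‖]
  have hnt : ∃ x : H, x ≠ 0 := by
    by_contra! hx
    exact hns ⟨0, le_rfl, zero_le_one, by ext x; simp [hx x]⟩
  obtain ⟨x, hx⟩ := hnt
  set s := {c : ℝ | c • (1 : H →L[ℂ] H) ≤ A} with hs
  have hmem : ∀ c ∈ s, ∀ z : H, c * ‖z‖ ^ 2 ≤ qf A z := fun c hc z => by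
    have := qf_mono (show c • (1 : H →L[ℂ] H) ≤ A from hc) z
    rwa [qf_real_smul_one] at this
  have hdiv : ∀ c ∈ s, ∀ z : H, z ≠ 0 → c ≤ qf A z / ‖z‖ ^ 2 := fun c hc z hz => by
    rw [le_div_iff₀ (by positivity)]
    exact hmem c hc z
  have hne : s.Nonempty := ⟨0, by simpa [hs] using hA⟩
  have hbdd : BddAbove s := ⟨qf A x / ‖x‖ ^ 2, fun c hc => hdiv c hc x hx⟩
  have h1 : ∀ z, sSup s * ‖z‖ ^ 2 ≤ qf A z := by
    intro z
    by_cases hz : z = 0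
    · simp [hz, qf]
    · rw [← le_div_iff₀ (by positivity)]
      exact csSup_le hne fun c hc => hdiv c hc z hz
  have h2 : ∀ z, qf A z ≤ sSup s * ‖z‖ ^ 2 := by
    intro z
    refine le_of_forall_pos_le_add fun ε hε => ?_
    set d := ε / (‖z‖ ^ 2 + 1) with hd
    have hdpos : 0 < d := by positivity
    have hnot : ¬ (sSup s + d) • (1 : H →L[ℂ] H) ≤ A := fun h => by
      have := le_csSup hbdd (show sSup s + d ∈ s from h)
      linarith
    have hle : A ≤ (sSup s + d) • 1 := by
      by_contra hc
      exact hnot (hcon' _ hc)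
    have := qf_mono hle z
    rw [qf_real_smul_one] at this
    have hdz : d * ‖z‖ ^ 2 ≤ ε := by
      rw [hd, div_mul_eq_mul_div, div_le_iff₀ (by positivity)]
      nlinarith [sq_nonneg ‖z‖]
    nlinarith
  have hAeq : A = sSup s • 1 := ext_qf hsa (isSelfAdjoint_smul_one _) fun z => by
    rw [qf_real_smul_one]
    exact le_antisymm (h2 z) (h1 z)
  refine hns ⟨sSup s, le_csSup hbdd (by simpa [hs] using hA), ?_, hAeq⟩
  refine csSup_le hne fun c hc => ?_
  have h3 := hmem c hc x
  have h4 := qf_mono hA' x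
  rw [qf_one] at h4
  have h5 : (0 : ℝ) < ‖x‖ ^ 2 := by positivity
  by_contra! h6
  nlinarith

/-- A non-scalar effect is cut by a spectral projection into a part strictly above some `c` and a
nonzero part below `c`. -/
lemma exists_cut {A : H →L[ℂ] H} (hA : 0 ≤ A) (hA' : A ≤ 1)
    (hns : ¬ ∃ t : ℝ, 0 ≤ t ∧ t ≤ 1 ∧ A = t • 1) :
    ∃ (c : ℝ) (E : H →L[ℂ] H), 0 < c ∧ c < 1 ∧ IsStarProjection E ∧
      (∀ X, Commute X A → Commute X E) ∧ (∃ x, x ≠ 0 ∧ E x = x) ∧ (∃ x, x ≠ 0 ∧ E x = 0) ∧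
      (∀ x, x ≠ 0 → E x = x → c * ‖x‖ ^ 2 < qf A x) ∧ ∀ x, E x = 0 → qf A x ≤ c * ‖x‖ ^ 2 := by
  obtain ⟨c, hc0, hc1, h1, h2⟩ := exists_not_comparable_scalar hA hA' hns
  set T : H →L[ℂ] H := A - c • 1 with hT
  have hTsa : IsSelfAdjoint T := (IsSelfAdjoint.of_nonneg hA).sub (isSelfAdjoint_smul_one c)
  have hE := specProj_isStarProjection T
  have hAT : A = T + c • 1 := by rw [hT]; abel
  have hTpn := CFC.posPart_sub_negPart T hTsa
  have hTp : T⁺ ≠ 0 := fun h0 => h1 (by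
    rw [hAT, ← hTpn, h0, zero_sub]
    simpa using CFC.negPart_nonneg T)
  have hTn : T⁻ ≠ 0 := fun h0 => h2 (by
    rw [hAT, ← hTpn, h0, sub_zero]
    simpa using CFC.posPart_nonneg T)
  have hqf : ∀ x, qf A x = qf T⁺ x - qf T⁻ x + c * ‖x‖ ^ 2 := fun x => by
    rw [← qf_sub, hTpn, ← qf_real_smul_one, ← qf_add, ← hAT]
  refine ⟨c, specProj T, hc0, hc1, hE, fun X hX =>
    specProj_commute (hX.sub_right ((Commute.one_right X).smul_right _)), ?_, ?_, ?_, ?_⟩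
  · obtain ⟨x, hx⟩ : ∃ x, T⁺ x ≠ 0 := by
      by_contra! h
      exact hTp (by ext x; simpa using h x)
    refine ⟨T⁺ x, hx, ?_⟩
    rw [← mul_apply_eq_comp, specProj_mul_posPart]
  · obtain ⟨x, hx⟩ : ∃ x, T⁻ x ≠ 0 := by
      by_contra! h
      exact hTn (by ext x; simpa using h x)
    refine ⟨T⁻ x, hx, ?_⟩
    rw [← mul_apply_eq_comp, specProj_mul_negPart]
    rfl
  · intro x hx hEx
    have h3 : T⁻ x = 0 := by
      have h4 := congrArg star (specProj_mul_negPart T)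
      rw [star_mul, hE.isSelfAdjoint.star_eq,
        (IsSelfAdjoint.of_nonneg (CFC.negPart_nonneg T)).star_eq, star_zero] at h4
      rw [← hEx, ← mul_apply_eq_comp, h4]
      rfl
    have h5 : 0 < qf T⁺ x := by
      refine lt_of_le_of_ne (qf_nonneg (CFC.posPart_nonneg T) x) fun h => hx ?_
      exact eq_zero_of_suppProj hEx (apply_eq_zero_of_qf (CFC.posPart_nonneg T) h.symm)
    rw [hqf]
    have : qf T⁻ x = 0 := by simp [qf, h3]
    linarith
  · intro x hx
    have h3 : T⁺ x = 0 := (suppProj_apply_eq_zero_iff _ _).1 hx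
    rw [hqf]
    have h4 : qf T⁺ x = 0 := by simp [qf, h3]
    have h5 := qf_nonneg (CFC.negPart_nonneg T) x
    linarith

end Effect

/-! ### The inverse quadratic form of a positive operator -/

namespace Effect

open scoped ENNReal

variable {H : Type*} [NormedAddCommGroup H] [InnerProductSpace ℂ H] [CompleteSpace H]

/-- The resolvent `(A + 1/(n+1))⁻¹` of a positive operator. -/
noncomputable def resolv (A : H →L[ℂ] H) (n : ℕ) : H →L[ℂ] H :=
  Ring.inverse (A + ((n : ℝ) + 1)⁻¹ • 1)

/-- The extended quadratic form `x ↦ ⟨A⁻¹x, x⟩ ∈ [0, ∞]` of a positive operator `A`, as a supremum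
of forms of resolvents; it is finite exactly on the range of the square root of `A`. -/
noncomputable def invForm (A : H →L[ℂ] H) (x : H) : ℝ≥0∞ :=
  ⨆ n : ℕ, ENNReal.ofReal (qf (resolv A n) x)

lemma shift_isStrictlyPositive {A : H →L[ℂ] H} (hA : 0 ≤ A) (n : ℕ) :
    IsStrictlyPositive (A + ((n : ℝ) + 1)⁻¹ • (1 : H →L[ℂ] H)) :=
  IsStrictlyPositive.nonneg_add hA (IsStrictlyPositive.smul (by positivity) isStrictlyPositive_one)

lemma resolv_nonneg {A : H →L[ℂ] H} (hA : 0 ≤ A) (n : ℕ) : 0 ≤ resolv A n :=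
  (shift_isStrictlyPositive hA n).ringInverse.nonneg

lemma resolv_mono {A : H →L[ℂ] H} (hA : 0 ≤ A) : Monotone (resolv A) := by
  intro n m hnm
  refine CStarAlgebra.ringInverse_le_ringInverse ?_ (shift_isStrictlyPositive hA m)
  gcongr

lemma shift_mul_resolv {A : H →L[ℂ] H} (hA : 0 ≤ A) (n : ℕ) (x : H) :
    (A + ((n : ℝ) + 1)⁻¹ • (1 : H →L[ℂ] H)) (resolv A n x) = x := by
  rw [← mul_apply_eq_comp, resolv,
    Ring.mul_inverse_cancel _ (shift_isStrictlyPositive hA n).isUnit]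
  rfl

lemma qf_parallelogram (A : H →L[ℂ] H) (x y : H) :
    qf A (x + y) + qf A (x - y) = 2 * qf A x + 2 * qf A y := by
  simp only [qf, map_add, map_sub, inner_add_left, inner_sub_left, inner_add_right,
    inner_sub_right, Complex.add_re, Complex.sub_re]
  ring

lemma qf_complex_smul (A : H →L[ℂ] H) (c : ℂ) (x : H) : qf A (c • x) = ‖c‖ ^ 2 * qf A x := by
  have h : inner ℂ (A (c • x)) (c • x) = ((‖c‖ ^ 2 : ℝ) : ℂ) * inner ℂ (A x) x := by
    rw [map_smul, inner_smul_left, inner_smul_right, ← mul_assoc, Complex.conj_mul']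
    push_cast
    rfl
  rw [qf, h, Complex.re_ofReal_mul, qf]

lemma invForm_monotone {A : H →L[ℂ] H} (hA : 0 ≤ A) (x : H) :
    Monotone fun n => ENNReal.ofReal (qf (resolv A n) x) := fun _ _ h =>
  ENNReal.ofReal_le_ofReal (qf_mono (resolv_mono hA h) x)

/-- The operator `a |x⟩⟨x|` lies below `A` exactly when `a ⟨A⁻¹x, x⟩ ≤ 1`. -/
lemma smul_ray_le_iff {A : H →L[ℂ] H} (hA : 0 ≤ A) {a : ℝ} (ha : 0 ≤ a) (x : H) :
    a • ray x ≤ A ↔ ENNReal.ofReal a * invForm A x ≤ 1 := by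
  have hpt : a • ray x ≤ A ↔ ∀ n, a * qf (resolv A n) x ≤ 1 := by
    constructor
    · intro h n
      set z := resolv A n x with hz
      have hr : 0 ≤ qf (resolv A n) x := qf_nonneg (resolv_nonneg hA n) x
      have h1 := qf_mono h z
      rw [qf_smul, qf_ray] at h1
      have h2 : qf A z ≤ qf (resolv A n) x := by
        have h3 : qf (A + ((n : ℝ) + 1)⁻¹ • (1 : H →L[ℂ] H)) z = qf (resolv A n) x := by
          rw [qf, hz, shift_mul_resolv hA, qf]
          exact inner_re_symm (𝕜 := ℂ) _ _
        rw [← h3, qf_add, qf_real_smul_one]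
        have : 0 ≤ ((n : ℝ) + 1)⁻¹ * ‖z‖ ^ 2 := by positivity
        linarith
      have h4 : qf (resolv A n) x ≤ ‖inner ℂ x z‖ := by
        rw [qf, ← hz]
        have := inner_re_symm (𝕜 := ℂ) z x
        calc (inner ℂ z x).re = (inner ℂ x z).re := this
          _ ≤ ‖inner ℂ x z‖ := Complex.re_le_norm _
      by_contra! hc
      have h5 : a * qf (resolv A n) x ^ 2 ≤ a * ‖inner ℂ x z‖ ^ 2 := by gcongr
      have hpos : 0 < qf (resolv A n) x := by
        rcases hr.lt_or_eq with h6 | h6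
        · exact h6
        · rw [← h6] at hc; norm_num at hc
      nlinarith
    · intro h
      rw [le_iff_qf (isSelfAdjoint_real_smul _ (ray_isSelfAdjoint x)) (.of_nonneg hA)]
      intro z
      rw [qf_smul, qf_ray]
      have hn : ∀ n : ℕ, a * ‖inner ℂ x z‖ ^ 2 ≤ qf A z + ((n : ℝ) + 1)⁻¹ * ‖z‖ ^ 2 := by
        intro n
        have hpos := (shift_isStrictlyPositive hA n).nonneg
        have h1 := norm_inner_apply_sq_le hpos (resolv A n x) z
        rw [shift_mul_resolv hA] at h1
        have h2 : qf (A + ((n : ℝ) + 1)⁻¹ • (1 : H →L[ℂ] H)) (resolv A n x)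
            = qf (resolv A n) x := by
          rw [qf, shift_mul_resolv hA, qf]
          exact inner_re_symm (𝕜 := ℂ) _ _
        have h3 : qf (A + ((n : ℝ) + 1)⁻¹ • (1 : H →L[ℂ] H)) z
            = qf A z + ((n : ℝ) + 1)⁻¹ * ‖z‖ ^ 2 := by rw [qf_add, qf_real_smul_one]
        rw [h2, h3] at h1
        have h4 : 0 ≤ qf A z + ((n : ℝ) + 1)⁻¹ * ‖z‖ ^ 2 :=
          add_nonneg (qf_nonneg hA z) (by positivity)
        calc a * ‖inner ℂ x z‖ ^ 2
            ≤ a * (qf (resolv A n) x * (qf A z + ((n : ℝ) + 1)⁻¹ * ‖z‖ ^ 2)) := by gcongr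
          _ = (a * qf (resolv A n) x) * (qf A z + ((n : ℝ) + 1)⁻¹ * ‖z‖ ^ 2) := by ring
          _ ≤ 1 * (qf A z + ((n : ℝ) + 1)⁻¹ * ‖z‖ ^ 2) :=
            mul_le_mul_of_nonneg_right (h n) h4
          _ = _ := one_mul _
      have hlim : Filter.Tendsto (fun n : ℕ => qf A z + ((n : ℝ) + 1)⁻¹ * ‖z‖ ^ 2) Filter.atTop
          (nhds (qf A z)) := by
        have h5 : Filter.Tendsto (fun n : ℕ => ((n : ℝ) + 1)⁻¹) Filter.atTop (nhds 0) := by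
          simpa using tendsto_one_div_add_atTop_nhds_zero_nat (𝕜 := ℝ)
        simpa using (h5.mul_const (‖z‖ ^ 2)).const_add (qf A z)
      exact ge_of_tendsto' hlim hn
  rw [hpt, invForm, ENNReal.mul_iSup, iSup_le_iff]
  refine forall_congr' fun n => ?_
  rw [← ENNReal.ofReal_mul ha, ENNReal.ofReal_le_one]

/-- The functional equations of an extended quadratic form. -/
structure IsQuad (q : H → ℝ≥0∞) : Prop where
  par : ∀ x y, q (x + y) + q (x - y) = 2 * q x + 2 * q y
  smul : ∀ (c : ℂ) x, q (c • x) = ENNReal.ofReal (‖c‖ ^ 2) * q x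

lemma invForm_isQuad {A : H →L[ℂ] H} (hA : 0 ≤ A) : IsQuad (invForm A) where
  par x y := by
    have hm := invForm_monotone hA
    simp only [invForm]
    rw [ENNReal.iSup_add_iSup_of_monotone (hm _) (hm _), ENNReal.mul_iSup, ENNReal.mul_iSup,
      ENNReal.iSup_add_iSup_of_monotone ((hm x).const_mul' 2) ((hm y).const_mul' 2)]
    congr 1
    ext n
    have hq := fun z => qf_nonneg (resolv_nonneg hA n) z
    have h2 : (2 : ℝ≥0∞) = ENNReal.ofReal 2 := by simp
    rw [h2, ← ENNReal.ofReal_mul zero_le_two, ← ENNReal.ofReal_mul zero_le_two,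
      ← ENNReal.ofReal_add (hq _) (hq _), ← ENNReal.ofReal_add, qf_parallelogram]
    · have := hq x; linarith
    · have := hq y; linarith
  smul c x := by
    simp only [invForm]
    rw [ENNReal.mul_iSup]
    congr 1
    ext n
    rw [qf_complex_smul, ENNReal.ofReal_mul (by positivity)]

namespace IsQuad

variable {q : H → ℝ≥0∞}

lemma zero (hq : IsQuad q) : q 0 = 0 := by simpa using hq.smul 0 0

lemma neg (hq : IsQuad q) (x : H) : q (-x) = q x := by simpa using hq.smul (-1) x

lemma add_ne_top (hq : IsQuad q) {x y : H} (hx : q x ≠ ⊤) (hy : q y ≠ ⊤) : q (x + y) ≠ ⊤ := by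
  have h := hq.par x y
  intro h1
  rw [h1, top_add] at h
  exact (ENNReal.add_ne_top.2 ⟨ENNReal.mul_ne_top (by simp) hx, ENNReal.mul_ne_top (by simp) hy⟩)
    h.symm

lemma sub_ne_top (hq : IsQuad q) {x y : H} (hx : q x ≠ ⊤) (hy : q y ≠ ⊤) : q (x - y) ≠ ⊤ := by
  rw [sub_eq_add_neg]
  exact hq.add_ne_top hx (by rwa [hq.neg])

end IsQuad

lemma invForm_add_of_commute {A E : H →L[ℂ] H} (hA : 0 ≤ A) (hE : IsStarProjection E)
    (h : Commute E A) (x : H) : invForm A x = invForm A (E x) + invForm A (x - E x) := by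
  have hm := invForm_monotone hA
  simp only [invForm]
  rw [ENNReal.iSup_add_iSup_of_monotone (hm _) (hm _)]
  congr 1
  ext n
  have hq := fun z => qf_nonneg (resolv_nonneg hA n) z
  rw [← ENNReal.ofReal_add (hq _) (hq _)]
  congr 1
  set R := resolv A n with hR
  have hRsa : IsSelfAdjoint R := .of_nonneg (resolv_nonneg hA n)
  have hu := (shift_isStrictlyPositive hA n).isUnit
  have hc : Commute E (A + ((n : ℝ) + 1)⁻¹ • (1 : H →L[ℂ] H)) :=
    h.add_right ((Commute.one_right E).smul_right _)
  have hcR : Commute E R := by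
    set S := A + ((n : ℝ) + 1)⁻¹ • (1 : H →L[ℂ] H) with hS
    have h1 : S * R = 1 := Ring.mul_inverse_cancel _ hu
    have h2 : R * S = 1 := Ring.inverse_mul_cancel _ hu
    calc E * R = R * S * E * R := by rw [h2, one_mul]
      _ = R * (E * S) * R := by rw [hc.eq]; noncomm_ring
      _ = R * E := by rw [mul_assoc, mul_assoc, h1, mul_one]
  have hER : ∀ y, E (R y) = R (E y) := fun y => by
    rw [← mul_apply_eq_comp, hcR.eq, mul_apply_eq_comp]
  have hx0 : inner ℂ (R (E x)) (x - E x) = 0 := by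
    rw [← hER, inner_apply_comm hE.isSelfAdjoint, map_sub, projection_apply_apply hE, sub_self,
      inner_zero_right]
  have hx1 : inner ℂ (R (x - E x)) (E x) = 0 := by
    rw [← inner_apply_comm hE.isSelfAdjoint, hER, map_sub, projection_apply_apply hE, sub_self,
      map_zero, inner_zero_left]
  have hxx : x = E x + (x - E x) := by abel
  have : qf R x = qf R (E x + (x - E x)) := by rw [← hxx]
  rw [this]
  simp only [qf, map_add, inner_add_left, inner_add_right, hx0, hx1, add_zero, zero_add,
    Complex.add_re]

lemma invForm_apply_ne_top {A : H →L[ℂ] H} (hA : 0 ≤ A) (z : H) : invForm A (A z) ≠ ⊤ := by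
  by_cases h0 : qf A z = 0
  · rw [apply_eq_zero_of_qf hA h0, (invForm_isQuad hA).zero]
    simp
  · have hpos : 0 < qf A z := lt_of_le_of_ne (qf_nonneg hA z) (Ne.symm h0)
    have h : (qf A z)⁻¹ • ray (A z) ≤ A := by
      rw [le_iff_qf (isSelfAdjoint_real_smul _ (ray_isSelfAdjoint _)) (.of_nonneg hA)]
      intro w
      rw [qf_smul, qf_ray, inv_mul_le_iff₀ hpos]
      exact norm_inner_apply_sq_le hA z w
    rw [smul_ray_le_iff hA (by positivity)] at h
    intro htop
    rw [htop, ENNReal.mul_top] at h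
    · simp at h
    · simpa using hpos

lemma norm_inner_self_eq (x : H) : ‖inner ℂ x x‖ = ‖x‖ ^ 2 := by
  rw [inner_self_eq_norm_sq_to_K]
  simp

lemma invForm_ne_zero {A : H →L[ℂ] H} (hA : 0 ≤ A) (hA' : A ≤ 1) {x : H} (hx : x ≠ 0) :
    invForm A x ≠ 0 := by
  intro h
  set a := 2 / ‖x‖ ^ 2 with ha
  have hpos : 0 < ‖x‖ ^ 2 := by positivity
  have h1 : a • ray x ≤ A := (smul_ray_le_iff hA (by positivity) x).2 (by simp [h])
  have h2 := qf_mono (h1.trans hA') x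
  rw [qf_smul, qf_ray, qf_one, norm_inner_self_eq, ha] at h2
  · have : 2 / ‖x‖ ^ 2 * (‖x‖ ^ 2) ^ 2 = 2 * ‖x‖ ^ 2 := by field_simp
    rw [this] at h2
    linarith

/-- The strength `max {a ≥ 0 : a |x⟩⟨x| ≤ A}` of the effect `A` along `x`, for `x ≠ 0`, as the
inverse of `⟨A⁻¹x, x⟩`. -/
noncomputable def str (A : H →L[ℂ] H) (x : H) : ℝ := (invForm A x)⁻¹.toReal

lemma str_nonneg (A : H →L[ℂ] H) (x : H) : 0 ≤ str A x := ENNReal.toReal_nonneg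

lemma inv_invForm {A : H →L[ℂ] H} (hA : 0 ≤ A) (hA' : A ≤ 1) {x : H} (hx : x ≠ 0) :
    (invForm A x)⁻¹ = ENNReal.ofReal (str A x) := by
  rw [str, ENNReal.ofReal_toReal]
  simpa using invForm_ne_zero hA hA' hx

lemma smul_ray_le_iff_str {A : H →L[ℂ] H} (hA : 0 ≤ A) (hA' : A ≤ 1) {a : ℝ} (ha : 0 ≤ a) {x : H}
    (hx : x ≠ 0) : a • ray x ≤ A ↔ a ≤ str A x := by
  rw [smul_ray_le_iff hA ha, ← ENNReal.ofReal_le_ofReal_iff (str_nonneg A x),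
    ← inv_invForm hA hA' hx, ENNReal.le_inv_iff_mul_le]

lemma str_pos_iff {A : H →L[ℂ] H} (hA : 0 ≤ A) (hA' : A ≤ 1) {x : H} (hx : x ≠ 0) :
    0 < str A x ↔ invForm A x ≠ ⊤ := by
  rw [← ENNReal.ofReal_pos, ← inv_invForm hA hA' hx, ENNReal.inv_pos]

lemma str_mul_le {A : H →L[ℂ] H} (hA : 0 ≤ A) (hA' : A ≤ 1) {x : H} (hx : x ≠ 0) :
    str A x * (‖x‖ ^ 2) ^ 2 ≤ qf A x := by
  have h := qf_mono ((smul_ray_le_iff_str hA hA' (str_nonneg A x) hx).2 le_rfl) x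
  rwa [qf_smul, qf_ray, norm_inner_self_eq] at h

lemma coex_smul_ray_iff_str {A : H →L[ℂ] H} (hA : 0 ≤ A) (hA' : A ≤ 1) {s : ℝ} (hs : 0 ≤ s) {x : H}
    (hx : x ≠ 0) : Coex A (s • ray x) ↔ s ≤ str A x + str (1 - A) x := by
  have hB : 0 ≤ 1 - A := sub_nonneg.2 hA'
  have hB' : 1 - A ≤ 1 := sub_le_self _ hA
  rw [coex_smul_ray_iff hx]
  constructor
  · rintro ⟨a, b, ha, hb, rfl, h1, h2⟩
    exact add_le_add ((smul_ray_le_iff_str hA hA' ha hx).1 h1)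
      ((smul_ray_le_iff_str hB hB' hb hx).1 h2)
  · intro h
    refine ⟨min s (str A x), s - min s (str A x), le_min hs (str_nonneg A x),
      sub_nonneg.2 (min_le_left _ _), by ring,
      (smul_ray_le_iff_str hA hA' (le_min hs (str_nonneg A x)) hx).2 (min_le_right _ _),
      (smul_ray_le_iff_str hB hB' (sub_nonneg.2 (min_le_left _ _)) hx).2 ?_⟩
    rcases le_total s (str A x) with h1 | h1
    · rw [min_eq_left h1, sub_self]; exact str_nonneg _ _
    · rw [min_eq_right h1]; linarith

lemma str_add_str_le {A : H →L[ℂ] H} (hA : 0 ≤ A) (hA' : A ≤ 1) {x : H} (hx : x ≠ 0) :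
    (str A x + str (1 - A) x) * ‖x‖ ^ 2 ≤ 1 := by
  have h1 := str_mul_le hA hA' hx
  have h2 := str_mul_le (sub_nonneg.2 hA') (sub_le_self _ hA) hx
  rw [qf_sub, qf_one] at h2
  have hpos : 0 < ‖x‖ ^ 2 := by positivity
  have h3 : ((str A x + str (1 - A) x) * ‖x‖ ^ 2) * ‖x‖ ^ 2 ≤ 1 * ‖x‖ ^ 2 := by linarith
  exact le_of_mul_le_mul_right h3 hpos

/-- Effects with the same coexistent rank-one effects have the same total strengths. -/
lemma str_add_eq_of_coex {A B : H →L[ℂ] H} (hA : 0 ≤ A) (hA' : A ≤ 1) (hB : 0 ≤ B) (hB' : B ≤ 1)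
    {x : H} (hx : x ≠ 0) (h : ∀ s : ℝ, 0 ≤ s → s * ‖x‖ ^ 2 ≤ 1 →
      (Coex A (s • ray x) ↔ Coex B (s • ray x))) :
    str A x + str (1 - A) x = str B x + str (1 - B) x := by
  have hpA : 0 ≤ str A x + str (1 - A) x := add_nonneg (str_nonneg _ _) (str_nonneg _ _)
  have hpB : 0 ≤ str B x + str (1 - B) x := add_nonneg (str_nonneg _ _) (str_nonneg _ _)
  refine le_antisymm ?_ ?_
  · rw [← coex_smul_ray_iff_str hB hB' hpA hx, ← h _ hpA (str_add_str_le hA hA' hx),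
      coex_smul_ray_iff_str hA hA' hpA hx]
  · rw [← coex_smul_ray_iff_str hA hA' hpB hx, h _ hpB (str_add_str_le hB hB' hx),
      coex_smul_ray_iff_str hB hB' hpB hx]

lemma le_of_invForm_eq {A B : H →L[ℂ] H} (hA : 0 ≤ A) (hB : 0 ≤ B)
    (h : ∀ x, invForm A x = invForm B x) : A ≤ B := by
  rw [le_iff_qf (.of_nonneg hA) (.of_nonneg hB)]
  intro z
  by_cases h0 : qf A z = 0
  · rw [h0]; exact qf_nonneg hB z
  have hpos : 0 < qf A z := lt_of_le_of_ne (qf_nonneg hA z) (Ne.symm h0)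
  have h1 : (qf A z)⁻¹ • ray (A z) ≤ A := by
    rw [le_iff_qf (isSelfAdjoint_real_smul _ (ray_isSelfAdjoint _)) (.of_nonneg hA)]
    intro w
    rw [qf_smul, qf_ray, inv_mul_le_iff₀ hpos]
    exact norm_inner_apply_sq_le hA z w
  rw [smul_ray_le_iff hA (by positivity), h, ← smul_ray_le_iff hB (by positivity)] at h1
  have h2 := qf_mono h1 z
  rw [qf_smul, qf_ray] at h2
  have h3 : qf A z ≤ ‖inner ℂ (A z) z‖ := Complex.re_le_norm _
  calc qf A z = (qf A z)⁻¹ * qf A z ^ 2 := by field_simp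
    _ ≤ (qf A z)⁻¹ * ‖inner ℂ (A z) z‖ ^ 2 := by gcongr
    _ ≤ qf B z := h2

lemma eq_of_invForm_eq {A B : H →L[ℂ] H} (hA : 0 ≤ A) (hB : 0 ≤ B)
    (h : ∀ x, invForm A x = invForm B x) : A = B :=
  le_antisymm (le_of_invForm_eq hA hB h) (le_of_invForm_eq hB hA fun x => (h x).symm)

/-- The strength along a vector with components on both sides of a reducing projection. -/
lemma str_smul_add {A E : H →L[ℂ] H} (hA : 0 ≤ A) (hA' : A ≤ 1) (hE : IsStarProjection E)
    (h : Commute E A) {x y : H} (hx : x ≠ 0) (hy : y ≠ 0) (hEx : E x = 0) (hEy : E y = y) {r : ℝ}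
    (hr : r ≠ 0) :
    str A ((r : ℂ) • x + y) = str A x * str A y / (r ^ 2 * str A y + str A x) := by
  have h1 : invForm A ((r : ℂ) • x + y)
      = invForm A y + ENNReal.ofReal (r ^ 2) * invForm A x := by
    rw [invForm_add_of_commute hA hE h]
    have : E ((r : ℂ) • x + y) = y := by rw [map_add, map_smul, hEx, hEy, smul_zero, zero_add]
    rw [this, add_sub_cancel_right, (invForm_isQuad hA).smul]
    simp
  have hr2 : 0 < r ^ 2 := by positivity
  have hx0 := invForm_ne_zero hA hA' hx
  have hy0 := invForm_ne_zero hA hA' hy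
  rw [str, str, str, h1]
  by_cases hxt : invForm A x = ⊤
  · rw [hxt, ENNReal.mul_top (by simpa using hr)]
    simp
  by_cases hyt : invForm A y = ⊤
  · rw [hyt]
    simp
  have hxp : 0 < (invForm A x).toReal := ENNReal.toReal_pos hx0 hxt
  have hyp : 0 < (invForm A y).toReal := ENNReal.toReal_pos hy0 hyt
  rw [ENNReal.toReal_inv, ENNReal.toReal_inv, ENNReal.toReal_inv,
    ENNReal.toReal_add hyt (ENNReal.mul_ne_top (by simp) hxt), ENNReal.toReal_mul,
    ENNReal.toReal_ofReal hr2.le]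
  field_simp
  ring

end Effect

/-! ### Effects are determined by their coexistent rank-one effects -/

namespace Effect

open scoped ENNReal

variable {H : Type*} [NormedAddCommGroup H] [InnerProductSpace ℂ H] [CompleteSpace H]

lemma ennreal_eq_of_two_mul_add {a b c : ℝ≥0∞} (hc : c ≠ ⊤) (h : 2 * a + 2 * c = 2 * b + 2 * c) :
    a = b := by
  have h1 : 2 * c ≠ ⊤ := ENNReal.mul_ne_top (by simp) hc
  have h2 : 2 * a = 2 * b := (ENNReal.add_left_inj h1).1 h
  exact (ENNReal.mul_right_inj (by simp) (by simp)).1 h2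

/-- A subspace covered by two subspaces lies in one of them, for the subspaces on which quadratic
forms are finite. -/
lemma IsQuad.cover {r s t : H → ℝ≥0∞} (hr : IsQuad r) (hs : IsQuad s) (ht : IsQuad t)
    (hc : ∀ x, r x ≠ ⊤ → s x ≠ ⊤ ∨ t x ≠ ⊤) :
    (∀ x, r x ≠ ⊤ → s x ≠ ⊤) ∨ (∀ x, r x ≠ ⊤ → t x ≠ ⊤) := by
  by_contra! hcon
  obtain ⟨⟨x, hx, hx'⟩, y, hy, hy'⟩ := hcon
  have hxt := (hc x hx).resolve_left (not_not.2 hx')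
  have hys := (hc y hy).resolve_right (not_not.2 hy')
  rcases hc _ (hr.add_ne_top hx hy) with h3 | h3
  · have := hs.sub_ne_top h3 hys
    rw [add_sub_cancel_right] at this
    exact this hx'
  · have := ht.sub_ne_top h3 hxt
    rw [add_sub_cancel_left] at this
    exact this hy'

lemma isQuad_zero : IsQuad (fun _ : H => (0 : ℝ≥0∞)) := ⟨by simp, by simp⟩

lemma finite_iff_of_inv_add_eq {a b c d : ℝ≥0∞} (h : a⁻¹ + b⁻¹ = c⁻¹ + d⁻¹) :
    (a ≠ ⊤ ∨ b ≠ ⊤) ↔ (c ≠ ⊤ ∨ d ≠ ⊤) := by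
  have key : ∀ a b : ℝ≥0∞, a⁻¹ + b⁻¹ = 0 ↔ a = ⊤ ∧ b = ⊤ := by simp
  have h3 := key a b
  rw [h, key] at h3
  tauto

/-- Let extended quadratic forms satisfy `1/q₁ + 1/q₂ = 1/p₁ + 1/p₂`, where the domains of `q₁` and
`q₂` are proper subspaces that together span the space. If `p₁` is finite on the domain of `q₁`, then
`q₁ = p₁`: where only `q₁` is finite the equation reads `1/q₁ = 1/p₁`, and the parallelogram law
extends this to the whole domain. -/
lemma IsQuad.eq_of_inv_add_eq_of_le {q₁ q₂ p₁ p₂ : H → ℝ≥0∞} (hq₁ : IsQuad q₁) (hq₂ : IsQuad q₂)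
    (hp₁ : IsQuad p₁) (hp₂ : IsQuad p₂)
    (hq : ∀ z, ∃ x y, z = x + y ∧ q₁ x ≠ ⊤ ∧ q₂ y ≠ ⊤)
    (h : ∀ x, (q₁ x)⁻¹ + (q₂ x)⁻¹ = (p₁ x)⁻¹ + (p₂ x)⁻¹)
    (h₁ : ∃ x, q₁ x = ⊤) (h₂ : ∃ x, q₂ x = ⊤) (hle : ∀ x, q₁ x ≠ ⊤ → p₁ x ≠ ⊤) (x : H) :
    q₁ x = p₁ x := by
  have hdom : ∀ x, (q₁ x ≠ ⊤ ∨ q₂ x ≠ ⊤) ↔ (p₁ x ≠ ⊤ ∨ p₂ x ≠ ⊤) := fun x =>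
    finite_iff_of_inv_add_eq (h x)
  obtain ⟨u, hu⟩ := h₁
  obtain ⟨v, hv⟩ := h₂
  have hle2 : ∀ x, q₂ x ≠ ⊤ → p₂ x ≠ ⊤ := by
    rcases hq₂.cover hp₁ hp₂ (fun x hx => (hdom x).1 (Or.inr hx)) with h3 | h3
    · exfalso
      have hall : ∀ z, p₁ z ≠ ⊤ := fun z => by
        obtain ⟨x, y, rfl, hx, hy⟩ := hq z
        exact hp₁.add_ne_top (hle x hx) (h3 y hy)
      rcases isQuad_zero.cover hq₁ hq₂ (fun x _ => (hdom x).2 (Or.inl (hall x))) with h4 | h4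
      · exact h4 u (by simp) hu
      · exact h4 v (by simp) hv
    · exact h3
  have hge : ∀ x, p₁ x ≠ ⊤ → q₁ x ≠ ⊤ := by
    rcases hp₁.cover hq₁ hq₂ (fun x hx => (hdom x).2 (Or.inl hx)) with h3 | h3
    · exact h3
    · exfalso
      obtain ⟨x, y, rfl, hx, hy⟩ := hq v
      exact hq₂.add_ne_top (h3 x (hle x hx)) hy hv
  have hge2 : ∀ x, p₂ x ≠ ⊤ → q₂ x ≠ ⊤ := by
    rcases hp₂.cover hq₁ hq₂ (fun x hx => (hdom x).2 (Or.inr hx)) with h3 | h3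
    · exfalso
      obtain ⟨x, y, rfl, hx, hy⟩ := hq u
      exact hq₁.add_ne_top hx (h3 y (hle2 y hy)) hu
    · exact h3
  have hoff : ∀ x, q₂ x = ⊤ → q₁ x = p₁ x := fun x hx => by
    have h3 : p₂ x = ⊤ := by by_contra h4; exact hge2 x h4 hx
    have h4 := h x
    rw [hx, h3] at h4
    simpa using h4
  by_cases hx : q₁ x = ⊤
  · rw [hx]
    by_contra h3
    exact hge x (Ne.symm h3) hx
  by_cases hx2 : q₂ x = ⊤
  · exact hoff x hx2
  obtain ⟨y, y', hyy, hy, hy'⟩ := hq v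
  have hyt : q₂ y = ⊤ := by
    by_contra h3
    rw [hyy] at hv
    exact hq₂.add_ne_top h3 hy' hv
  have h5 : q₂ (x + y) = ⊤ := by
    by_contra h3
    have := hq₂.sub_ne_top h3 hx2
    rw [add_sub_cancel_left] at this
    exact this hyt
  have h6 : q₂ (x - y) = ⊤ := by
    by_contra h3
    have := hq₂.sub_ne_top hx2 h3
    rw [sub_sub_cancel] at this
    exact this hyt
  have h7 := hq₁.par x y
  rw [hoff _ h5, hoff _ h6, hp₁.par, hoff y hyt] at h7
  exact (ennreal_eq_of_two_mul_add (hoff y hyt ▸ hy) h7).symm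

/-- The rational identity behind the rank-one test on a vector with two reduced components: both
sides are sums of two simple fractions, the two poles on the left being distinct, so the fractions
agree up to order. The case of a vanishing `k₁` (a vector outside the range of the square root) has
a single pole on the left. -/
lemma match_or_swap {k₁ k₂ k₁' k₂' l₁ l₂ l₁' l₂' : ℝ} (hk₁ : 0 ≤ k₁) (hk₂ : 0 < k₂)
    (hk₁' : 0 < k₁') (hk₂' : 0 < k₂') (hl₁ : 0 ≤ l₁) (hl₂ : 0 ≤ l₂) (hl₁' : 0 < l₁')
    (hl₂' : 0 < l₂') (hlt : k₁ * k₂' < k₁' * k₂) (s₁ : k₁ + k₁' = l₁ + l₁')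
    (s₂ : k₂ + k₂' = l₂ + l₂')
    (h : ∀ s : ℝ, 0 < s → k₁ * k₂ / (s * k₂ + k₁) + k₁' * k₂' / (s * k₂' + k₁') =
      l₁ * l₂ / (s * l₂ + l₁) + l₁' * l₂' / (s * l₂' + l₁')) :
    (k₁ = l₁ ∧ k₂ = l₂ ∧ k₁' = l₁' ∧ k₂' = l₂') ∨
      (k₁ = l₁' ∧ k₂ = l₂' ∧ k₁' = l₁ ∧ k₂' = l₂) := by
  have hd : 0 < k₁' * k₂ - k₁ * k₂' := by linarith
  rcases hl₂.eq_or_lt with h0 | hl₂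
  · exfalso
    subst h0
    have hl2 : l₂' = k₂ + k₂' := by linarith
    subst hl2
    have hp : ∀ s : ℝ, 0 < s →
        (k₁ * k₂ * (s * k₂' + k₁') + k₁' * k₂' * (s * k₂ + k₁)) * (s * (k₂ + k₂') + l₁') =
          l₁' * (k₂ + k₂') * ((s * k₂ + k₁) * (s * k₂' + k₁')) := by
      intro s hs
      have h1 : s * k₂ + k₁ ≠ 0 := by positivity
      have h2 : s * k₂' + k₁' ≠ 0 := by positivity
      have h3 : s * (k₂ + k₂') + l₁' ≠ 0 := by positivity
      have h4 := h s hs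
      rw [mul_zero, zero_div, zero_add, div_add_div _ _ h1 h2,
        div_eq_div_iff (mul_ne_zero h1 h2) h3] at h4
      linarith
    have e1 := hp 1 one_pos
    have e2 := hp 2 two_pos
    have c2 : k₂ * k₂' * (k₂ + k₂') * (k₁ + k₁' - l₁') = 0 := by linear_combination e2 / 2 - e1
    have hk : k₂ * k₂' * (k₂ + k₂') ≠ 0 := by positivity
    have h5 : k₁ + k₁' - l₁' = 0 := (mul_eq_zero.1 c2).resolve_left hk
    have h6 : l₁' = k₁ + k₁' := by linarith
    subst h6
    have c1 : (k₁' * k₂ - k₁ * k₂') ^ 2 = 0 := by linear_combination -e1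
    have := pow_pos hd 2
    linarith
  have hp : ∀ s : ℝ, 0 < s →
      (k₁ * k₂ * (s * k₂' + k₁') + k₁' * k₂' * (s * k₂ + k₁)) *
          ((s * l₂ + l₁) * (s * l₂' + l₁')) =
        (l₁ * l₂ * (s * l₂' + l₁') + l₁' * l₂' * (s * l₂ + l₁)) *
          ((s * k₂ + k₁) * (s * k₂' + k₁')) := by
    intro s hs
    have h1 : s * k₂ + k₁ ≠ 0 := by positivity
    have h2 : s * k₂' + k₁' ≠ 0 := by positivity
    have h3 : s * l₂ + l₁ ≠ 0 := by positivity
    have h3' : s * l₂' + l₁' ≠ 0 := by positivity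
    have h4 := h s hs
    rw [div_add_div _ _ h1 h2, div_add_div _ _ h3 h3',
      div_eq_div_iff (mul_ne_zero h1 h2) (mul_ne_zero h3 h3')] at h4
    linarith
  have el₁' : l₁' = k₁ + k₁' - l₁ := by linarith
  have el₂' : l₂' = k₂ + k₂' - l₂ := by linarith
  -- The coefficients of `s ^ 2` and `s` in the cleared identity
  obtain ⟨c2, c1⟩ :
      (k₁ + k₁') * (k₂ * k₂' * (l₁ * l₂' + l₁' * l₂) - l₂ * l₂' * (k₁ * k₂' + k₁' * k₂)) +
        (k₂ + k₂') * (k₁ * k₁' * (l₂ * l₂') - l₁ * l₁' * (k₂ * k₂')) = 0 ∧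
      (k₂ + k₂') * (k₁ * k₁' * (l₁ * l₂' + l₁' * l₂) - l₁ * l₁' * (k₁ * k₂' + k₁' * k₂)) -
        (k₁ + k₁') * (k₁ * k₁' * (l₂ * l₂') - l₁ * l₁' * (k₂ * k₂')) = 0 := by
    have e1 := hp 1 one_pos
    have e2 := hp 2 two_pos
    subst el₁' el₂'
    constructor
    · linear_combination e2 / 2 - e1
    · linear_combination 2 * e1 - e2 / 2
  rcases hk₁.eq_or_lt with h0 | hk₁
  · left
    subst h0
    have h1 : l₁ * (l₁' * (k₁' * (k₂ * k₂))) = 0 := by linear_combination -c1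
    have h2 : l₁ = 0 := by
      rcases mul_eq_zero.1 h1 with h3 | h3
      · exact h3
      · exact absurd h3 (by positivity)
    subst h2
    have h3 : l₁' = k₁' := by linarith
    subst h3
    have h4 : (k₂' - l₂') * (l₁' * (l₁' * (l₂ * k₂))) = 0 := by linear_combination c2
    have h5 : k₂' = l₂' := by
      rcases mul_eq_zero.1 h4 with h6 | h6
      · linarith
      · exact absurd h6 (by positivity)
    exact ⟨rfl, by linarith, rfl, h5⟩
  -- The two poles on the left are poles on the right
  have r1 : (k₁ * l₂ - l₁ * k₂) * (k₁ * l₂' - l₁' * k₂) = 0 := by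
    have h1 : (k₁ * k₂ * (k₁' * k₂ - k₁ * k₂')) *
        ((k₁ * l₂ - l₁ * k₂) * (k₁ * l₂' - l₁' * k₂)) = 0 := by
      subst el₁' el₂'
      linear_combination k₁ ^ 2 * k₂ * c2 - k₁ * k₂ ^ 2 * c1
    exact (mul_eq_zero.1 h1).resolve_left (by positivity)
  have r2 : (k₁' * l₂ - l₁ * k₂') * (k₁' * l₂' - l₁' * k₂') = 0 := by
    have h1 : (k₁' * k₂' * (k₁' * k₂ - k₁ * k₂')) *
        ((k₁' * l₂ - l₁ * k₂') * (k₁' * l₂' - l₁' * k₂')) = 0 := by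
      subst el₁' el₂'
      linear_combination -k₁' ^ 2 * k₂' * c2 + k₁' * k₂' ^ 2 * c1
    exact (mul_eq_zero.1 h1).resolve_left (by positivity)
  have hcross : ∀ {x₁ x₂ y₁ y₂ : ℝ}, x₁ + y₁ = k₁ + k₁' → x₂ + y₂ = k₂ + k₂' →
      k₁ * x₂ - x₁ * k₂ = 0 → k₁' * y₂ - y₁ * k₂' = 0 →
      k₁ = x₁ ∧ k₂ = x₂ ∧ k₁' = y₁ ∧ k₂' = y₂ := by
    intro x₁ x₂ y₁ y₂ h1 h2 h3 h4
    have ey₁ : y₁ = k₁ + k₁' - x₁ := by linarith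
    have ey₂ : y₂ = k₂ + k₂' - x₂ := by linarith
    subst ey₁ ey₂
    have h5 : (k₁' * k₂ - k₁ * k₂') * (x₁ - k₁) = 0 := by linear_combination -k₁ * h4 - k₁' * h3
    have h6 : x₁ - k₁ = 0 := (mul_eq_zero.1 h5).resolve_left hd.ne'
    have h7 : x₁ = k₁ := by linarith
    subst h7
    have h8 : x₁ * (x₂ - k₂) = 0 := by linear_combination h3
    have h9 : x₂ - k₂ = 0 := (mul_eq_zero.1 h8).resolve_left hk₁.ne'
    refine ⟨rfl, by linarith, by ring, by linarith⟩
  rcases mul_eq_zero.1 r1 with a1 | a1 <;> rcases mul_eq_zero.1 r2 with a2 | a2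
  · exfalso
    have h1 : l₂ * (k₁' * k₂ - k₁ * k₂') = 0 := by linear_combination k₂ * a2 - k₂' * a1
    exact (mul_pos hl₂ hd).ne' h1
  · exact Or.inl (hcross s₁.symm s₂.symm a1 a2)
  · obtain ⟨e1, e2, e3, e4⟩ := hcross (by linarith) (by linarith) a1 a2
    exact Or.inr ⟨e1, e2, e3, e4⟩
  · exfalso
    have h1 : l₂' * (k₁' * k₂ - k₁ * k₂') = 0 := by linear_combination k₂ * a2 - k₂' * a1
    exact (mul_pos hl₂' hd).ne' h1

/-- If on every vector of a subspace two pairs of quadratic forms agree either directly or after a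
swap, then one of the two alternatives holds on the whole subspace. Otherwise, on a line joining a
vector without direct agreement to one without swapped agreement, the parallelogram law forbids
three direct agreements in arithmetic progression, and forbids swapped agreement at two points
symmetric about the centre. -/
lemma IsQuad.uniform_match_or_swap {q q' p p' : H → ℝ≥0∞} (hq : IsQuad q) (hq' : IsQuad q')
    (hp : IsQuad p) (hp' : IsQuad p') (hq't : ∀ x, q' x ≠ ⊤) (hp't : ∀ x, p' x ≠ ⊤)
    (M : Submodule ℂ H)
    (h : ∀ x ∈ M, (q x = p x ∧ q' x = p' x) ∨ (q x = p' x ∧ q' x = p x)) :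
    (∀ x ∈ M, q x = p x ∧ q' x = p' x) ∨ (∀ x ∈ M, q x = p' x ∧ q' x = p x) := by
  by_contra! hcon
  obtain ⟨⟨x, hx, hmx⟩, y, hy, hwy⟩ := hcon
  set m : ℤ → Prop := fun n => q (y + (n : ℂ) • x) = p (y + (n : ℂ) • x) ∧
    q' (y + (n : ℂ) • x) = p' (y + (n : ℂ) • x) with hm
  set w : ℤ → Prop := fun n => q (y + (n : ℂ) • x) = p' (y + (n : ℂ) • x) ∧
    q' (y + (n : ℂ) • x) = p (y + (n : ℂ) • x) with hw
  have hmw : ∀ n, m n ∨ w n := fun n => h _ (M.add_mem hy (M.smul_mem _ hx))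
  have hwx : q x = p' x ∧ q' x = p x := (h x hx).resolve_left fun h => hmx h.1 h.2
  have hmy : q y = p y ∧ q' y = p' y := (h y hy).resolve_right fun h => hwy h.1 h.2
  have hneq : q' x ≠ p' x := fun h1 => hmx (by rw [hwx.1, ← hwx.2, h1]) h1
  have hm0 : m 0 := by simpa [hm] using hmy
  have hM : ∀ n d : ℤ, d ≠ 0 → m (n - d) → m n → m (n + d) → False := by
    intro n d hd h1 h2 h3
    have e := hq'.par (y + (n : ℂ) • x) ((d : ℂ) • x)
    have e' := hp'.par (y + (n : ℂ) • x) ((d : ℂ) • x)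
    have e1 : y + (n : ℂ) • x + (d : ℂ) • x = y + ((n + d : ℤ) : ℂ) • x := by
      push_cast; module
    have e2 : y + (n : ℂ) • x - (d : ℂ) • x = y + ((n - d : ℤ) : ℂ) • x := by
      push_cast; module
    rw [e1, e2] at e e'
    rw [h1.2, h3.2, h2.2, e', add_comm, add_comm (2 * p' (y + (n : ℂ) • x))] at e
    have e3 := ennreal_eq_of_two_mul_add (hp't _) e
    rw [hq'.smul, hp'.smul] at e3
    have hpos : (0 : ℝ) < ‖(d : ℂ)‖ ^ 2 := by
      have : (d : ℂ) ≠ 0 := by exact_mod_cast hd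
      positivity
    exact hneq ((ENNReal.mul_right_inj (by simpa using hd) (by simp)).1 e3).symm
  have hW : ∀ d : ℤ, w (-d) → w d → False := by
    intro d h1 h2
    have ht : ∀ z, q z = p' z ∧ q' z = p z → q z ≠ ⊤ := fun z hz => hz.1 ▸ hp't z
    have e1 : y - (d : ℂ) • x = y + ((-d : ℤ) : ℂ) • x := by push_cast; module
    have hs : q ((d : ℂ) • x) = p' ((d : ℂ) • x) ∧ q' ((d : ℂ) • x) = p ((d : ℂ) • x) := by
      rw [hq.smul, hp'.smul, hq'.smul, hp.smul, hwx.1, hwx.2]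
      exact ⟨rfl, rfl⟩
    have a1 := hq.par y ((d : ℂ) • x)
    have a2 := hp'.par y ((d : ℂ) • x)
    have a3 := hq'.par y ((d : ℂ) • x)
    have a4 := hp.par y ((d : ℂ) • x)
    rw [e1] at a1 a2 a3 a4
    rw [h1.1, h2.1, a2, hs.1] at a1
    rw [h1.2, h2.2, a4, hs.2] at a3
    exact hwy (ennreal_eq_of_two_mul_add (hp't _) a1).symm
      (ennreal_eq_of_two_mul_add (hs.2 ▸ hq't _) a3).symm
  clear_value m w
  have b1 : m 0 → m 1 → m 2 → False := hM 1 1 one_ne_zero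
  have b2 : m (-4) → m (-2) → m 0 → False := by
    have := hM (-2) 2 two_ne_zero
    rwa [show (-2 - 2 : ℤ) = -4 by norm_num, show (-2 + 2 : ℤ) = 0 by norm_num] at this
  have b3 : m (-2) → m 1 → m 4 → False := hM 1 3 three_ne_zero
  have b4 : m (-2) → m (-1) → m 0 → False := by
    have := hM (-1) 1 one_ne_zero
    rwa [show (-1 - 1 : ℤ) = -2 by norm_num, show (-1 + 1 : ℤ) = 0 by norm_num] at this
  have b5 : m 0 → m 2 → m 4 → False := hM 2 2 two_ne_zero
  have b6 : m (-4) → m (-1) → m 2 → False := by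
    have := hM (-1) 3 three_ne_zero
    rwa [show (-1 - 3 : ℤ) = -4 by norm_num, show (-1 + 3 : ℤ) = 2 by norm_num] at this
  rcases hmw 1 with h1 | h1
  · have w2 := (hmw 2).resolve_left (b1 hm0 h1)
    have m2 := (hmw (-2)).resolve_right fun h => hW 2 h w2
    have w4 := (hmw (-4)).resolve_left fun h => b2 h m2 hm0
    exact b3 m2 h1 ((hmw 4).resolve_right fun h => hW 4 w4 h)
  · have m1 := (hmw (-1)).resolve_right fun h => hW 1 h h1
    have w2 := (hmw (-2)).resolve_left fun h => b4 h m1 hm0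
    have m2 := (hmw 2).resolve_right fun h => hW 2 w2 h
    have w4 := (hmw 4).resolve_left fun h => b5 hm0 m2 h
    exact b6 ((hmw (-4)).resolve_right fun h => hW 4 h w4) m1 m2

end Effect

namespace Effect

open scoped ENNReal

variable {H : Type*} [NormedAddCommGroup H] [InnerProductSpace ℂ H] [CompleteSpace H]

lemma inv_invForm_add_eq {A B : H →L[ℂ] H} (hA : 0 ≤ A) (hA' : A ≤ 1) (hB : 0 ≤ B) (hB' : B ≤ 1)
    (hL : ∀ x : H, x ≠ 0 → str A x + str (1 - A) x = str B x + str (1 - B) x) (x : H) :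
    (invForm A x)⁻¹ + (invForm (1 - A) x)⁻¹ = (invForm B x)⁻¹ + (invForm (1 - B) x)⁻¹ := by
  by_cases hx : x = 0
  · subst hx
    simp [(invForm_isQuad hA).zero, (invForm_isQuad hB).zero]
  rw [inv_invForm hA hA' hx, inv_invForm hB hB' hx,
    inv_invForm (sub_nonneg.2 hA') (sub_le_self _ hA) hx,
    inv_invForm (sub_nonneg.2 hB') (sub_le_self _ hB) hx,
    ← ENNReal.ofReal_add (str_nonneg _ _) (str_nonneg _ _),
    ← ENNReal.ofReal_add (str_nonneg _ _) (str_nonneg _ _), hL x hx]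

lemma exists_add_invForm_ne_top {A : H →L[ℂ] H} (hA : 0 ≤ A) (hA' : A ≤ 1) (z : H) :
    ∃ x y, z = x + y ∧ invForm A x ≠ ⊤ ∧ invForm (1 - A) y ≠ ⊤ :=
  ⟨A z, (1 - A) z, by simp, invForm_apply_ne_top hA z, invForm_apply_ne_top (sub_nonneg.2 hA') z⟩

/-- The case where neither `A` nor `1 - A` is invertible: no commutation is needed. -/
lemma eq_or_eq_compl_of_not_finite {A B : H →L[ℂ] H} (hA : 0 ≤ A) (hA' : A ≤ 1) (hB : 0 ≤ B)
    (hB' : B ≤ 1) (hL : ∀ x : H, x ≠ 0 → str A x + str (1 - A) x = str B x + str (1 - B) x)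
    (h₁ : ∃ x, invForm A x = ⊤) (h₂ : ∃ x, invForm (1 - A) x = ⊤) : B = A ∨ B = 1 - A := by
  have hcA : 0 ≤ 1 - A := sub_nonneg.2 hA'
  have hcB : 0 ≤ 1 - B := sub_nonneg.2 hB'
  have hinv := inv_invForm_add_eq hA hA' hB hB' hL
  have hq₁ := invForm_isQuad hA
  have hq₂ := invForm_isQuad hcA
  have hp₁ := invForm_isQuad hB
  have hp₂ := invForm_isQuad hcB
  have hd := exists_add_invForm_ne_top hA hA'
  rcases hq₁.cover hp₁ hp₂ (fun x hx => (finite_iff_of_inv_add_eq (hinv x)).1 (Or.inl hx))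
    with h | h
  · exact Or.inl (eq_of_invForm_eq hA hB
      (hq₁.eq_of_inv_add_eq_of_le hq₂ hp₁ hp₂ hd hinv h₁ h₂ h)).symm
  · refine Or.inr ?_
    rw [eq_of_invForm_eq hA hcB (hq₁.eq_of_inv_add_eq_of_le hq₂ hp₂ hp₁ hd
      (fun x => by rw [hinv, add_comm]) h₁ h₂ h), sub_sub_cancel]

lemma invForm_eq_of_str_eq {A B : H →L[ℂ] H} (hA : 0 ≤ A) (hA' : A ≤ 1) (hB : 0 ≤ B) (hB' : B ≤ 1)
    {x : H} (hx : x ≠ 0) (h : str A x = str B x) : invForm A x = invForm B x := by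
  rw [← inv_inj, inv_invForm hA hA' hx, inv_invForm hB hB' hx, h]

/-- The case where `1 - A` and `1 - B` are invertible: the two sides of a spectral cut of `A` are
compared through vectors with components on both sides. -/
lemma eq_or_eq_compl_of_finite {A B : H →L[ℂ] H} (hA : 0 ≤ A) (hA' : A ≤ 1) (hB : 0 ≤ B)
    (hB' : B ≤ 1) (hns : ¬ ∃ t : ℝ, 0 ≤ t ∧ t ≤ 1 ∧ A = t • 1)
    (hL : ∀ x : H, x ≠ 0 → str A x + str (1 - A) x = str B x + str (1 - B) x)
    (hcomm : ∀ E : H →L[ℂ] H, IsStarProjection E → Commute E A → Commute E B)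
    (hAt : ∀ x, invForm (1 - A) x ≠ ⊤) (hBt : ∀ x, invForm (1 - B) x ≠ ⊤) :
    B = A ∨ B = 1 - A := by
  have hcA : 0 ≤ 1 - A := sub_nonneg.2 hA'
  have hcB : 0 ≤ 1 - B := sub_nonneg.2 hB'
  have hcA' : 1 - A ≤ 1 := sub_le_self _ hA
  have hcB' : 1 - B ≤ 1 := sub_le_self _ hB
  obtain ⟨c, E, hc0, hc1, hE, hEX, ⟨y₀, hy₀, hEy₀⟩, ⟨x₀, hx₀, hEx₀⟩, hup, hlow⟩ :=
    exists_cut hA hA' hns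
  have hEA : Commute E A := (hEX A rfl).symm
  have hEB : Commute E B := hcomm E hE hEA
  have hEcA : Commute E (1 - A) := (Commute.one_right E).sub_right hEA
  have hEcB : Commute E (1 - B) := (Commute.one_right E).sub_right hEB
  have hpair : ∀ x y, x ≠ 0 → y ≠ 0 → E x = 0 → E y = y →
      ((invForm A x = invForm B x ∧ invForm (1 - A) x = invForm (1 - B) x) ∧
        (invForm A y = invForm B y ∧ invForm (1 - A) y = invForm (1 - B) y)) ∨
      ((invForm A x = invForm (1 - B) x ∧ invForm (1 - A) x = invForm B x) ∧
        (invForm A y = invForm (1 - B) y ∧ invForm (1 - A) y = invForm B y)) := by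
    intro x y hx hy hEx hEy
    have nx : 0 < ‖x‖ ^ 2 := by positivity
    have ny : 0 < ‖y‖ ^ 2 := by positivity
    have k1 : str A x * (‖x‖ ^ 2) ^ 2 ≤ c * ‖x‖ ^ 2 := (str_mul_le hA hA' hx).trans (hlow x hEx)
    have k2' : str (1 - A) y * (‖y‖ ^ 2) ^ 2 < (1 - c) * ‖y‖ ^ 2 := by
      refine (str_mul_le hcA hcA' hy).trans_lt ?_
      rw [qf_sub, qf_one]
      have := hup y hy hEy
      linarith
    -- Cauchy–Schwarz on the range of `E`, where `A > c`, and on its complement, where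
    -- `1 - A ≥ 1 - c`
    have k2 : c / ‖y‖ ^ 2 ≤ str A y := by
      rw [← smul_ray_le_iff_str hA hA' (by positivity) hy,
        le_iff_qf (isSelfAdjoint_real_smul _ (ray_isSelfAdjoint y)) (.of_nonneg hA)]
      intro z
      rw [qf_smul, qf_ray]
      have h1 : inner ℂ y z = inner ℂ y (E z) := by
        rw [← inner_apply_comm hE.isSelfAdjoint, hEy]
      have h2 : ‖inner ℂ y z‖ ^ 2 ≤ ‖y‖ ^ 2 * ‖E z‖ ^ 2 := by
        rw [h1, ← mul_pow]
        gcongr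
        exact norm_inner_le_norm _ _
      have h3 : c * ‖E z‖ ^ 2 ≤ qf A (E z) := by
        by_cases h0 : E z = 0
        · simp [h0, qf]
        · exact (hup _ h0 (projection_apply_apply hE z)).le
      have h4 : qf A (E z) ≤ qf A z := by
        have e1 : A * E ≤ A := by
          have := Commute.mul_nonneg hA hE.one_sub.zero_le
            ((Commute.one_right A).sub_right hEA.symm)
          rwa [mul_sub, mul_one, sub_nonneg] at this
        have e2 : qf (A * E) z = qf A (E z) := by
          have e3 : E (A (E z)) = A (E z) := by
            rw [← mul_apply_eq_comp, hEA.eq, mul_apply_eq_comp, projection_apply_apply hE]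
          rw [qf, qf, mul_apply_eq_comp]
          nth_rewrite 1 [← e3]
          rw [inner_apply_comm hE.isSelfAdjoint]
        rw [← e2]
        exact qf_mono e1 z
      calc c / ‖y‖ ^ 2 * ‖inner ℂ y z‖ ^ 2 ≤ c / ‖y‖ ^ 2 * (‖y‖ ^ 2 * ‖E z‖ ^ 2) := by gcongr
        _ = c * ‖E z‖ ^ 2 := by field_simp
        _ ≤ qf A z := h3.trans h4
    have k1' : (1 - c) / ‖x‖ ^ 2 ≤ str (1 - A) x := by
      rw [← smul_ray_le_iff_str hcA hcA' (div_nonneg (by linarith) nx.le) hx,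
        le_iff_qf (isSelfAdjoint_real_smul _ (ray_isSelfAdjoint x)) (.of_nonneg hcA)]
      intro z
      rw [qf_smul, qf_ray]
      set F := 1 - E with hF
      have hFp : IsStarProjection F := hE.one_sub
      have hFA : Commute F (1 - A) := (Commute.one_left _).sub_left hEcA
      have h1 : inner ℂ x z = inner ℂ x (F z) := by
        rw [← inner_apply_comm hFp.isSelfAdjoint, hF]
        simp [hEx]
      have h2 : ‖inner ℂ x z‖ ^ 2 ≤ ‖x‖ ^ 2 * ‖F z‖ ^ 2 := by
        rw [h1, ← mul_pow]
        gcongr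
        exact norm_inner_le_norm _ _
      have h3 : (1 - c) * ‖F z‖ ^ 2 ≤ qf (1 - A) (F z) := by
        have h0 : E (F z) = 0 := by
          rw [← mul_apply_eq_comp, hE.mul_one_sub_self]
          rfl
        rw [qf_sub, qf_one]
        have := hlow _ h0
        linarith
      have h4 : qf (1 - A) (F z) ≤ qf (1 - A) z := by
        have e1 : (1 - A) * F ≤ 1 - A := by
          have := Commute.mul_nonneg hcA hFp.one_sub.zero_le
            ((Commute.one_right (1 - A)).sub_right hFA.symm)
          rwa [mul_sub, mul_one, sub_nonneg] at this
        have e2 : qf ((1 - A) * F) z = qf (1 - A) (F z) := by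
          have e3 : F ((1 - A) (F z)) = (1 - A) (F z) := by
            rw [← mul_apply_eq_comp, hFA.eq, mul_apply_eq_comp, projection_apply_apply hFp]
          rw [qf, qf, mul_apply_eq_comp]
          nth_rewrite 1 [← e3]
          rw [inner_apply_comm hFp.isSelfAdjoint]
        rw [← e2]
        exact qf_mono e1 z
      have hc : 0 ≤ (1 - c) / ‖x‖ ^ 2 := div_nonneg (by linarith) nx.le
      calc (1 - c) / ‖x‖ ^ 2 * ‖inner ℂ x z‖ ^ 2
          ≤ (1 - c) / ‖x‖ ^ 2 * (‖x‖ ^ 2 * ‖F z‖ ^ 2) := by gcongr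
        _ = (1 - c) * ‖F z‖ ^ 2 := by field_simp
        _ ≤ qf (1 - A) z := h3.trans h4
    have k1u : str A x ≤ c / ‖x‖ ^ 2 := by
      rw [le_div_iff₀ nx]
      have : (str A x * ‖x‖ ^ 2) * ‖x‖ ^ 2 ≤ c * ‖x‖ ^ 2 := by linarith
      exact le_of_mul_le_mul_right this nx
    have k2u : str (1 - A) y < (1 - c) / ‖y‖ ^ 2 := by
      rw [lt_div_iff₀ ny]
      have : (str (1 - A) y * ‖y‖ ^ 2) * ‖y‖ ^ 2 < (1 - c) * ‖y‖ ^ 2 := by linarith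
      exact lt_of_mul_lt_mul_right this ny.le
    have hk2 : 0 < str A y := lt_of_lt_of_le (by positivity) k2
    have hk1' : 0 < str (1 - A) x := (str_pos_iff hcA hcA' hx).2 (hAt x)
    have hk2' : 0 < str (1 - A) y := (str_pos_iff hcA hcA' hy).2 (hAt y)
    have hl1' : 0 < str (1 - B) x := (str_pos_iff hcB hcB' hx).2 (hBt x)
    have hl2' : 0 < str (1 - B) y := (str_pos_iff hcB hcB' hy).2 (hBt y)
    have hlt : str A x * str (1 - A) y < str (1 - A) x * str A y := by
      have hcx : 0 < c / ‖x‖ ^ 2 := by positivity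
      calc str A x * str (1 - A) y ≤ c / ‖x‖ ^ 2 * str (1 - A) y := by gcongr
        _ < c / ‖x‖ ^ 2 * ((1 - c) / ‖y‖ ^ 2) := by gcongr
        _ = (1 - c) / ‖x‖ ^ 2 * (c / ‖y‖ ^ 2) := by ring
        _ ≤ str (1 - A) x * str A y := by gcongr
    have key := match_or_swap (str_nonneg A x) hk2 hk1' hk2' (str_nonneg B x) (str_nonneg B y)
      hl1' hl2' hlt (hL x hx) (hL y hy) (fun s hs => by
        have hr : Real.sqrt s ≠ 0 := (Real.sqrt_pos.2 hs).ne'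
        have hne : ((Real.sqrt s : ℝ) : ℂ) • x + y ≠ 0 := by
          intro h0
          have := congrArg E h0
          rw [map_add, map_smul, hEx, hEy, smul_zero, zero_add, map_zero] at this
          exact hy this
        have := hL _ hne
        rwa [str_smul_add hA hA' hE hEA hx hy hEx hEy hr,
          str_smul_add hcA hcA' hE hEcA hx hy hEx hEy hr,
          str_smul_add hB hB' hE hEB hx hy hEx hEy hr,
          str_smul_add hcB hcB' hE hEcB hx hy hEx hEy hr, Real.sq_sqrt hs.le] at this)
    rcases key with ⟨a1, a2, a3, a4⟩ | ⟨a1, a2, a3, a4⟩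
    · exact Or.inl ⟨⟨invForm_eq_of_str_eq hA hA' hB hB' hx a1,
        invForm_eq_of_str_eq hcA hcA' hcB hcB' hx a3⟩,
        invForm_eq_of_str_eq hA hA' hB hB' hy a2,
        invForm_eq_of_str_eq hcA hcA' hcB hcB' hy a4⟩
    · exact Or.inr ⟨⟨invForm_eq_of_str_eq hA hA' hcB hcB' hx a1,
        invForm_eq_of_str_eq hcA hcA' hB hB' hx a3⟩,
        invForm_eq_of_str_eq hA hA' hcB hcB' hy a2,
        invForm_eq_of_str_eq hcA hcA' hB hB' hy a4⟩
  have hqA := invForm_isQuad hA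
  have hqB := invForm_isQuad hB
  have hqcA := invForm_isQuad hcA
  have hqcB := invForm_isQuad hcB
  have hM : ∀ z, z ∈ E.ker ↔ E z = 0 := fun z => Iff.rfl
  have hN : ∀ z, z ∈ (1 - E).ker ↔ E z = z := fun z => by
    rw [LinearMap.mem_ker]
    change (1 - E) z = 0 ↔ _
    rw [sub_apply, one_apply_eq_self, sub_eq_zero, eq_comm]
  have u₁ := hqA.uniform_match_or_swap hqcA hqB hqcB hAt hBt E.ker (fun z hz => by
    by_cases h0 : z = 0
    · left; rw [h0, hqA.zero, hqB.zero, hqcA.zero, hqcB.zero]; exact ⟨rfl, rfl⟩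
    · exact (hpair z y₀ h0 hy₀ ((hM z).1 hz) hEy₀).imp And.left And.left)
  have u₂ := hqA.uniform_match_or_swap hqcA hqB hqcB hAt hBt (1 - E).ker (fun z hz => by
    by_cases h0 : z = 0
    · left; rw [h0, hqA.zero, hqB.zero, hqcA.zero, hqcB.zero]; exact ⟨rfl, rfl⟩
    · exact (hpair x₀ z hx₀ h0 hEx₀ ((hN z).1 hz)).imp And.right And.right)
  have hfin : ((∀ z ∈ E.ker, invForm A z = invForm B z) ∧
        (∀ z ∈ (1 - E).ker, invForm A z = invForm B z)) ∨
      ((∀ z ∈ E.ker, invForm A z = invForm (1 - B) z) ∧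
        (∀ z ∈ (1 - E).ker, invForm A z = invForm (1 - B) z)) := by
    rcases u₁ with v₁ | v₁
    · rcases u₂ with v₂ | v₂
      · exact Or.inl ⟨fun z hz => (v₁ z hz).1, fun z hz => (v₂ z hz).1⟩
      · by_cases hall : ∀ z ∈ (1 - E).ker,
          invForm A z = invForm B z ∧ invForm (1 - A) z = invForm (1 - B) z
        · exact Or.inl ⟨fun z hz => (v₁ z hz).1, fun z hz => (hall z hz).1⟩
        · push Not at hall
          obtain ⟨y, hy, hyn⟩ := hall
          refine Or.inr ⟨fun z hz => ?_, fun z hz => (v₂ z hz).1⟩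
          by_cases h0 : z = 0
          · rw [h0, hqA.zero, hqcB.zero]
          have hy0 : y ≠ 0 := by
            rintro rfl
            exact hyn (by rw [hqA.zero, hqB.zero]) (by rw [hqcA.zero, hqcB.zero])
          rcases hpair z y h0 hy0 ((hM z).1 hz) ((hN y).1 hy) with h5 | h5
          · exact absurd h5.2.2 (hyn h5.2.1)
          · exact h5.1.1
    · rcases u₂ with v₂ | v₂
      · by_cases hall : ∀ z ∈ E.ker,
          invForm A z = invForm B z ∧ invForm (1 - A) z = invForm (1 - B) z
        · exact Or.inl ⟨fun z hz => (hall z hz).1, fun z hz => (v₂ z hz).1⟩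
        · push Not at hall
          obtain ⟨y, hy, hyn⟩ := hall
          refine Or.inr ⟨fun z hz => (v₁ z hz).1, fun z hz => ?_⟩
          by_cases h0 : z = 0
          · rw [h0, hqA.zero, hqcB.zero]
          have hy0 : y ≠ 0 := by
            rintro rfl
            exact hyn (by rw [hqA.zero, hqB.zero]) (by rw [hqcA.zero, hqcB.zero])
          rcases hpair y z hy0 h0 ((hM y).1 hy) ((hN z).1 hz) with h5 | h5
          · exact absurd h5.1.2 (hyn h5.1.1)
          · exact h5.2.1
      · exact Or.inr ⟨fun z hz => (v₁ z hz).1, fun z hz => (v₂ z hz).1⟩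
  have hEm : ∀ z, E z ∈ (1 - E).ker := fun z => (hN _).2 (projection_apply_apply hE z)
  have hEm' : ∀ z, z - E z ∈ E.ker := fun z => (hM _).2 (by
    rw [map_sub, projection_apply_apply hE, sub_self])
  rcases hfin with ⟨f₁, f₂⟩ | ⟨f₁, f₂⟩
  · exact Or.inl (eq_of_invForm_eq hA hB fun z => by
      rw [invForm_add_of_commute hA hE hEA, invForm_add_of_commute hB hE hEB, f₁ _ (hEm' z),
        f₂ _ (hEm z)]).symm
  · refine Or.inr ?_
    rw [eq_of_invForm_eq hA hcB fun z => by
      rw [invForm_add_of_commute hA hE hEA, invForm_add_of_commute hcB hE hEcB, f₁ _ (hEm' z),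
        f₂ _ (hEm z)], sub_sub_cancel]

/-- A non-scalar effect is determined, up to its ortho-complement, by its strengths along all
vectors and the projections commuting with it. -/
theorem eq_or_eq_compl_of_str_add {A B : H →L[ℂ] H} (hA : 0 ≤ A) (hA' : A ≤ 1) (hB : 0 ≤ B)
    (hB' : B ≤ 1) (hns : ¬ ∃ t : ℝ, 0 ≤ t ∧ t ≤ 1 ∧ A = t • 1)
    (hL : ∀ x : H, x ≠ 0 → str A x + str (1 - A) x = str B x + str (1 - B) x)
    (hcomm : ∀ E : H →L[ℂ] H, IsStarProjection E → Commute E A → Commute E B) :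
    B = A ∨ B = 1 - A := by
  have hcA : 0 ≤ 1 - A := sub_nonneg.2 hA'
  have hcB : 0 ≤ 1 - B := sub_nonneg.2 hB'
  have hcA' : 1 - A ≤ 1 := sub_le_self _ hA
  have hcB' : 1 - B ≤ 1 := sub_le_self _ hB
  have hcc : ∀ T : H →L[ℂ] H, 1 - (1 - T) = T := fun T => sub_sub_cancel 1 T
  have hinv := inv_invForm_add_eq hA hA' hB hB' hL
  -- First the case where `1 - A` is invertible
  have main : ∀ A B : H →L[ℂ] H, 0 ≤ A → A ≤ 1 → 0 ≤ B → B ≤ 1 →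
      (¬ ∃ t : ℝ, 0 ≤ t ∧ t ≤ 1 ∧ A = t • 1) →
      (∀ x : H, x ≠ 0 → str A x + str (1 - A) x = str B x + str (1 - B) x) →
      (∀ E : H →L[ℂ] H, IsStarProjection E → Commute E A → Commute E B) →
      (∀ x, invForm (1 - A) x ≠ ⊤) → B = A ∨ B = 1 - A := by
    intro A B hA hA' hB hB' hns hL hcomm h2
    have hcB : 0 ≤ 1 - B := sub_nonneg.2 hB'
    have hcB' : 1 - B ≤ 1 := sub_le_self _ hB
    have hinv := inv_invForm_add_eq hA hA' hB hB' hL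
    rcases isQuad_zero.cover (invForm_isQuad hB) (invForm_isQuad hcB) (fun x _ =>
      (finite_iff_of_inv_add_eq (hinv x)).1 (Or.inr (h2 x))) with h3 | h3
    · have := eq_or_eq_compl_of_finite (B := 1 - B) hA hA' hcB hcB' hns
        (fun x hx => by rw [hL x hx, hcc, add_comm])
        (fun E hE h => (Commute.one_right E).sub_right (hcomm E hE h)) h2
        (fun x => by rw [hcc]; exact h3 x (by simp))
      rcases this with h4 | h4
      · exact Or.inr (by rw [← h4, hcc])
      · exact Or.inl (by rw [← hcc B, h4, hcc])
    · exact eq_or_eq_compl_of_finite hA hA' hB hB' hns hL hcomm h2 fun x => h3 x (by simp)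
  by_cases h2 : ∃ x, invForm (1 - A) x = ⊤
  · by_cases h1 : ∃ x, invForm A x = ⊤
    · exact eq_or_eq_compl_of_not_finite hA hA' hB hB' hL h1 h2
    · push Not at h1
      have := main (1 - A) B hcA hcA' hB hB' (fun ⟨t, ht, ht', h⟩ => hns ⟨1 - t, by linarith,
          by linarith, by rw [sub_smul, one_smul, ← h, hcc]⟩)
        (fun x hx => by rw [hcc, add_comm, hL x hx])
        (fun E hE h => hcomm E hE (by
          have := (Commute.one_right E).sub_right h
          rwa [hcc] at this)) (fun x => by rw [hcc]; exact h1 x)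
      rw [hcc] at this
      exact this.symm
  · push Not at h2
    exact main A B hA hA' hB hB' hns hL hcomm h2

end Effect

/-! ### Characterizing rank-one projections and their complements -/

namespace Effect

variable {H : Type*} [NormedAddCommGroup H] [InnerProductSpace ℂ H] [CompleteSpace H]

lemma invForm_projection_ne_top_iff {P : H →L[ℂ] H} (hP : IsStarProjection P) {x : H} :
    invForm P x ≠ ⊤ ↔ P x = x := by
  constructor
  · intro h
    by_cases hx : x = 0
    · simp [hx]
    have hpos := (str_pos_iff hP.zero_le hP.le_one' hx).2 h
    have hle := (smul_ray_le_iff_str hP.zero_le hP.le_one' hpos.le hx).2 le_rfl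
    have h0 : P (x - P x) = 0 := by rw [map_sub, projection_apply_apply hP, sub_self]
    have h1 := apply_eq_zero_of_le (smul_nonneg hpos.le (ray_nonneg x)) hle h0
    have h2 : qf (str P x • ray x) (x - P x) = 0 := by simp [qf, h1]
    rw [qf_smul, qf_ray, mul_eq_zero, or_iff_right hpos.ne'] at h2
    have h3 : inner ℂ x (x - P x) = 0 := by simpa using h2
    have h4 := norm_sq_projection hP x
    have h5 := qf_projection hP x
    rw [inner_sub_right, sub_eq_zero, inner_self_eq_norm_sq_to_K,
      ← inner_apply_comm hP.isSelfAdjoint] at h3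
    have h6 := congrArg Complex.re h3
    rw [← qf, h5] at h6
    have h7 : ‖x‖ ^ 2 = ‖P x‖ ^ 2 := by
      rw [← h6]
      norm_cast
    have h8 : ‖x - P x‖ = 0 := by
      have : ‖x - P x‖ ^ 2 = 0 := by linarith
      simpa using this
    exact (sub_eq_zero.1 (norm_eq_zero.1 h8)).symm
  · intro h
    rw [← h]
    exact invForm_apply_ne_top hP.zero_le x

/-- `B` and `C` are coexistent with the same operators among those coexistent with `A`. -/
def SameCoexOn (A B C : H →L[ℂ] H) : Prop :=
  ∀ X : H →L[ℂ] H, 0 ≤ X → X ≤ 1 → Coex A X → (Coex B X ↔ Coex C X)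

lemma SameCoexOn.compl_left {A B C : H →L[ℂ] H} (h : SameCoexOn A B C) : SameCoexOn (1 - A) B C :=
  fun X hX hX' hAX => h X hX hX' (coex_compl_left.1 hAX)

lemma SameCoexOn.compl_right {A B C : H →L[ℂ] H} (h : SameCoexOn A B C) : SameCoexOn A B (1 - C) :=
  fun X hX hX' hAX => by rw [coex_compl_left]; exact h X hX hX' hAX

lemma smul_ray_le_one {x : H} {s : ℝ} (h : s * ‖x‖ ^ 2 ≤ 1) : s • ray x ≤ 1 := by
  rw [le_iff_qf (isSelfAdjoint_real_smul _ (ray_isSelfAdjoint x)) (.one _)]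
  intro z
  rw [qf_smul, qf_ray, qf_one]
  by_cases hs : 0 ≤ s
  · have : ‖inner ℂ x z‖ ^ 2 ≤ ‖x‖ ^ 2 * ‖z‖ ^ 2 := by
      rw [← mul_pow]; gcongr; exact norm_inner_le_norm _ _
    nlinarith [sq_nonneg ‖z‖]
  · nlinarith [sq_nonneg ‖z‖, sq_nonneg ‖inner ℂ x z‖]

/-- Testing with small multiples of `|x⟩⟨x|` for `x` in the range of the square root of `A`. -/
lemma SameCoexOn.finite_iff {A B C : H →L[ℂ] H} (hA : 0 ≤ A) (hA' : A ≤ 1) (hB : 0 ≤ B)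
    (hB' : B ≤ 1) (hC : 0 ≤ C) (hC' : C ≤ 1) (h : SameCoexOn A B C) {x : H}
    (hxA : invForm A x ≠ ⊤) :
    (invForm B x ≠ ⊤ ∨ invForm (1 - B) x ≠ ⊤) ↔ (invForm C x ≠ ⊤ ∨ invForm (1 - C) x ≠ ⊤) := by
  by_cases hx : x = 0
  · subst hx
    simp [(invForm_isQuad hB).zero, (invForm_isQuad hC).zero]
  have key : ∀ B : H →L[ℂ] H, 0 ≤ B → B ≤ 1 → ((invForm B x ≠ ⊤ ∨ invForm (1 - B) x ≠ ⊤) ↔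
      0 < str B x + str (1 - B) x) := fun B hB hB' => by
    rw [← str_pos_iff hB hB' hx, ← str_pos_iff (sub_nonneg.2 hB') (sub_le_self _ hB) hx]
    have h1 := str_nonneg B x
    have h2 := str_nonneg (1 - B) x
    constructor
    · rintro (h | h) <;> linarith
    · intro h3
      by_contra! hcon
      linarith [hcon.1, hcon.2]
  have hA0 := (key A hA hA').1 (.inl hxA)
  have test : ∀ s : ℝ, 0 ≤ s → s ≤ str A x + str (1 - A) x →
      (s ≤ str B x + str (1 - B) x ↔ s ≤ str C x + str (1 - C) x) := fun s hs hsA => by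
    rw [← coex_smul_ray_iff_str hB hB' hs hx, ← coex_smul_ray_iff_str hC hC' hs hx]
    refine h _ (smul_nonneg hs (ray_nonneg x)) (smul_ray_le_one ?_)
      ((coex_smul_ray_iff_str hA hA' hs hx).2 hsA)
    exact (mul_le_mul_of_nonneg_right hsA (by positivity)).trans (str_add_str_le hA hA' hx)
  rw [key B hB hB', key C hC hC']
  constructor
  · intro h1
    exact (lt_min hA0 h1).trans_le ((test _ (lt_min hA0 h1).le (min_le_left _ _)).1
      (min_le_right _ _))
  · intro h1
    exact (lt_min hA0 h1).trans_le ((test _ (lt_min hA0 h1).le (min_le_left _ _)).2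
      (min_le_right _ _))

lemma SameCoexOn.commute_projection {A B C : H →L[ℂ] H} (hA : 0 ≤ A) (hA' : A ≤ 1)
    (hBp : IsStarProjection B)
    (h : SameCoexOn A B C) {E : H →L[ℂ] H} (hE : IsStarProjection E) (hEA : Commute E A)
    (hEB : Commute E B) : Commute C E := by
  have h1 := (h E hE.zero_le hE.le_one' (coex_of_commute hA hA' hE.zero_le hE.le_one' hEA.symm)).1
    (coex_of_commute hBp.zero_le hBp.le_one' hE.zero_le hE.le_one' hEB.symm)
  exact (commute_of_coex_projection hE h1.symm).symm

/-- A projection `B` commuting with `A` and cutting the range of `A` nontrivially is determined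
there, up to complement, by what it is coexistent with. -/
lemma SameCoexOn.mul_eq {A B C : H →L[ℂ] H} (hA : 0 ≤ A) (hA' : A ≤ 1)
    (hBp : IsStarProjection B) (hAB : Commute A B) (hC : 0 ≤ C) (hC' : C ≤ 1)
    (h : SameCoexOn A B C) (h₁ : A * B ≠ 0) (h₂ : A * (1 - B) ≠ 0) :
    A * C = A * B ∨ A * C = A * (1 - B) := by
  have hCB : Commute C B := h.commute_projection hA hA' hBp hBp hAB.symm (.refl _)
  have hCA : Commute C A := commute_of_forall_projection hA hA' fun E hE hX =>
    h.commute_projection hA hA' hBp hE (hX A (.refl _)).symm (hX B hAB.symm).symm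
  obtain ⟨x₀, hx₀⟩ : ∃ x, (A * B) x ≠ 0 := by
    by_contra! hcon
    exact h₁ (by ext x; simpa using hcon x)
  obtain ⟨y₀, hy₀⟩ : ∃ x, (A * (1 - B)) x ≠ 0 := by
    by_contra! hcon
    exact h₂ (by ext x; simpa using hcon x)
  -- Vectors of the range of `A` inside and outside the range of `B` cannot both be in the form
  -- domain of `C`, nor both in that of `1 - C`.
  have hBA : ∀ z, B (A (B z)) = A (B z) := fun z => by
    rw [← mul_apply_eq_comp B A, ← hAB.eq, mul_apply_eq_comp, projection_apply_apply hBp]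
  have hBA' : ∀ z, B (A ((1 - B) z)) = 0 := fun z => by
    rw [← mul_apply_eq_comp B A, ← hAB.eq, mul_apply_eq_comp]
    simp [projection_apply_apply hBp]
  have core : ∀ C : H →L[ℂ] H, 0 ≤ C → C ≤ 1 → SameCoexOn A B C → ∀ z w, A (B z) ≠ 0 →
      A ((1 - B) w) ≠ 0 → invForm C (A (B z)) ≠ ⊤ → invForm C (A ((1 - B) w)) ≠ ⊤ → False := by
    intro C hC hC' h z w hz hw h1 h2
    have hne := (invForm_isQuad hC).add_ne_top h1 h2
    rw [← map_add] at hne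
    have h3 := (h.finite_iff hA hA' hBp.zero_le hBp.le_one' hC hC'
      (invForm_apply_ne_top hA (B z + (1 - B) w))).2 (.inl hne)
    rw [invForm_projection_ne_top_iff hBp, invForm_projection_ne_top_iff hBp.one_sub, map_add,
      map_add B, hBA, hBA'] at h3
    rcases h3 with h3 | h3
    · rw [add_zero, left_eq_add] at h3
      exact hw h3
    · simp only [sub_apply, one_apply_eq_self, map_add, map_sub] at h3
      rw [← map_sub] at h3
      have h4 := congrArg B h3
      have h5 : B (A w) - A (B w) = 0 := by simpa [hBA] using hBA' w
      simp only [map_sub, map_add, hBA, projection_apply_apply hBp] at h4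
      apply hz
      simpa [hBA, h5] using h4.symm
  have main : ∀ C : H →L[ℂ] H, 0 ≤ C → C ≤ 1 → SameCoexOn A B C → Commute C A → Commute C B →
      invForm C ((A * B) x₀) ≠ ⊤ → A * C = A * B := by
    intro C hC hC' h hCA hCB hx
    have hcompl := sub_nonneg.2 hC'
    have hcompl' : 1 - C ≤ 1 := sub_le_self _ hC
    have e1 : ∀ w, C (A ((1 - B) w)) = 0 := fun w => by
      by_contra hne
      have e : C (A ((1 - B) w)) = A ((1 - B) (C w)) := by
        simp only [← mul_apply_eq_comp]
        rw [← mul_assoc, hCA.eq, mul_assoc, ((Commute.one_right C).sub_right hCB).eq]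
      refine core C hC hC' h x₀ (C w) hx₀ (e ▸ hne) hx ?_
      rw [← e]
      exact invForm_apply_ne_top hC _
    have e2 : ∀ z, (1 - C) (A (B z)) = 0 := fun z => by
      by_contra hne
      have e : (1 - C) (A (B z)) = A (B ((1 - C) z)) := by
        simp only [← mul_apply_eq_comp]
        rw [← mul_assoc, ((Commute.one_left A).sub_left hCA).eq, mul_assoc,
          ((Commute.one_left B).sub_left hCB).eq]
      refine core (1 - C) hcompl hcompl' h.compl_right ((1 - C) z) y₀ (e ▸ hne) hy₀ ?_ ?_
      · rw [← e]
        exact invForm_apply_ne_top hcompl _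
      · have : (1 - C) (A ((1 - B) y₀)) = A ((1 - B) y₀) := by
          rw [sub_apply, one_apply_eq_self, e1, sub_zero]
        rw [← this]
        exact invForm_apply_ne_top hcompl _
    rw [← hCA.eq]
    ext z
    have hz : A z = A (B z) + A ((1 - B) z) := by
      rw [← map_add]
      simp
    have e2' := e2 z
    rw [sub_apply, one_apply_eq_self, sub_eq_zero] at e2'
    rw [mul_apply_eq_comp, hz, map_add, e1, ← e2', add_zero, mul_apply_eq_comp]
  have hd := (h.finite_iff hA hA' hBp.zero_le hBp.le_one' hC hC'
    (invForm_apply_ne_top hA (B x₀))).1 (.inl ((invForm_projection_ne_top_iff hBp).2 (hBA x₀)))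
  rcases hd with hd | hd
  · exact .inl (main C hC hC' h hCA hCB hd)
  · right
    have := main (1 - C) (sub_nonneg.2 hC') (sub_le_self _ hC) h.compl_right
      ((Commute.one_left A).sub_left hCA) ((Commute.one_left B).sub_left hCB) hd
    rw [mul_sub, mul_one, sub_eq_iff_eq_add] at this
    rw [mul_sub, mul_one, eq_sub_iff_add_eq, add_comm]
    exact this.symm

lemma mul_ne_zero_of_apply {A B : H →L[ℂ] H} {x : H} (h : A (B x) ≠ 0) : A * B ≠ 0 := fun h0 =>
  h (by rw [← mul_apply_eq_comp, h0]; rfl)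

/-- If `A` is injective, a spectral cut of `A` is a projection `B` as required. -/
lemma finite_sameCoexOn_of_injective {A : H →L[ℂ] H} (hA : 0 ≤ A) (hA' : A ≤ 1)
    (hns : ¬ ∃ t : ℝ, 0 ≤ t ∧ t ≤ 1 ∧ A = t • 1) (hinj : ∀ x, A x = 0 → x = 0) :
    ∃ B : H →L[ℂ] H, IsStarProjection B ∧ Commute A B ∧
      {C : H →L[ℂ] H | 0 ≤ C ∧ C ≤ 1 ∧ SameCoexOn A B C}.Finite := by
  obtain ⟨c, E, -, -, hE, hcomm, ⟨x, hx, hEx⟩, ⟨y, hy, hEy⟩, -, -⟩ := exists_cut hA hA' hns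
  have hAE := hcomm A (.refl _)
  refine ⟨E, hE, hAE, (Set.toFinite {E, 1 - E}).subset ?_⟩
  rintro C ⟨hC, hC', h⟩
  have h₁ : A * E ≠ 0 := mul_ne_zero_of_apply (x := x) (by rw [hEx]; exact fun h => hx (hinj x h))
  have h₂ : A * (1 - E) ≠ 0 := mul_ne_zero_of_apply (x := y) (by
    rw [sub_apply, one_apply_eq_self, hEy, sub_zero]; exact fun h => hy (hinj y h))
  have cancel : ∀ X Y : H →L[ℂ] H, A * X = A * Y → X = Y := fun X Y hXY => by
    ext z
    refine sub_eq_zero.1 (hinj _ ?_)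
    rw [map_sub, ← mul_apply_eq_comp, hXY, mul_apply_eq_comp, sub_self]
  rcases h.mul_eq hA hA' hE hAE hC hC' h₁ h₂ with h | h
  · exact .inl (cancel _ _ h)
  · exact .inr (cancel _ _ h)

lemma ne_zero_of_norm_eq_one {x : H} (hx : ‖x‖ = 1) : x ≠ 0 := fun h => by simp [h] at hx

lemma ray_ne_zero {x : H} (hx : ‖x‖ = 1) : ray x ≠ 0 :=
  InnerProductSpace.rankOne_ne_zero (ne_zero_of_norm_eq_one hx) (ne_zero_of_norm_eq_one hx)

lemma ray_mul_ray_eq_zero {e f : H} (h : inner ℂ e f = 0) : ray e * ray f = 0 := by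
  ext z
  simp [InnerProductSpace.rankOne_apply, h]

lemma mul_ray {A : H →L[ℂ] H} {e : H} {c : ℝ} (h : A e = c • e) : A * ray e = c • ray e := by
  ext z
  simp only [mul_apply_eq_comp, InnerProductSpace.rankOne_apply, map_smul, h, smul_apply]
  rw [smul_comm]

lemma ray_mul {A : H →L[ℂ] H} (hA : IsSelfAdjoint A) {e : H} {c : ℝ} (h : A e = c • e) :
    ray e * A = c • ray e := by
  have := congrArg star (mul_ray h)
  rwa [star_mul, (ray_isSelfAdjoint e).star_eq, hA.star_eq, star_smul,
    (ray_isSelfAdjoint e).star_eq, star_trivial] at this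

/-- An effect that is neither scalar nor a rank-one projection nor the complement of one commutes
with a projection which its coexistence relation pins down up to finitely many effects. -/
lemma exists_finite_sameCoexOn {A : H →L[ℂ] H} (hA : 0 ≤ A) (hA' : A ≤ 1)
    (hns : ¬ ∃ t : ℝ, 0 ≤ t ∧ t ≤ 1 ∧ A = t • 1) (h₁ : ∀ x : H, ‖x‖ = 1 → A ≠ ray x)
    (h₂ : ∀ x : H, ‖x‖ = 1 → A ≠ 1 - ray x) :
    ∃ B : H →L[ℂ] H, IsStarProjection B ∧ Commute A B ∧
      {C : H →L[ℂ] H | 0 ≤ C ∧ C ≤ 1 ∧ SameCoexOn A B C}.Finite := by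
  have hcA : 0 ≤ 1 - A := sub_nonneg.2 hA'
  have hcA' : 1 - A ≤ 1 := sub_le_self _ hA
  by_cases hi : ∀ x, A x = 0 → x = 0
  · exact finite_sameCoexOn_of_injective hA hA' hns hi
  by_cases hi' : ∀ x, (1 - A) x = 0 → x = 0
  · have hns' : ¬ ∃ t : ℝ, 0 ≤ t ∧ t ≤ 1 ∧ 1 - A = t • (1 : H →L[ℂ] H) := by
      rintro ⟨t, ht, ht', h⟩
      refine hns ⟨1 - t, by linarith, by linarith, ?_⟩
      rw [sub_smul, one_smul, ← h, sub_sub_cancel]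
    obtain ⟨B, hB, hAB, hfin⟩ := finite_sameCoexOn_of_injective hcA hcA' hns' hi'
    refine ⟨B, hB, ?_, hfin.subset fun C hC => ⟨hC.1, hC.2.1, hC.2.2.compl_left⟩⟩
    have := (Commute.one_left B).sub_left hAB
    rwa [sub_sub_cancel] at this
  push Not at hi hi'
  have unit : ∀ T : H →L[ℂ] H, (∃ x, T x = 0 ∧ x ≠ 0) → ∃ x, T x = 0 ∧ ‖x‖ = 1 := by
    rintro T ⟨x, hx, hx0⟩
    exact ⟨((‖x‖ : ℂ)⁻¹) • x, by rw [map_smul, hx, smul_zero], norm_smul_inv_norm hx0⟩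
  obtain ⟨f, hf, hf1⟩ := unit A hi
  obtain ⟨e, he, he1⟩ := unit (1 - A) hi'
  have he' : A e = e := by
    rw [sub_apply, one_apply_eq_self, sub_eq_zero] at he
    exact he.symm
  have hsa : IsSelfAdjoint A := .of_nonneg hA
  have hef : inner ℂ e f = 0 := by
    rw [← he', inner_apply_comm hsa, hf, inner_zero_right]
  have hAe : A * ray e = ray e := by rw [mul_ray (c := 1) (by rw [he', one_smul]), one_smul]
  have hAf : A * ray f = 0 := by rw [mul_ray (c := 0) (by rw [hf, zero_smul]), zero_smul]
  have heA : ray e * A = ray e := by rw [ray_mul hsa (c := 1) (by rw [he', one_smul]), one_smul]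
  have hfA : ray f * A = 0 := by rw [ray_mul hsa (c := 0) (by rw [hf, zero_smul]), zero_smul]
  set B := ray e + ray f with hBdef
  have hBp : IsStarProjection B :=
    (ray_isStarProjection he1).add (ray_isStarProjection hf1) (ray_mul_ray_eq_zero hef)
  have hAB : A * B = ray e := by rw [hBdef, mul_add, hAe, hAf, add_zero]
  have hBA : B * A = ray e := by rw [hBdef, add_mul, heA, hfA, add_zero]
  have hABc : Commute A B := hAB.trans hBA.symm
  have hABc' : Commute (1 - A) B := (Commute.one_left B).sub_left hABc
  have n1 : A * B ≠ 0 := hAB ▸ ray_ne_zero he1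
  have n2 : A * (1 - B) ≠ 0 := by
    rw [mul_sub, mul_one, hAB, sub_ne_zero]
    exact h₁ e he1
  have hcAB : (1 - A) * B = ray f := by rw [sub_mul, one_mul, hAB, hBdef, add_sub_cancel_left]
  have n3 : (1 - A) * B ≠ 0 := hcAB ▸ ray_ne_zero hf1
  have n4 : (1 - A) * (1 - B) ≠ 0 := by
    rw [mul_sub, mul_one, hcAB, sub_ne_zero]
    intro h
    exact h₂ f hf1 (by rw [← h, sub_sub_cancel])
  refine ⟨B, hBp, hABc, (Set.toFinite {A * B + (1 - A) * B, A * B + (1 - A) * (1 - B),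
    A * (1 - B) + (1 - A) * B, A * (1 - B) + (1 - A) * (1 - B)}).subset ?_⟩
  rintro C ⟨hC, hC', h⟩
  have hsum : C = A * C + (1 - A) * C := by noncomm_ring
  have d1 := h.mul_eq hA hA' hBp hABc hC hC' n1 n2
  have d2 := h.compl_left.mul_eq hcA hcA' hBp hABc' hC hC' n3 n4
  simp only [Set.mem_insert_iff, Set.mem_singleton_iff]
  rw [hsum]
  rcases d1 with d1 | d1 <;> rcases d2 with d2 | d2 <;> rw [d1, d2] <;> simp

/-- On the range of a rank-one projection coexistence imposes no condition, so there every effect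
commuting with the projection may be replaced by any scalar. -/
lemma infinite_sameCoexOn_ray {x : H} (hx : ‖x‖ = 1) {B : H →L[ℂ] H} (hB : 0 ≤ B) (hB' : B ≤ 1)
    (h : Coex (ray x) B) :
    {C : H →L[ℂ] H | 0 ≤ C ∧ C ≤ 1 ∧ SameCoexOn (ray x) B C}.Infinite := by
  set W := ray x with hWdef
  have hW : IsStarProjection W := ray_isStarProjection hx
  have hWB : Commute W B := commute_of_coex_projection hW h
  have hWW : W * W = W := hW.isIdempotentElem.eq
  have hWc : Commute W (1 - W) := (Commute.one_right W).sub_right (.refl W)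
  set C : ℝ → H →L[ℂ] H := fun c => c • W + B * (1 - W) with hCdef
  have hBV : B * (1 - W) = (1 - W) * B * (1 - W) := by
    rw [((Commute.one_left B).sub_left hWB).eq, mul_assoc, hW.one_sub.isIdempotentElem.eq]
  have hC0 : ∀ c : ℝ, 0 ≤ c → 0 ≤ C c := fun c hc =>
    add_nonneg (smul_nonneg hc hW.zero_le) (hBV ▸ hW.one_sub.isSelfAdjoint.conjugate_nonneg hB)
  have hC1 : ∀ c : ℝ, c ≤ 1 → C c ≤ 1 := fun c hc => by
    have h1 : (1 - W) * B * (1 - W) ≤ 1 - W := by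
      have := hW.one_sub.isSelfAdjoint.conjugate_le_conjugate hB'
      rwa [mul_one, hW.one_sub.isIdempotentElem.eq] at this
    calc C c ≤ W + (1 - W) :=
          add_le_add (smul_le_of_le_one_left hW.zero_le hc) (hBV ▸ h1)
      _ = 1 := by abel
  have hCW : ∀ c, C c * W = c • W := fun c => by
    simp only [hCdef]
    rw [add_mul, smul_mul_assoc, hWW, mul_assoc, sub_mul, one_mul, hWW, sub_self, mul_zero,
      add_zero]
  have hCV : ∀ c, C c * (1 - W) = B * (1 - W) := fun c => by
    simp only [hCdef]
    rw [add_mul, smul_mul_assoc, mul_sub, mul_one, hWW, sub_self, smul_zero, zero_add, mul_assoc,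
      hW.one_sub.isIdempotentElem.eq]
  have hWC : ∀ c, Commute W (C c) := fun c =>
    ((Commute.refl W).smul_right c).add_right (hWB.mul_right hWc)
  -- `B` acts as a scalar on the range of `W`.
  have hBW : ∃ b : ℝ, 0 ≤ b ∧ b ≤ 1 ∧ B * W = b • W := by
    have hle : W * B * W ≤ (1 : ℝ) • ray x := by
      rw [one_smul]
      have := hW.isSelfAdjoint.conjugate_le_conjugate hB'
      rwa [mul_one, hWW] at this
    obtain ⟨b, hb, hbe⟩ := eq_smul_ray_of_le (ne_zero_of_norm_eq_one hx) (hW.isSelfAdjoint.conjugate_nonneg hB) hle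
    refine ⟨b, hb, ?_, ?_⟩
    · rw [hbe] at hle
      have := qf_mono hle x
      rw [qf_smul, qf_smul, qf_ray, norm_inner_self_eq, hx] at this
      simpa using this
    · rw [← hbe, hWB.eq, mul_assoc, hWW]
  obtain ⟨b, hb, hb', hBW⟩ := hBW
  have hinj : Set.InjOn C (Set.Icc 0 1) := fun c _ d _ hcd => by
    have h1 : C c * W = C d * W := congrArg (· * W) hcd
    rw [hCW, hCW] at h1
    exact smul_left_injective ℝ (ray_ne_zero hx) h1
  refine ((Set.Icc_infinite (zero_lt_one' ℝ)).image hinj).mono ?_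
  rintro _ ⟨c, ⟨hc, hc'⟩, rfl⟩
  refine ⟨hC0 c hc, hC1 c hc', fun X hX hX' hWX => ?_⟩
  have hWX' : Commute W X := commute_of_coex_projection hW hWX
  exact ⟨fun hBX => Coex.change_block hW (hCV c) (hCW c) hc hc' hWB hWX' rfl hWX' hX hX' hBX,
    fun hCX => Coex.change_block hW (hCV c).symm hBW hb hb' (hWC c) hWX' rfl hWX' hX hX' hCX⟩

/-- The operators in `[0, 1]`, that is, the underlying operators of effects. -/
def IsEff (A : H →L[ℂ] H) : Prop := 0 ≤ A ∧ A ≤ 1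

/-- Operators `t I` with `t ∈ [0, 1]`. -/
def IsScalarOp (A : H →L[ℂ] H) : Prop := ∃ t : ℝ, 0 ≤ t ∧ t ≤ 1 ∧ A = t • 1

/-- Rank-one projections and their complements, in terms of unit vectors. -/
def IsRayLike (A : H →L[ℂ] H) : Prop := ∃ x : H, ‖x‖ = 1 ∧ (A = ray x ∨ A = 1 - ray x)

/-- In terms of coexistence alone, a non-scalar effect `A` is a rank-one projection or the
complement of one exactly when its coexistence relation never pins down an effect `B` up to
finitely many possibilities. -/
lemma isRayLike_iff {A : H →L[ℂ] H} (hA : IsEff A) (hns : ¬ IsScalarOp A) :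
    IsRayLike A ↔ ∀ B : H →L[ℂ] H, IsEff B → Coex A B →
      {C : H →L[ℂ] H | 0 ≤ C ∧ C ≤ 1 ∧ SameCoexOn A B C}.Infinite := by
  constructor
  · rintro ⟨x, hx, rfl | rfl⟩ B hB hAB
    · exact infinite_sameCoexOn_ray hx hB.1 hB.2 hAB
    · exact (infinite_sameCoexOn_ray hx hB.1 hB.2 (coex_compl_left.1 hAB)).mono fun C hC =>
        ⟨hC.1, hC.2.1, hC.2.2.compl_left⟩
  · intro h
    by_contra hcon
    simp only [IsRayLike, not_exists, not_and, not_or] at hcon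
    obtain ⟨B, hB, hAB, hfin⟩ := exists_finite_sameCoexOn hA.1 hA.2 hns
      (fun x hx => (hcon x hx).1) (fun x hx => (hcon x hx).2)
    exact h B ⟨hB.zero_le, hB.le_one'⟩ (coex_of_commute hA.1 hA.2 hB.zero_le hB.le_one' hAB) hfin

end Effect

/-! ### Strength functions at sums of eigenvectors -/

namespace Effect

variable {H : Type*} [NormedAddCommGroup H] [InnerProductSpace ℂ H] [CompleteSpace H]

lemma IsEff.isSelfAdjoint {A : H →L[ℂ] H} (hA : IsEff A) : IsSelfAdjoint A := .of_nonneg hA.1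

lemma IsEff.compl {A : H →L[ℂ] H} (hA : IsEff A) : IsEff (1 - A) :=
  ⟨sub_nonneg.2 hA.2, sub_le_self _ hA.1⟩

lemma IsEff.smul {A : H →L[ℂ] H} (hA : IsEff A) {t : ℝ} (ht : 0 ≤ t) (ht' : t ≤ 1) :
    IsEff (t • A) :=
  ⟨smul_nonneg ht hA.1, (smul_le_of_le_one_left hA.1 ht').trans hA.2⟩

lemma _root_.IsStarProjection.isEff {P : H →L[ℂ] H} (hP : IsStarProjection P) : IsEff P :=
  ⟨hP.zero_le, hP.le_one'⟩

lemma isEff_ray {x : H} (hx : ‖x‖ = 1) : IsEff (ray x) := (ray_isStarProjection hx).isEff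

lemma isEff_smul_ray {x : H} {s : ℝ} (hs : 0 ≤ s) (h : s * ‖x‖ ^ 2 ≤ 1) : IsEff (s • ray x) :=
  ⟨smul_nonneg hs (ray_nonneg x), smul_ray_le_one h⟩

lemma ray_smul (c : ℂ) (x : H) : ray (c • x) = (‖c‖ ^ 2 : ℝ) • ray x := by
  refine ext_qf (ray_isSelfAdjoint _) (isSelfAdjoint_real_smul _ (ray_isSelfAdjoint _)) fun z => ?_
  rw [qf_ray, qf_smul, qf_ray, inner_smul_left, norm_mul, mul_pow, RCLike.norm_conj]

lemma qf_eigen {A : H →L[ℂ] H} {e : H} {c : ℝ} (h : A e = c • e) : qf A e = c * ‖e‖ ^ 2 := by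
  rw [← qf_real_smul_one]
  simp [qf, h]

lemma commute_ray_of_apply {A : H →L[ℂ] H} (hA : IsSelfAdjoint A) {e : H} {c : ℝ}
    (h : A e = c • e) : Commute A (ray e) :=
  (mul_ray h).trans (ray_mul hA h).symm

lemma inner_apply_self_eq_qf {A : H →L[ℂ] H} (hA : IsSelfAdjoint A) (y : H) :
    inner ℂ y (A y) = (qf A y : ℂ) := by
  have h1 : (starRingEnd ℂ) (inner ℂ y (A y)) = inner ℂ y (A y) := by
    rw [inner_conj_symm, inner_apply_comm hA]
  rw [qf, inner_apply_comm hA]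
  exact (Complex.conj_eq_iff_re.1 h1).symm

lemma apply_eq_of_commute_ray {A : H →L[ℂ] H} (hA : IsSelfAdjoint A) {y : H} (hy : ‖y‖ = 1)
    (h : Commute A (ray y)) : A y = qf A y • y := by
  have h1 := DFunLike.congr_fun h.eq y
  rw [mul_apply_eq_comp, ray_apply_self hy, mul_apply_eq_comp, InnerProductSpace.rankOne_apply,
    inner_apply_self_eq_qf hA] at h1
  rw [h1]
  exact (Complex.coe_smul _ _)

lemma smul_ray_le_of_eigen {A : H →L[ℂ] H} (hA : IsEff A) {e : H} (he : ‖e‖ = 1) {c : ℝ}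
    (h : A e = c • e) : c • ray e ≤ A := by
  have h1 := mul_ray h
  have h2 := ray_mul hA.isSelfAdjoint h
  have hW := ray_isStarProjection he
  have h3 : A - c • ray e = (1 - ray e) * A * (1 - ray e) := by
    have h4 : ray e * ray e = ray e := hW.isIdempotentElem.eq
    rw [sub_mul, one_mul, h2, mul_sub, mul_one, sub_mul, h1, smul_mul_assoc, h4]
    abel
  rw [← sub_nonneg, h3]
  exact hW.one_sub.isSelfAdjoint.conjugate_nonneg hA.1

/-- The strength of an effect along an eigenvector is the eigenvalue. -/
lemma str_eigen {A : H →L[ℂ] H} (hA : IsEff A) {e : H} (he : e ≠ 0) {c : ℝ} (h : A e = c • e) :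
    str A e = c / ‖e‖ ^ 2 := by
  have hpos : 0 < ‖e‖ ^ 2 := by positivity
  have hq := qf_eigen h
  have hc : 0 ≤ c := by
    have := qf_nonneg hA.1 e
    rw [hq] at this
    exact nonneg_of_mul_nonneg_left this hpos
  refine le_antisymm ?_ ?_
  · rw [le_div_iff₀ hpos]
    have := str_mul_le hA.1 hA.2 he
    rw [hq] at this
    nlinarith
  · refine (smul_ray_le_iff_str hA.1 hA.2 (by positivity) he).1 ?_
    set u : H := ((‖e‖ : ℂ)⁻¹) • e with hu
    have hu1 : ‖u‖ = 1 := norm_smul_inv_norm he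
    have h1 := smul_ray_le_of_eigen hA hu1 (c := c) (by rw [hu, map_smul, h, smul_comm])
    convert h1 using 1
    rw [hu, ray_smul, smul_smul]
    congr 1
    simp
    field_simp

lemma str_eigen_add {A : H →L[ℂ] H} (hA : IsEff A) {e f : H} (he : ‖e‖ = 1) (hf : ‖f‖ = 1)
    (hef : inner ℂ e f = 0) {l m : ℝ} (hAe : A e = l • e) (hAf : A f = m • f) {α β : ℂ}
    (hα : α ≠ 0) (hβ : β ≠ 0) :
    str A (α • e + β • f) = l * m / (‖α‖ ^ 2 * m + ‖β‖ ^ 2 * l) := by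
  have he0 := ne_zero_of_norm_eq_one he
  have hf0 := ne_zero_of_norm_eq_one hf
  have h1 := str_smul_add hA.1 hA.2 (ray_isStarProjection hf)
    (commute_ray_of_apply hA.isSelfAdjoint hAf).symm (x := α • e) (y := β • f)
    (smul_ne_zero hα he0) (smul_ne_zero hβ hf0)
    (by
      rw [InnerProductSpace.rankOne_apply, inner_smul_right, ← inner_conj_symm, hef]
      simp)
    (by rw [map_smul, ray_apply_self hf]) one_ne_zero
  rw [str_eigen hA (smul_ne_zero hα he0) (c := l) (by rw [map_smul, hAe, smul_comm]),
    str_eigen hA (smul_ne_zero hβ hf0) (c := m) (by rw [map_smul, hAf, smul_comm]),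
    norm_smul, norm_smul, he, hf] at h1
  simp only [Complex.ofReal_one, one_smul, mul_one, one_pow, one_mul] at h1
  rw [h1]
  have hl : 0 ≤ l := by
    have := qf_nonneg hA.1 e
    rwa [qf_eigen hAe, he, one_pow, mul_one] at this
  have hm : 0 ≤ m := by
    have := qf_nonneg hA.1 f
    rwa [qf_eigen hAf, hf, one_pow, mul_one] at this
  have ha : 0 < ‖α‖ ^ 2 := by positivity
  have hb : 0 < ‖β‖ ^ 2 := by positivity
  generalize ‖α‖ ^ 2 = a at ha ⊢
  generalize ‖β‖ ^ 2 = b at hb ⊢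
  by_cases hl0 : l = 0
  · simp [hl0]
  · have hlp : 0 < l := lt_of_le_of_ne hl (Ne.symm hl0)
    have h3 : a * m + b * l ≠ 0 := by positivity
    have h4 : m / b + l / a ≠ 0 := by positivity
    field_simp

/-- The total strength of an effect with eigenvalues `l` and `m` along a vector whose components
have squared norms `a` and `b`. -/
noncomputable def pairStr (l m a b : ℝ) : ℝ :=
  l * m / (a * m + b * l) + (1 - l) * (1 - m) / (a * (1 - m) + b * (1 - l))

lemma str_add_str_eigen_add {A : H →L[ℂ] H} (hA : IsEff A) {e f : H} (he : ‖e‖ = 1) (hf : ‖f‖ = 1)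
    (hef : inner ℂ e f = 0) {l m : ℝ} (hAe : A e = l • e) (hAf : A f = m • f) {α β : ℂ}
    (hα : α ≠ 0) (hβ : β ≠ 0) :
    str A (α • e + β • f) + str (1 - A) (α • e + β • f) = pairStr l m (‖α‖ ^ 2) (‖β‖ ^ 2) := by
  rw [str_eigen_add hA he hf hef hAe hAf hα hβ,
    str_eigen_add hA.compl he hf hef (l := 1 - l) (m := 1 - m) (by simp [hAe, sub_smul])
      (by simp [hAf, sub_smul]) hα hβ, pairStr]

lemma pairStr_zero_one {t r : ℝ} : pairStr t 0 1 r = (1 - t) / (1 + r * (1 - t)) := by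
  simp [pairStr]

/-- Letting `r` tend to `0` in the inequality below gives `1 ≤ 1 - t` unless `m = 0` or
`m = 1`. -/
lemma of_pairStr_le {l m t : ℝ} (hl : 0 ≤ l) (hl' : l ≤ 1) (hm : 0 ≤ m) (hm' : m ≤ 1)
    (ht : 0 < t) (ht' : t ≤ 1) (h : ∀ r : ℝ, 0 < r → pairStr l m 1 r ≤ pairStr t 0 1 r) :
    (m = 0 ∨ m = 1) ∧ l ≠ m := by
  simp only [pairStr_zero_one] at h
  have hfirst : m = 0 ∨ m = 1 := by
    by_contra! hcon
    have hm0 : 0 < m := lt_of_le_of_ne hm (Ne.symm hcon.1)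
    have hm1 : 0 < 1 - m := sub_pos.2 (lt_of_le_of_ne hm' hcon.2)
    have hpos : 0 < m * (1 - m) := mul_pos hm0 hm1
    set r := t * (m * (1 - m)) / 2 with hr
    have hr0 : 0 < r := by positivity
    have h1 := h r hr0
    have key : ∀ l m : ℝ, 0 ≤ l → l ≤ 1 → 0 < m → l - r / m ≤ l * m / (1 * m + r * l) := by
      intro l m hl hl' hm
      rw [le_div_iff₀ (by positivity), sub_mul, sub_le_iff_le_add]
      have : r / m * (1 * m + r * l) = r + r * (r * l / m) := by field_simp
      rw [this]
      have h2 : 0 ≤ r * (r * l / m) := by positivity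
      have h3 : l * l ≤ 1 := mul_le_one₀ hl' hl hl'
      nlinarith [mul_le_mul_of_nonneg_left h3 hr0.le]
    have k1 := key l m hl hl' hm0
    have k2 := key (1 - l) (1 - m) (by linarith) (by linarith) hm1
    have k3 : (1 - t) / (1 + r * (1 - t)) ≤ 1 - t := by
      have : 0 ≤ 1 - t := by linarith
      exact div_le_self this (by nlinarith)
    have k4 : r / m + r / (1 - m) = t / 2 := by
      rw [hr]
      field_simp
      ring
    rw [pairStr] at h1
    linarith
  refine ⟨hfirst, ?_⟩
  rintro rfl
  have h1 := h 1 one_pos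
  have h2 : (1 - t) / (1 + 1 * (1 - t)) < 1 / 2 := by
    rw [div_lt_div_iff₀ (by linarith) (by norm_num)]
    linarith
  have h3 : pairStr l l 1 1 = 1 / 2 := by
    rcases hfirst with rfl | rfl <;> norm_num [pairStr]
  linarith

lemma str_add_le_of_coex {A B : H →L[ℂ] H} (hA : IsEff A) (hB : IsEff B) {x : H} (hx : x ≠ 0)
    (h : ∀ s : ℝ, 0 ≤ s → s * ‖x‖ ^ 2 ≤ 1 → Coex A (s • ray x) → Coex B (s • ray x)) :
    str A x + str (1 - A) x ≤ str B x + str (1 - B) x := by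
  have hp : 0 ≤ str A x + str (1 - A) x := add_nonneg (str_nonneg _ _) (str_nonneg _ _)
  rw [← coex_smul_ray_iff_str hB.1 hB.2 hp hx]
  exact h _ hp (str_add_str_le hA.1 hA.2 hx) ((coex_smul_ray_iff_str hA.1 hA.2 hp hx).2 le_rfl)

/-! ### Comparing coexistence relations -/

/-- Everything coexistent with `A` is coexistent with `B`: a preorder on effects defined by
coexistence alone, in which scalars are the largest effects. -/
def Finer (A B : H →L[ℂ] H) : Prop := ∀ X : H →L[ℂ] H, IsEff X → Coex A X → Coex B X

lemma Finer.refl (A : H →L[ℂ] H) : Finer A A := fun _ _ h => h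

lemma Finer.trans {A B C : H →L[ℂ] H} (h : Finer A B) (h' : Finer B C) : Finer A C :=
  fun X hX hAX => h' X hX (h X hX hAX)

lemma finer_compl_left {A B : H →L[ℂ] H} : Finer (1 - A) B ↔ Finer A B := by
  simp only [Finer, coex_compl_left]

lemma finer_compl_right {A B : H →L[ℂ] H} : Finer A (1 - B) ↔ Finer A B := by
  simp only [Finer, coex_compl_left]

lemma Finer.str_add_le {A B : H →L[ℂ] H} (h : Finer A B) (hA : IsEff A) (hB : IsEff B) {x : H}
    (hx : x ≠ 0) : str A x + str (1 - A) x ≤ str B x + str (1 - B) x :=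
  str_add_le_of_coex hA hB hx fun _ hs hs' => h _ (isEff_smul_ray hs hs')

/-- Let `e` and `f` be orthonormal eigenvectors of `D`, with `R e = e` and `R f = 0`. If every
multiple of `|e + c f⟩⟨e + c f|` that is coexistent with `D` is coexistent with `t R`, then the
eigenvalue of `D` at `f` is extreme, and different from the one at `e`. -/
lemma eigenvalue_of_finer {D R : H →L[ℂ] H} (hD : IsEff D) (hR : IsEff R) {e f : H} (he : ‖e‖ = 1)
    (hf : ‖f‖ = 1) (hef : inner ℂ e f = 0) {l m t : ℝ} (hDe : D e = l • e) (hDf : D f = m • f)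
    (hRe : R e = e) (hRf : R f = 0) (ht : 0 < t) (ht' : t ≤ 1)
    (h : ∀ (c : ℂ) (s : ℝ), IsEff (s • ray (e + c • f)) → Coex D (s • ray (e + c • f)) →
      Coex (t • R) (s • ray (e + c • f))) :
    (m = 0 ∨ m = 1) ∧ l ≠ m := by
  have hbound : ∀ e : H, ‖e‖ = 1 → ∀ c : ℝ, D e = c • e → 0 ≤ c ∧ c ≤ 1 := fun e he c hc => by
    have h1 := qf_nonneg hD.1 e
    have h2 := qf_mono hD.2 e
    rw [qf_eigen hc, he, one_pow, mul_one] at h1 h2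
    rw [qf_one, he, one_pow] at h2
    exact ⟨h1, h2⟩
  obtain ⟨hl, hl'⟩ := hbound e he l hDe
  obtain ⟨hm, hm'⟩ := hbound f hf m hDf
  refine of_pairStr_le hl hl' hm hm' ht ht' fun r hr => ?_
  have hr' : ((Real.sqrt r : ℝ) : ℂ) ≠ 0 := by exact_mod_cast (Real.sqrt_pos.2 hr).ne'
  have hnr : ‖((Real.sqrt r : ℝ) : ℂ)‖ ^ 2 = r := by
    rw [Complex.norm_real, Real.norm_of_nonneg (Real.sqrt_nonneg r), Real.sq_sqrt hr.le]
  have e1 := str_add_str_eigen_add hD he hf hef hDe hDf one_ne_zero hr'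
  have e2 := str_add_str_eigen_add (hR.smul ht.le ht') he hf hef (l := t) (m := 0)
    (by simp [hRe]) (by simp [hRf]) one_ne_zero hr'
  rw [hnr, one_smul, norm_one, one_pow] at e1 e2
  rw [← e1, ← e2]
  refine str_add_le_of_coex hD (hR.smul ht.le ht') (fun h0 => ?_) fun s hs hs' => ?_
  · have := congrArg (inner ℂ e) h0
    rw [inner_add_right, inner_smul_right, hef, inner_self_eq_norm_sq_to_K, he] at this
    simp at this
  · exact h _ s (isEff_smul_ray hs hs')

/-- Mixing an effect with its complement can only enlarge its coexistence relation. -/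
lemma finer_mix {D : H →L[ℂ] H} {α β : ℝ} (hα : 0 ≤ α) (hα' : α ≤ 1) (hβ : 0 ≤ β)
    (hβ' : β ≤ 1) : Finer D (α • D + β • (1 - D)) := by
  rintro X - ⟨F, G, hF, hF', hG, hG', rfl⟩
  refine ⟨(1 - α) • G + (1 - β) • F, α • G + β • F,
    add_nonneg (smul_nonneg (by linarith) hG) (smul_nonneg (by linarith) hF), ?_,
    add_nonneg (smul_nonneg hα hG) (smul_nonneg hβ hF),
    add_le_add (smul_le_smul_of_nonneg_left hG' hα) (smul_le_smul_of_nonneg_left hF' hβ), ?_⟩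
  · have : (1 : H →L[ℂ] H) - (α • D + β • (1 - D)) = (1 - α) • D + (1 - β) • (1 - D) := by
      module
    rw [this]
    exact add_le_add (smul_le_smul_of_nonneg_left hG' (by linarith))
      (smul_le_smul_of_nonneg_left hF' (by linarith))
  · module

lemma finer_smul_smul {D : H →L[ℂ] H} {s t : ℝ} (ht : 0 ≤ t) (hts : t ≤ s) :
    Finer (s • D) (t • D) := by
  by_cases hs : s = 0
  · have : t = 0 := le_antisymm (hs ▸ hts) ht
    rw [hs, this]
    exact Finer.refl _
  · have hs0 : 0 < s := lt_of_le_of_ne (ht.trans hts) (Ne.symm hs)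
    have h := finer_mix (D := s • D) (α := t / s) (β := 0) (by positivity)
      ((div_le_one hs0).2 hts) le_rfl zero_le_one
    rwa [zero_smul, add_zero, smul_smul, div_mul_cancel₀ _ hs] at h

lemma exists_eigenvalue_of_forall {A : H →L[ℂ] H} (S : Submodule ℂ H)
    (h : ∀ y ∈ S, ∃ c : ℂ, A y = c • y) : ∃ c : ℂ, ∀ y ∈ S, A y = c • y := by
  by_cases hS : ∀ y ∈ S, y = 0
  · exact ⟨0, fun y hy => by simp [hS y hy]⟩
  push Not at hS
  obtain ⟨z, hz, hz0⟩ := hS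
  obtain ⟨c, hc⟩ := h z hz
  refine ⟨c, fun y hy => ?_⟩
  obtain ⟨d, hd⟩ := h y hy
  obtain ⟨b, hb⟩ := h _ (S.add_mem hy hz)
  rw [map_add, hc, hd] at hb
  have h1 : (d - b) • y = (b - c) • z := by
    rw [sub_smul, sub_smul, sub_eq_sub_iff_add_eq_add, hb, smul_add, add_comm]
  by_cases hdb : d = b
  · rw [hdb, sub_self, zero_smul] at h1
    have h2 := (smul_eq_zero.1 h1.symm).resolve_right hz0
    rw [hd, hdb, sub_eq_zero.1 h2]
  · have h2 : y = ((d - b)⁻¹ * (b - c)) • z := by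
      rw [mul_smul, ← h1, smul_smul, inv_mul_cancel₀ (sub_ne_zero.2 hdb), one_smul]
    rw [h2, map_smul, hc, smul_comm]

lemma exists_eigenvalue_of_commute_ray {A : H →L[ℂ] H} (hA : IsEff A) (S : Submodule ℂ H)
    (h : ∀ y ∈ S, ‖y‖ = 1 → Commute A (ray y)) :
    ∃ c : ℝ, 0 ≤ c ∧ c ≤ 1 ∧ ∀ y ∈ S, A y = c • y := by
  have h1 : ∀ y ∈ S, ∃ c : ℂ, A y = c • y := fun y hy => by
    by_cases hy0 : y = 0
    · exact ⟨0, by simp [hy0]⟩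
    have h2 := apply_eq_of_commute_ray hA.isSelfAdjoint (norm_smul_inv_norm (𝕜 := ℂ) hy0)
      (h _ (S.smul_mem _ hy) (norm_smul_inv_norm hy0))
    refine ⟨(qf A (((‖y‖ : ℂ)⁻¹) • y) : ℝ), ?_⟩
    have hne : (‖y‖ : ℂ) ≠ 0 := by exact_mod_cast norm_ne_zero_iff.2 hy0
    have h3 := congrArg ((‖y‖ : ℂ) • ·) h2
    simp only [map_smul] at h3
    rw [smul_comm _ (qf A _)] at h3
    simp only [RCLike.ofReal_eq_complex_ofReal] at h3
    rw [smul_smul, smul_smul, mul_inv_cancel₀ hne, one_smul, one_smul] at h3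
    rw [h3]
    exact (Complex.coe_smul _ _).symm
  obtain ⟨c, hc⟩ := exists_eigenvalue_of_forall S h1
  by_cases hS : ∀ y ∈ S, y = 0
  · exact ⟨0, le_rfl, zero_le_one, fun y hy => by simp [hS y hy]⟩
  push Not at hS
  obtain ⟨y, hy, hy0⟩ := hS
  set u : H := ((‖y‖ : ℂ)⁻¹) • y with hu
  have hu1 : ‖u‖ = 1 := norm_smul_inv_norm hy0
  have huS : u ∈ S := S.smul_mem _ hy
  have h2 := apply_eq_of_commute_ray hA.isSelfAdjoint hu1 (h u huS hu1)
  have hu0 := ne_zero_of_norm_eq_one hu1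
  have hcq : c = (qf A u : ℂ) := by
    refine smul_left_injective ℂ hu0 ?_
    change c • u = (qf A u : ℂ) • u
    rw [← hc u huS, h2]
    exact (Complex.coe_smul _ _).symm
  refine ⟨qf A u, qf_nonneg hA.1 u, ?_, fun y hy => ?_⟩
  · have := qf_mono hA.2 u
    rwa [qf_one, hu1, one_pow] at this
  · rw [hc y hy, hcq]
    exact Complex.coe_smul _ _

/-- An effect is scalar exactly when it is coexistent with everything. -/
lemma isScalarOp_iff {A : H →L[ℂ] H} (hA : IsEff A) :
    IsScalarOp A ↔ ∀ X : H →L[ℂ] H, IsEff X → Coex A X := by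
  constructor
  · rintro ⟨t, h0, h1, rfl⟩ X hX
    exact coex_scalar h0 h1 hX.1 hX.2
  · intro h
    obtain ⟨c, h0, h1, hc⟩ := exists_eigenvalue_of_commute_ray hA ⊤ fun y _ hy =>
      (commute_of_coex_projection (ray_isStarProjection hy) (h _ (isEff_ray hy)).symm).symm
    exact ⟨c, h0, h1, by ext y; simpa using hc y trivial⟩

lemma commute_of_finer_ray {x : H} (hx : ‖x‖ = 1) {C : H →L[ℂ] H} (h : Finer (ray x) C)
    {E : H →L[ℂ] H} (hE : IsStarProjection E) (hEx : Commute E (ray x)) : Commute C E :=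
  (commute_of_coex_projection hE (h E hE.isEff (coex_of_commute (isEff_ray hx).1 (isEff_ray hx).2
    hE.zero_le hE.le_one' hEx.symm)).symm).symm

/-- The effects coexistent with everything that a rank-one projection is coexistent with are those
in the plane it spans with the identity. -/
lemma finer_ray_iff {x : H} (hx : ‖x‖ = 1) {C : H →L[ℂ] H} (hC : IsEff C) :
    Finer (ray x) C ↔ ∃ l m : ℝ, 0 ≤ l ∧ l ≤ 1 ∧ 0 ≤ m ∧ m ≤ 1 ∧
      C = l • ray x + m • (1 - ray x) := by
  constructor
  · intro h
    have h1 := apply_eq_of_commute_ray hC.isSelfAdjoint hx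
      (commute_of_finer_ray hx h (ray_isStarProjection hx) (.refl _))
    obtain ⟨m, hm, hm', h2⟩ := exists_eigenvalue_of_commute_ray hC (ℂ ∙ x)ᗮ fun y hy hy1 => by
      rw [Submodule.mem_orthogonal_singleton_iff_inner_right] at hy
      refine commute_of_finer_ray hx h (ray_isStarProjection hy1) ?_
      rw [Commute, SemiconjBy, ray_mul_ray_eq_zero hy, ray_mul_ray_eq_zero]
      rw [← inner_conj_symm, hy, map_zero]
    refine ⟨qf C x, m, qf_nonneg hC.1 x, ?_, hm, hm', ?_⟩
    · have := qf_mono hC.2 x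
      rwa [qf_one, hx, one_pow] at this
    · ext z
      have hz := h2 (z - ray x z) (by
        rw [Submodule.mem_orthogonal_singleton_iff_inner_right, inner_sub_right,
          InnerProductSpace.rankOne_apply, inner_smul_right, inner_self_eq_norm_sq_to_K, hx]
        simp)
      have hr : C (ray x z) = qf C x • ray x z := by
        rw [InnerProductSpace.rankOne_apply, map_smul, h1, smul_comm]
      rw [map_sub, hr, sub_eq_iff_eq_add] at hz
      rw [hz]
      simp only [add_apply, smul_apply, sub_apply, one_apply_eq_self]
      rw [add_comm]
  · rintro ⟨l, m, hl, hl', hm, hm', rfl⟩ X hX h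
    have hc := commute_of_coex_projection (ray_isStarProjection hx) h
    refine coex_of_commute hC.1 hC.2 hX.1 hX.2 ?_
    exact (hc.smul_left l).add_left (((Commute.one_left X).sub_left hc).smul_left m)

end Effect

/-! ### The branches at a rank-one projection -/

namespace Effect

variable {H : Type*} [NormedAddCommGroup H] [InnerProductSpace ℂ H] [CompleteSpace H]

/-- `Q` is one of the two projections with range or kernel spanned by `x`. -/
def IsAxis (x : H) (Q : H →L[ℂ] H) : Prop := Q = ray x ∨ Q = 1 - ray x

lemma IsAxis.isStarProjection {x : H} {Q : H →L[ℂ] H} (hQ : IsAxis x Q) (hx : ‖x‖ = 1) :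
    IsStarProjection Q := by
  rcases hQ with rfl | rfl
  · exact ray_isStarProjection hx
  · exact (ray_isStarProjection hx).one_sub

lemma IsAxis.compl {x : H} {Q : H →L[ℂ] H} (hQ : IsAxis x Q) : IsAxis x (1 - Q) := by
  rcases hQ with rfl | rfl
  · exact .inr rfl
  · exact .inl (sub_sub_cancel _ _)

lemma IsAxis.exists_vectors {x : H} {Q : H →L[ℂ] H} (hQ : IsAxis x Q) (hx : ‖x‖ = 1)
    (hd : ∃ f : H, ‖f‖ = 1 ∧ inner ℂ x f = 0) :
    ∃ e f : H, ‖e‖ = 1 ∧ ‖f‖ = 1 ∧ inner ℂ e f = 0 ∧ Q e = e ∧ Q f = 0 := by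
  obtain ⟨f, hf, hxf⟩ := hd
  have h1 := ray_apply_self hx
  have h2 : ray x f = 0 := by rw [InnerProductSpace.rankOne_apply, hxf, zero_smul]
  rcases hQ with rfl | rfl
  · exact ⟨x, f, hx, hf, hxf, h1, h2⟩
  · refine ⟨f, x, hf, hx, by rw [← inner_conj_symm, hxf, map_zero], ?_, ?_⟩
    · rw [sub_apply, h2, one_apply_eq_self, sub_zero]
    · rw [sub_apply, h1, one_apply_eq_self, sub_self]

lemma IsAxis.finer_iff {x : H} {Q : H →L[ℂ] H} (hQ : IsAxis x Q) (hx : ‖x‖ = 1)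
    {C : H →L[ℂ] H} (hC : IsEff C) :
    Finer (ray x) C ↔ ∃ l m : ℝ, 0 ≤ l ∧ l ≤ 1 ∧ 0 ≤ m ∧ m ≤ 1 ∧ C = l • Q + m • (1 - Q) := by
  rw [finer_ray_iff hx hC]
  rcases hQ with rfl | rfl
  · rfl
  · constructor
    · rintro ⟨l, m, h1, h2, h3, h4, h⟩
      exact ⟨m, l, h3, h4, h1, h2, by rw [h, sub_sub_cancel, add_comm]⟩
    · rintro ⟨l, m, h1, h2, h3, h4, h⟩
      exact ⟨m, l, h3, h4, h1, h2, by rw [h, sub_sub_cancel, add_comm]⟩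

lemma IsAxis.eq_smul_of_finer {x : H} {Q : H →L[ℂ] H} (hQ : IsAxis x Q) (hx : ‖x‖ = 1)
    (hd : ∃ f : H, ‖f‖ = 1 ∧ inner ℂ x f = 0) {D : H →L[ℂ] H} (hD : IsEff D)
    (hK : Finer (ray x) D) {t : ℝ} (ht : 0 < t) (ht' : t ≤ 1) (h : Finer D (t • Q)) :
    ∃ s : ℝ, 0 < s ∧ s ≤ 1 ∧ (D = s • Q ∨ D = 1 - s • Q) := by
  obtain ⟨l, m, hl, hl', hm, hm', hDe⟩ := (hQ.finer_iff hx hD).1 hK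
  obtain ⟨e, f, he, hf, hef, hQe, hQf⟩ := hQ.exists_vectors hx hd
  obtain ⟨hm01, hne⟩ := eigenvalue_of_finer hD (hQ.isStarProjection hx).isEff he hf hef
    (l := l) (m := m) (by simp [hDe, hQe]) (by simp [hDe, hQf]) hQe hQf ht ht'
    fun c s hs hc => h _ hs hc
  rcases hm01 with rfl | rfl
  · exact ⟨l, lt_of_le_of_ne hl (Ne.symm hne), hl', .inl (by rw [hDe, zero_smul, add_zero])⟩
  · refine ⟨1 - l, sub_pos.2 (lt_of_le_of_ne hl' hne), by linarith, .inr ?_⟩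
    rw [hDe]
    module

lemma le_of_finer_smul {Q : H →L[ℂ] H} (hQ : IsEff Q) {e f : H} (he : ‖e‖ = 1) (hf : ‖f‖ = 1)
    (hef : inner ℂ e f = 0) (hQe : Q e = e) (hQf : Q f = 0) {s t : ℝ} (hs : 0 ≤ s) (hs' : s ≤ 1)
    (ht : 0 ≤ t) (ht' : t ≤ 1) (h : Finer (s • Q) (t • Q)) : t ≤ s := by
  have hne : (1 : ℂ) • e + (1 : ℂ) • f ≠ 0 := fun h0 => by
    have := congrArg (inner ℂ e) h0
    rw [inner_add_right, inner_smul_right, inner_smul_right, hef, inner_self_eq_norm_sq_to_K,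
      he] at this
    simp at this
  have h1 := h.str_add_le (hQ.smul hs hs') (hQ.smul ht ht') hne
  rw [str_add_str_eigen_add (hQ.smul hs hs') he hf hef (l := s) (m := 0) (by simp [hQe])
      (by simp [hQf]) one_ne_zero one_ne_zero,
    str_add_str_eigen_add (hQ.smul ht ht') he hf hef (l := t) (m := 0) (by simp [hQe])
      (by simp [hQf]) one_ne_zero one_ne_zero, norm_one, one_pow, pairStr_zero_one,
    pairStr_zero_one, div_le_div_iff₀ (by linarith) (by linarith)] at h1
  linarith

lemma IsAxis.eq_of_finer {x : H} {Q Q' : H →L[ℂ] H} (hQ : IsAxis x Q) (hQ' : IsAxis x Q')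
    (hx : ‖x‖ = 1) (hd : ∃ f : H, ‖f‖ = 1 ∧ inner ℂ x f = 0) {s t : ℝ} (hs : 0 < s) (hs' : s < 1)
    (ht : 0 < t) (ht' : t < 1) (h : Finer (s • Q) (t • Q')) : Q = Q' := by
  have hor : Q = Q' ∨ Q = 1 - Q' := by
    rcases hQ with rfl | rfl <;> rcases hQ' with rfl | rfl <;> simp
  refine hor.resolve_right fun hc => ?_
  have hQeff := (hQ.isStarProjection hx).isEff
  obtain ⟨e, f, he, hf, -, hQe, hQf⟩ := hQ'.exists_vectors hx hd
  have hK : Finer (ray x) (s • Q) := (hQ.finer_iff hx (hQeff.smul hs.le hs'.le)).2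
    ⟨s, 0, hs.le, hs'.le, le_rfl, zero_le_one, by simp⟩
  obtain ⟨r, -, -, hr⟩ := hQ'.eq_smul_of_finer hx hd (hQeff.smul hs.le hs'.le) hK ht ht'.le h
  have hf0 := ne_zero_of_norm_eq_one hf
  have h1 : (s • Q) f = s • f := by rw [hc]; simp [hQf]
  rcases hr with hr | hr
  · rw [hr] at h1
    simp only [smul_apply, hQf, smul_zero] at h1
    exact (smul_ne_zero hs.ne' hf0) h1.symm
  · rw [hr] at h1
    simp only [sub_apply, smul_apply, hQf, smul_zero, one_apply_eq_self, sub_zero] at h1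
    have : (1 - s) • f = 0 := by rw [sub_smul, one_smul, ← h1, sub_self]
    exact (smul_ne_zero (by linarith) hf0) this

/-- `C` lies above `R` in the order given by coexistence, is neither scalar nor of the form `R`, `1 - R` for a rank-one projection `R`, and the
effects between `R` and `C` form a chain. -/
def IsBranch (R C : H →L[ℂ] H) : Prop :=
  Finer R C ∧ ¬ IsScalarOp C ∧ ¬ IsRayLike C ∧ ∀ D D' : H →L[ℂ] H, IsEff D → IsEff D' →
    Finer R D → Finer R D' → Finer D C → Finer D' C → Finer D D' ∨ Finer D' D

lemma IsRayLike.isIdempotentElem {A : H →L[ℂ] H} (hA : IsRayLike A) : IsIdempotentElem A := by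
  obtain ⟨x, hx, rfl | rfl⟩ := hA
  · exact (ray_isStarProjection hx).isIdempotentElem
  · exact (ray_isStarProjection hx).one_sub.isIdempotentElem

lemma smul_mul_self_ne {Q : H →L[ℂ] H} {e : H} (he : e ≠ 0) (hQe : Q e = e) {t : ℝ} (ht : 0 < t)
    (ht' : t < 1) : ¬ IsIdempotentElem (t • Q) := fun h => by
  have h1 := DFunLike.congr_fun h.eq e
  simp only [mul_apply_eq_comp, smul_apply, hQe] at h1
  rw [ContinuousLinearMap.map_smul_of_tower, hQe, smul_smul] at h1
  have h2 := smul_left_injective ℝ he h1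
  have h3 : t * t < t := by nlinarith
  exact h3.ne h2

lemma IsAxis.isBranch_smul {x : H} {Q : H →L[ℂ] H} (hQ : IsAxis x Q) (hx : ‖x‖ = 1)
    (hd : ∃ f : H, ‖f‖ = 1 ∧ inner ℂ x f = 0) {t : ℝ} (ht : 0 < t) (ht' : t < 1) :
    IsBranch (ray x) (t • Q) := by
  obtain ⟨e, f, he, hf, -, hQe, hQf⟩ := hQ.exists_vectors hx hd
  have hQp := hQ.isStarProjection hx
  have he0 := ne_zero_of_norm_eq_one he
  have hf0 := ne_zero_of_norm_eq_one hf
  refine ⟨?_, ?_, fun h => smul_mul_self_ne he0 hQe ht ht' h.isIdempotentElem, ?_⟩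
  · exact (hQ.finer_iff hx (hQp.isEff.smul ht.le ht'.le)).2
      ⟨t, 0, ht.le, ht'.le, le_rfl, zero_le_one, by simp⟩
  · rintro ⟨c, -, -, h⟩
    have h1 := DFunLike.congr_fun h e
    have h2 := DFunLike.congr_fun h f
    simp only [smul_apply, hQe, hQf, smul_zero, one_apply_eq_self] at h1 h2
    rcases smul_eq_zero.1 h2.symm with hc | hc
    · rw [hc, zero_smul] at h1
      exact smul_ne_zero ht.ne' he0 h1
    · exact hf0 hc
  · intro D D' hD hD' hRD hRD' hDC hDC'
    obtain ⟨s, hs, hs', h⟩ := hQ.eq_smul_of_finer hx hd hD hRD ht ht'.le hDC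
    obtain ⟨s', hs0, hs1, h'⟩ := hQ.eq_smul_of_finer hx hd hD' hRD' ht ht'.le hDC'
    have hle : Finer (s • Q) (s' • Q) ∨ Finer (s' • Q) (s • Q) := by
      rcases le_total s' s with hss | hss
      · exact .inl (finer_smul_smul hs0.le hss)
      · exact .inr (finer_smul_smul hs.le hss)
    rcases h with rfl | rfl <;> rcases h' with rfl | rfl <;>
      simpa only [finer_compl_left, finer_compl_right] using hle

/-- The branches are the effects `t R` and `t (1 - R)` with `0 < t < 1` and their complements:
`l R + m (1 - R)` with `0 < l, m < 1` lies above the incomparable effects `s R` and `s' (1 - R)` for `s, s'` close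
to `1`. -/
lemma IsBranch.exists_eq {x : H} (hx : ‖x‖ = 1) (hd : ∃ f : H, ‖f‖ = 1 ∧ inner ℂ x f = 0)
    {C : H →L[ℂ] H} (hC : IsEff C) (h : IsBranch (ray x) C) :
    ∃ (t : ℝ) (Q : H →L[ℂ] H), 0 < t ∧ t < 1 ∧ IsAxis x Q ∧ (C = t • Q ∨ C = 1 - t • Q) := by
  obtain ⟨hK, hns, hnr, hchain⟩ := h
  obtain ⟨l, m, hl, hl', hm, hm', hCe⟩ := (finer_ray_iff hx hC).1 hK
  have main : ∀ (Q : H →L[ℂ] H) (l m : ℝ), IsAxis x Q → 0 ≤ l → l ≤ 1 → (m = 0 ∨ m = 1) →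
      C = l • Q + m • (1 - Q) →
      ∃ (t : ℝ) (Q : H →L[ℂ] H), 0 < t ∧ t < 1 ∧ IsAxis x Q ∧ (C = t • Q ∨ C = 1 - t • Q) := by
    intro Q l m hQ hl hl' hm hCe
    have hax : ∀ Q, IsAxis x Q → IsRayLike Q := fun Q hQ => ⟨x, hx, hQ⟩
    rcases hm with rfl | rfl
    · rw [zero_smul, add_zero] at hCe
      refine ⟨l, Q, lt_of_le_of_ne hl fun h0 => hns ?_, lt_of_le_of_ne hl' fun h1 => hnr ?_, hQ,
        .inl hCe⟩
      · exact ⟨0, le_rfl, zero_le_one, by rw [hCe, ← h0, zero_smul, zero_smul]⟩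
      · rw [hCe, h1, one_smul]
        exact hax Q hQ
    · refine ⟨1 - l, Q, sub_pos.2 (lt_of_le_of_ne hl' fun h0 => hns ?_),
        sub_lt_self _ (lt_of_le_of_ne hl fun h1 => hnr ?_), hQ, .inr (by rw [hCe]; module)⟩
      · exact ⟨1, zero_le_one, le_rfl, by rw [hCe, h0]; module⟩
      · rw [hCe, ← h1, zero_smul, zero_add, one_smul]
        exact hax _ hQ.compl
  by_cases hm01 : m = 0 ∨ m = 1
  · exact main (ray x) l m (.inl rfl) hl hl' hm01 hCe
  by_cases hl01 : l = 0 ∨ l = 1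
  · exact main (1 - ray x) m l (.inr rfl) hm hm' hl01 (by rw [hCe, sub_sub_cancel, add_comm])
  exfalso
  push Not at hm01 hl01
  have below : ∀ (Q : H →L[ℂ] H) (l m : ℝ), IsAxis x Q → 0 ≤ l → l ≤ 1 → 0 ≤ m → m ≤ 1 →
      l ≠ 0 → l ≠ 1 → C = l • Q + m • (1 - Q) → ∃ s : ℝ, 0 < s ∧ s < 1 ∧ Finer (s • Q) C := by
    intro Q l m hQ hl hl' hm hm' hl0 hl1 hCe
    have hlp : 0 < l := lt_of_le_of_ne hl (Ne.symm hl0)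
    have hlt : l < 1 := lt_of_le_of_ne hl' hl1
    set s := max l (1 - l) with hs
    have hs0 : 0 < s := lt_max_of_lt_left hlp
    have hs1 : s < 1 := max_lt hlt (by linarith)
    have h1 : l ≤ s := le_max_left _ _
    have h2 : 1 - l ≤ s := le_max_right _ _
    refine ⟨s, hs0, hs1, ?_⟩
    have := finer_mix (D := s • Q) (α := (l - m * (1 - s)) / s) (β := m)
      (div_nonneg (by nlinarith) hs0.le) ((div_le_one hs0).2 (by nlinarith)) hm hm'
    convert this using 1
    rw [hCe, smul_smul, div_mul_cancel₀ _ hs0.ne']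
    module
  obtain ⟨s, hs, hs', h1⟩ := below (ray x) l m (.inl rfl) hl hl' hm hm' hl01.1 hl01.2 hCe
  obtain ⟨s', hs0, hs1, h2⟩ := below (1 - ray x) m l (.inr rfl) hm hm' hl hl' hm01.1 hm01.2
    (by rw [hCe, sub_sub_cancel, add_comm])
  have hQ : IsAxis x (ray x) := .inl rfl
  have hQ' : IsAxis x (1 - ray x) := .inr rfl
  have hne : ray x ≠ 1 - ray x := fun h => by
    have h3 := DFunLike.congr_fun h x
    rw [sub_apply, ray_apply_self hx, one_apply_eq_self, sub_self] at h3
    exact ne_zero_of_norm_eq_one hx h3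
  rcases hchain _ _ ((isEff_ray hx).smul hs.le hs'.le) ((isEff_ray hx).compl.smul hs0.le hs1.le)
    (hQ.isBranch_smul hx hd hs hs').1 (hQ'.isBranch_smul hx hd hs0 hs1).1 h1 h2 with h | h
  · exact hne (hQ.eq_of_finer hQ' hx hd hs hs' hs0 hs1 h)
  · exact hne (hQ'.eq_of_finer hQ hx hd hs0 hs1 hs hs' h).symm

/-- Equality of coexistence relations. -/
def CoexEq (A B : H →L[ℂ] H) : Prop := Finer A B ∧ Finer B A

lemma CoexEq.refl (A : H →L[ℂ] H) : CoexEq A A := ⟨Finer.refl A, Finer.refl A⟩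

lemma CoexEq.symm {A B : H →L[ℂ] H} (h : CoexEq A B) : CoexEq B A := ⟨h.2, h.1⟩

lemma CoexEq.trans {A B C : H →L[ℂ] H} (h : CoexEq A B) (h' : CoexEq B C) : CoexEq A C :=
  ⟨h.1.trans h'.1, h'.2.trans h.2⟩

lemma coexEq_compl (A : H →L[ℂ] H) : CoexEq A (1 - A) :=
  ⟨finer_compl_right.2 (Finer.refl A), finer_compl_left.2 (Finer.refl A)⟩

lemma CoexEq.coex_iff {A A' B B' : H →L[ℂ] H} (h : CoexEq A A') (h' : CoexEq B B')
    (hA' : IsEff A') (hB : IsEff B) : Coex A B ↔ Coex A' B' := by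
  have h1 : Coex A B ↔ Coex A' B := ⟨h.1 B hB, h.2 B hB⟩
  rw [h1, coex_comm, coex_comm (B := B')]
  exact ⟨h'.1 A' hA', h'.2 A' hA'⟩

lemma CoexEq.finer_iff {A A' B B' : H →L[ℂ] H} (h : CoexEq A A') (h' : CoexEq B B') :
    Finer A B ↔ Finer A' B' :=
  ⟨fun hf => h.2.trans (hf.trans h'.1), fun hf => h.1.trans (hf.trans h'.2)⟩

lemma coexEq_of_eq_or {A B : H →L[ℂ] H} (h : A = B ∨ A = 1 - B) : CoexEq A B := by
  rcases h with rfl | rfl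
  · exact .refl _
  · exact (coexEq_compl B).symm

lemma IsBranch.congr {R R' C : H →L[ℂ] H} (h : CoexEq R R') (hC : IsBranch R C) :
    IsBranch R' C :=
  ⟨h.2.trans hC.1, hC.2.1, hC.2.2.1, fun D D' hD hD' h1 h2 =>
    hC.2.2.2 D D' hD hD' (h.1.trans h1) (h.1.trans h2)⟩

/-- Multiples of rank-one projections by factors in `(0, 1)` are determined by their coexistence
relations. -/
lemma smul_ray_eq_of_coexEq {x y : H} (hx : ‖x‖ = 1) (hy : ‖y‖ = 1)
    (hd : ∃ f : H, ‖f‖ = 1 ∧ inner ℂ x f = 0) {s t : ℝ} (hs : 0 < s) (hs' : s < 1) (ht : 0 < t)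
    (ht' : t < 1) (h : CoexEq (t • ray y) (s • ray x)) : ray y = ray x ∧ t = s := by
  have hQ : IsAxis x (ray x) := .inl rfl
  have heff : IsEff (t • ray y) := (isEff_ray hy).smul ht.le ht'.le
  have hK : Finer (ray x) (t • ray y) := by
    refine Finer.trans ?_ h.2
    have := finer_smul_smul (D := ray x) hs.le hs'.le
    rwa [one_smul] at this
  obtain ⟨r, hr, hr', hor⟩ := hQ.eq_smul_of_finer hx hd heff hK hs hs'.le h.1
  obtain ⟨e, f, he, hf, hef, hQe, hQf⟩ := hQ.exists_vectors hx hd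
  have hfirst : t • ray y = r • ray x := by
    refine hor.resolve_right fun hc => ?_
    have h1 := qf_mono (smul_le_smul_of_nonneg_left (isEff_ray hy).2 ht.le) f
    rw [hc] at h1
    simp only [qf_sub, qf_smul, qf_one, hf] at h1
    have h2 : qf (ray x) f = 0 := by simp [qf, hQf]
    rw [h2] at h1
    linarith
  have htr : t = r := by
    have h1 : ∀ {x y : H} {r t : ℝ}, ‖x‖ = 1 → ‖y‖ = 1 → 0 < r → t • ray y = r • ray x → r ≤ t := by
      intro x y r t hx hy hr h
      have h2 := qf_mono (isEff_ray hy).2 x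
      have h3 : qf (t • ray y) x = r := by
        rw [h, qf_smul, qf_ray, norm_inner_self_eq, hx]
        simp
      rw [qf_one, hx] at h2
      rw [qf_smul] at h3
      have h4 := qf_nonneg (ray_nonneg y) x
      rcases le_total 0 t with h5 | h5
      · nlinarith
      · nlinarith [mul_nonneg (neg_nonneg.2 h5) h4]
    exact le_antisymm (h1 hy hx ht hfirst.symm) (h1 hx hy hr hfirst)
  have hray : ray y = ray x := by
    rw [← htr] at hfirst
    exact smul_right_injective _ ht.ne' hfirst
  refine ⟨hray, ?_⟩
  rw [hray] at h
  exact le_antisymm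
    (le_of_finer_smul (isEff_ray hx) he hf hef hQe hQf hs.le hs'.le ht.le ht'.le h.2)
    (le_of_finer_smul (isEff_ray hx) he hf hef hQe hQf ht.le ht'.le hs.le hs'.le h.1)

end Effect

/-! ### Coexistence preservers on rank-one projections -/

namespace Effect

variable {H : Type*} [NormedAddCommGroup H] [InnerProductSpace ℂ H] [CompleteSpace H]

lemma exists_unit_orthogonal {n : ℕ} (v : Fin n → H) (h : (n : Cardinal) < Module.rank ℂ H) :
    ∃ z : H, ‖z‖ = 1 ∧ ∀ i, inner ℂ (v i) z = 0 := by
  set S := Submodule.span ℂ (Set.range v) with hS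
  have hfin : FiniteDimensional ℂ S := FiniteDimensional.span_of_finite ℂ (Set.finite_range v)
  have hne : Sᗮ ≠ ⊥ := fun hbot => by
    rw [Submodule.orthogonal_eq_bot_iff] at hbot
    have h1 : Module.rank ℂ S ≤ (n : Cardinal) := by
      refine (rank_span_le _).trans ?_
      have := Cardinal.mk_range_le_lift (f := v)
      simpa using this
    rw [hbot, rank_top] at h1
    exact absurd h (not_lt.2 h1)
  obtain ⟨z, hz, hz0⟩ := Submodule.exists_mem_ne_zero_of_ne_bot hne
  refine ⟨((‖z‖ : ℂ)⁻¹) • z, norm_smul_inv_norm hz0, fun i => ?_⟩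
  rw [inner_smul_right, (Submodule.mem_orthogonal S z).1 hz _ (Submodule.subset_span ⟨i, rfl⟩),
    mul_zero]

lemma exists_unit_orthogonal_one (hdim : 2 ≤ Module.rank ℂ H) (x : H) :
    ∃ f : H, ‖f‖ = 1 ∧ inner ℂ x f = 0 := by
  obtain ⟨z, hz, h⟩ := exists_unit_orthogonal ![x]
    (lt_of_lt_of_le (by exact_mod_cast one_lt_two) hdim)
  exact ⟨z, hz, h 0⟩

lemma exists_unit_orthogonal_two (hdim : 3 ≤ Module.rank ℂ H) (x y : H) :
    ∃ f : H, ‖f‖ = 1 ∧ inner ℂ x f = 0 ∧ inner ℂ y f = 0 := by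
  obtain ⟨z, hz, h⟩ := exists_unit_orthogonal ![x, y]
    (lt_of_lt_of_le (by exact_mod_cast Nat.lt_succ_self 2) hdim)
  exact ⟨z, hz, h 0, h 1⟩

lemma inner_eq_zero_symm' {x y : H} (h : inner ℂ x y = 0) : inner ℂ y x = 0 := by
  rw [← inner_conj_symm, h, map_zero]

/-- In dimension two the complement of a rank-one projection is a rank-one projection. -/
lemma ray_add_ray_eq_one (hdim : ¬ 3 ≤ Module.rank ℂ H) {x y : H} (hx : ‖x‖ = 1) (hy : ‖y‖ = 1)
    (hxy : inner ℂ x y = 0) : 1 - ray x = ray y := by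
  have key : ∀ z : H, inner ℂ x z = 0 → inner ℂ y z = 0 → z = 0 := by
    intro z hxz hyz
    by_contra hz
    set u : H := ((‖z‖ : ℂ)⁻¹) • z with hu
    have hu1 : ‖u‖ = 1 := norm_smul_inv_norm hz
    have hxu : inner ℂ x u = 0 := by rw [hu, inner_smul_right, hxz, mul_zero]
    have hyu : inner ℂ y u = 0 := by rw [hu, inner_smul_right, hyz, mul_zero]
    clear_value u
    have hon : Orthonormal ℂ ![x, y, u] := by
      refine ⟨fun i => ?_, fun i j hij => ?_⟩
      · fin_cases i <;> simp [hx, hy, hu1]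
      · fin_cases i <;> fin_cases j <;>
          simp [hxy, hxu, hyu, inner_eq_zero_symm' hxy, inner_eq_zero_symm' hxu,
            inner_eq_zero_symm' hyu] at hij ⊢
    have := hon.linearIndependent.cardinal_lift_le_rank
    exact hdim (by simpa using this)
  have e1 : inner ℂ x x = (1 : ℂ) := by rw [inner_self_eq_norm_sq_to_K, hx]; simp
  have e2 : inner ℂ y y = (1 : ℂ) := by rw [inner_self_eq_norm_sq_to_K, hy]; simp
  ext z
  have h := key (z - ray x z - ray y z)
    (by simp only [inner_sub_right, InnerProductSpace.rankOne_apply, inner_smul_right, e1, hxy]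
        ring)
    (by simp only [inner_sub_right, InnerProductSpace.rankOne_apply, inner_smul_right, e2,
          inner_eq_zero_symm' hxy]
        ring)
  rw [sub_eq_zero] at h
  simpa using h

/-- Bijections of the set of effects that preserve coexistence in both directions, as maps on
operators; the values outside the set of effects are irrelevant. -/
structure CoexAut (Φ : (H →L[ℂ] H) → (H →L[ℂ] H)) : Prop where
  bij : Set.BijOn Φ {A | IsEff A} {A | IsEff A}
  coex : ∀ A B, IsEff A → IsEff B → (Coex A B ↔ Coex (Φ A) (Φ B))

namespace CoexAut

variable {Φ : (H →L[ℂ] H) → (H →L[ℂ] H)}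

lemma isEff (hΦ : CoexAut Φ) {A : H →L[ℂ] H} (hA : IsEff A) : IsEff (Φ A) := hΦ.bij.mapsTo hA

lemma exists_eq (hΦ : CoexAut Φ) {A : H →L[ℂ] H} (hA : IsEff A) : ∃ B, IsEff B ∧ Φ B = A :=
  hΦ.bij.surjOn hA

lemma exists_inv (hΦ : CoexAut Φ) : ∃ Ψ : (H →L[ℂ] H) → (H →L[ℂ] H), CoexAut Ψ ∧
    (∀ A, IsEff A → Ψ (Φ A) = A) ∧ ∀ A, IsEff A → Φ (Ψ A) = A := by
  have hinv := hΦ.bij.invOn_invFunOn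
  have hbij : Set.BijOn (Function.invFunOn Φ {A | IsEff A}) {A | IsEff A} {A | IsEff A} :=
    (Set.bijOn_comm hinv).2 hΦ.bij
  refine ⟨_, ⟨hbij, fun A B hA hB => ?_⟩, fun A hA => hinv.1 hA, fun A hA => hinv.2 hA⟩
  rw [hΦ.coex _ _ (hbij.mapsTo hA) (hbij.mapsTo hB), hinv.2 hA, hinv.2 hB]

lemma finer_iff (hΦ : CoexAut Φ) {A B : H →L[ℂ] H} (hA : IsEff A) (hB : IsEff B) :
    Finer A B ↔ Finer (Φ A) (Φ B) := by
  constructor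
  · intro h X hX hAX
    obtain ⟨Y, hY, rfl⟩ := hΦ.exists_eq hX
    rw [← hΦ.coex _ _ hA hY] at hAX
    rw [← hΦ.coex _ _ hB hY]
    exact h Y hY hAX
  · intro h X hX hAX
    rw [hΦ.coex _ _ hA hX] at hAX
    rw [hΦ.coex _ _ hB hX]
    exact h _ (hΦ.isEff hX) hAX

lemma coexEq_iff (hΦ : CoexAut Φ) {A B : H →L[ℂ] H} (hA : IsEff A) (hB : IsEff B) :
    CoexEq A B ↔ CoexEq (Φ A) (Φ B) := by
  rw [CoexEq, CoexEq, hΦ.finer_iff hA hB, hΦ.finer_iff hB hA]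

lemma isScalarOp_iff (hΦ : CoexAut Φ) {A : H →L[ℂ] H} (hA : IsEff A) :
    IsScalarOp A ↔ IsScalarOp (Φ A) := by
  rw [Effect.isScalarOp_iff hA, Effect.isScalarOp_iff (hΦ.isEff hA)]
  constructor
  · intro h X hX
    obtain ⟨Y, hY, rfl⟩ := hΦ.exists_eq hX
    exact (hΦ.coex _ _ hA hY).1 (h Y hY)
  · intro h X hX
    exact (hΦ.coex _ _ hA hX).2 (h _ (hΦ.isEff hX))

lemma isRayLike (hΦ : CoexAut Φ) {A : H →L[ℂ] H} (hA : IsEff A) (hns : ¬ IsScalarOp A)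
    (h : IsRayLike A) : IsRayLike (Φ A) := by
  have hns' : ¬ IsScalarOp (Φ A) := fun h => hns ((hΦ.isScalarOp_iff hA).2 h)
  rw [isRayLike_iff (hΦ.isEff hA) hns']
  intro B₀ hB₀ hAB
  obtain ⟨B, hB, rfl⟩ := hΦ.exists_eq hB₀
  have hinf := (isRayLike_iff hA hns).1 h B hB ((hΦ.coex _ _ hA hB).2 hAB)
  have hsub : {C : H →L[ℂ] H | 0 ≤ C ∧ C ≤ 1 ∧ SameCoexOn A B C} ⊆ {C | IsEff C} :=
    fun C hC => ⟨hC.1, hC.2.1⟩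
  refine (hinf.image (hΦ.bij.injOn.mono hsub)).mono ?_
  rintro _ ⟨C, ⟨hC0, hC1, hC⟩, rfl⟩
  have hCe : IsEff C := ⟨hC0, hC1⟩
  refine ⟨(hΦ.isEff hCe).1, (hΦ.isEff hCe).2, fun X hX hX' hAX => ?_⟩
  obtain ⟨X, hXe, rfl⟩ := hΦ.exists_eq (A := X) ⟨hX, hX'⟩
  rw [← hΦ.coex _ _ hB hXe, ← hΦ.coex _ _ hCe hXe]
  exact hC X hXe.1 hXe.2 ((hΦ.coex _ _ hA hXe).2 hAX)

lemma isRayLike_of (hΦ : CoexAut Φ) {A : H →L[ℂ] H} (hA : IsEff A) (hns : ¬ IsScalarOp A)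
    (h : IsRayLike (Φ A)) : IsRayLike A := by
  obtain ⟨Ψ, hΨ, h1, -⟩ := hΦ.exists_inv
  have := hΨ.isRayLike (hΦ.isEff hA) (fun h => hns ((hΦ.isScalarOp_iff hA).2 h)) h
  rwa [h1 A hA] at this

lemma isBranch (hΦ : CoexAut Φ) {R C : H →L[ℂ] H} (hR : IsEff R) (hC : IsEff C)
    (h : IsBranch R C) : IsBranch (Φ R) (Φ C) := by
  obtain ⟨h1, h2, h3, h4⟩ := h
  refine ⟨(hΦ.finer_iff hR hC).1 h1, fun h => h2 ((hΦ.isScalarOp_iff hC).2 h),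
    fun h => h3 (hΦ.isRayLike_of hC h2 h), fun D₀ D₁ hD₀ hD₁ => ?_⟩
  obtain ⟨D, hD, rfl⟩ := hΦ.exists_eq hD₀
  obtain ⟨D', hD', rfl⟩ := hΦ.exists_eq hD₁
  rw [← hΦ.finer_iff hR hD, ← hΦ.finer_iff hR hD', ← hΦ.finer_iff hD hC, ← hΦ.finer_iff hD' hC,
    ← hΦ.finer_iff hD hD', ← hΦ.finer_iff hD' hD]
  exact h4 D D' hD hD'

lemma not_isScalarOp_ray (hdim : 2 ≤ Module.rank ℂ H) {x : H} (hx : ‖x‖ = 1) :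
    ¬ IsScalarOp (ray x) := by
  rintro ⟨c, -, -, h⟩
  obtain ⟨f, hf, hxf⟩ := exists_unit_orthogonal_one hdim x
  have h1 := DFunLike.congr_fun h x
  have h2 := DFunLike.congr_fun h f
  rw [ray_apply_self hx] at h1
  rw [InnerProductSpace.rankOne_apply, hxf, zero_smul] at h2
  simp only [smul_apply, one_apply_eq_self] at h1 h2
  rcases smul_eq_zero.1 h2.symm with hc | hc
  · rw [hc, zero_smul] at h1
    exact ne_zero_of_norm_eq_one hx h1
  · exact ne_zero_of_norm_eq_one hf hc

lemma exists_ray (hΦ : CoexAut Φ) (hdim : 2 ≤ Module.rank ℂ H) {x : H} (hx : ‖x‖ = 1) :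
    ∃ x' : H, ‖x'‖ = 1 ∧ CoexEq (Φ (ray x)) (ray x') := by
  obtain ⟨x', hx', h⟩ := hΦ.isRayLike (isEff_ray hx) (not_isScalarOp_ray hdim hx) ⟨x, hx, .inl rfl⟩
  exact ⟨x', hx', coexEq_of_eq_or h⟩

/-- Multiples of a rank-one projection go to multiples of a rank-one projection or of the
complement of one, up to complement. -/
lemma exists_branch (hΦ : CoexAut Φ) (hdim : 2 ≤ Module.rank ℂ H) {x : H} (hx : ‖x‖ = 1) :
    ∃ (x' : H) (Q : H →L[ℂ] H), ‖x'‖ = 1 ∧ IsAxis x' Q ∧ CoexEq (Φ (ray x)) (ray x') ∧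
      (∀ t : ℝ, 0 < t → t < 1 → ∃ τ : ℝ, 0 < τ ∧ τ < 1 ∧ CoexEq (Φ (t • ray x)) (τ • Q)) ∧
      ∀ τ : ℝ, 0 < τ → τ < 1 → ∃ t : ℝ, 0 < t ∧ t < 1 ∧ CoexEq (Φ (t • ray x)) (τ • Q) := by
  obtain ⟨x', hx', hxx'⟩ := hΦ.exists_ray hdim hx
  have hd := exists_unit_orthogonal_one hdim x
  have hd' := exists_unit_orthogonal_one hdim x'
  have hR := isEff_ray hx
  have hQ₀ : IsAxis x (ray x) := .inl rfl
  have heff : ∀ t : ℝ, 0 < t → t < 1 → IsEff (t • ray x) := fun t h h' => hR.smul h.le h'.le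
  have himg : ∀ t : ℝ, 0 < t → t < 1 → ∃ (τ : ℝ) (Q : H →L[ℂ] H), 0 < τ ∧ τ < 1 ∧ IsAxis x' Q ∧
      CoexEq (Φ (t • ray x)) (τ • Q) := fun t h h' => by
    have hb := (hΦ.isBranch hR (heff t h h') (hQ₀.isBranch_smul hx hd h h')).congr hxx'
    obtain ⟨τ, Q, h1, h2, h3, h4⟩ := hb.exists_eq hx' hd' (hΦ.isEff (heff t h h'))
    exact ⟨τ, Q, h1, h2, h3, coexEq_of_eq_or h4⟩
  obtain ⟨τ₀, Q, h1, h2, hQ, h3⟩ := himg (1 / 2) (by norm_num) (by norm_num)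
  have hhalf := heff (1 / 2) (by norm_num) (by norm_num)
  refine ⟨x', Q, hx', hQ, hxx', fun t h h' => ?_, fun τ h h' => ?_⟩
  · obtain ⟨τ, Q', k1, k2, hQ', k3⟩ := himg t h h'
    have hcomp : Finer (τ • Q') (τ₀ • Q) ∨ Finer (τ₀ • Q) (τ • Q') := by
      rw [← k3.finer_iff h3, ← h3.finer_iff k3, ← hΦ.finer_iff (heff t h h') hhalf,
        ← hΦ.finer_iff hhalf (heff t h h')]
      rcases le_total t (1 / 2) with hle | hle
      · exact .inr (finer_smul_smul h.le hle)
      · exact .inl (finer_smul_smul (by norm_num) hle)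
    have hQQ' : Q' = Q := by
      rcases hcomp with hc | hc
      · exact hQ'.eq_of_finer hQ hx' hd' k1 k2 h1 h2 hc
      · exact (hQ.eq_of_finer hQ' hx' hd' h1 h2 k1 k2 hc).symm
    exact ⟨τ, k1, k2, hQQ' ▸ k3⟩
  · have hQp := hQ.isStarProjection hx'
    obtain ⟨C, hC, hCτ⟩ := hΦ.exists_eq (hQp.isEff.smul h.le h'.le)
    have hb : IsBranch (ray x) C := by
      obtain ⟨Ψ, hΨ, k1, k2⟩ := hΦ.exists_inv
      have hb := (hQ.isBranch_smul hx' hd' h h').congr hxx'.symm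
      have := hΨ.isBranch (hΦ.isEff hR) (hQp.isEff.smul h.le h'.le) hb
      rwa [k1 _ hR, ← hCτ, k1 _ hC] at this
    obtain ⟨t, Q', k1, k2, hQ', k3⟩ := hb.exists_eq hx hd hC
    have k4 := coexEq_of_eq_or k3
    have hcomp : Finer (t • Q') ((1 / 2 : ℝ) • ray x) ∨ Finer ((1 / 2 : ℝ) • ray x) (t • Q') := by
      rw [← k4.finer_iff (.refl _), ← (CoexEq.refl _).finer_iff k4, hΦ.finer_iff hC hhalf,
        hΦ.finer_iff hhalf hC, hCτ, (CoexEq.refl _).finer_iff h3, h3.finer_iff (.refl _)]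
      rcases le_total τ τ₀ with hle | hle
      · exact .inr (finer_smul_smul h.le hle)
      · exact .inl (finer_smul_smul h1.le hle)
    have hQQ' : Q' = ray x := by
      rcases hcomp with hc | hc
      · exact hQ'.eq_of_finer hQ₀ hx hd k1 k2 (by norm_num) (by norm_num) hc
      · exact (hQ₀.eq_of_finer hQ' hx hd (by norm_num) (by norm_num) k1 k2 hc).symm
    rw [hQQ'] at k4
    refine ⟨t, k1, k2, ?_⟩
    rw [← hCτ]
    exact ((hΦ.coexEq_iff hC (heff t k1 k2)).1 k4).symm

end CoexAut

/-! ### Rank-one projections are not exchanged with their complements -/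

lemma inner_eq_zero_or_of_commute_ray {x y : H} (hx : ‖x‖ = 1) (hy : ‖y‖ = 1)
    (h : Commute (ray x) (ray y)) : inner ℂ x y = 0 ∨ ray x = ray y := by
  refine or_iff_not_imp_left.2 fun hne => ?_
  have h1 := apply_eq_of_commute_ray (ray_isSelfAdjoint x) hy h
  rw [InnerProductSpace.rankOne_apply, qf_ray, ← Complex.coe_smul] at h1
  have h2 : x = ((inner ℂ x y)⁻¹ * (‖inner ℂ x y‖ ^ 2 : ℝ)) • y := by
    rw [mul_smul, ← h1, smul_smul, inv_mul_cancel₀ hne, one_smul]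
  have h3 := congrArg norm h2
  rw [norm_smul, hx, hy, mul_one] at h3
  conv_lhs => rw [h2]
  rw [ray_smul, ← h3, one_pow, one_smul]

lemma commute_ray_of_inner_eq_zero {x y : H} (h : inner ℂ x y = 0) :
    Commute (ray x) (ray y) := by
  rw [Commute, SemiconjBy, ray_mul_ray_eq_zero h, ray_mul_ray_eq_zero (inner_eq_zero_symm' h)]

lemma coex_ray_of_apply {A : H →L[ℂ] H} (hA : IsEff A) {e : H} (he : ‖e‖ = 1) {c : ℝ}
    (h : A e = c • e) : Coex A (ray e) :=
  coex_of_commute hA.1 hA.2 (isEff_ray he).1 (isEff_ray he).2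
    (commute_ray_of_apply hA.isSelfAdjoint h)

lemma apply_eq_of_coex_ray {A : H →L[ℂ] H} (hA : IsEff A) {e : H} (he : ‖e‖ = 1)
    (h : Coex A (ray e)) : A e = qf A e • e :=
  apply_eq_of_commute_ray hA.isSelfAdjoint he
    (commute_of_coex_projection (ray_isStarProjection he) h.symm).symm

/-- Pairs of rank-one projections, with a third one orthogonal to both, stay orthogonal. -/
lemma CoexAut.inner_eq_zero {Φ : (H →L[ℂ] H) → (H →L[ℂ] H)} (hΦ : CoexAut Φ) {x y x' y' z : H}
    (hx : ‖x‖ = 1) (hy : ‖y‖ = 1) (hz : ‖z‖ = 1) (hx' : ‖x'‖ = 1) (hy' : ‖y'‖ = 1)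
    (hxy : inner ℂ x y = 0) (hxz : inner ℂ x z = 0) (hyz : inner ℂ y z = 0)
    (hxx' : CoexEq (Φ (ray x)) (ray x')) (hyy' : CoexEq (Φ (ray y)) (ray y')) :
    inner ℂ x' y' = 0 := by
  have hX := isEff_ray hx
  have hY := isEff_ray hy
  have h1 : Coex (ray x) (ray y) :=
    coex_of_commute hX.1 hX.2 hY.1 hY.2 (commute_ray_of_inner_eq_zero hxy)
  rw [hΦ.coex _ _ hX hY, hxx'.coex_iff hyy' (isEff_ray hx') (hΦ.isEff hY)] at h1
  have h2 := commute_of_coex_projection (ray_isStarProjection hx') h1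
  refine (inner_eq_zero_or_of_commute_ray hx' hy' h2).resolve_right fun h3 => ?_
  rw [h3] at hxx'
  have h4 := (hxx'.trans hyy'.symm).1
  rw [← hΦ.finer_iff hX hY, finer_ray_iff hx hY] at h4
  obtain ⟨l, m, -, -, -, -, h5⟩ := h4
  have h6 := DFunLike.congr_fun h5 z
  have h7 := DFunLike.congr_fun h5 y
  rw [ray_apply_self hy] at h7
  simp only [InnerProductSpace.rankOne_apply, add_apply, smul_apply, sub_apply,
    one_apply_eq_self, hxz, hyz, hxy, zero_smul, smul_zero, zero_add, sub_zero] at h6 h7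
  rcases smul_eq_zero.1 h6.symm with h8 | h8
  · rw [h8, zero_smul] at h7
    exact ne_zero_of_norm_eq_one hy h7
  · exact ne_zero_of_norm_eq_one hz h8

section TripleBlocks

variable {e₁ e₂ : H}

lemma isEff_ray_add_half (h₁ : ‖e₁‖ = 1) (h₂ : ‖e₂‖ = 1) (h₁₂ : inner ℂ e₁ e₂ = 0) :
    IsEff (ray e₁ + (1 / 2 : ℝ) • ray e₂) := by
  have h := ((ray_isStarProjection h₁).add (ray_isStarProjection h₂)
    (ray_mul_ray_eq_zero h₁₂)).le_one'
  refine ⟨add_nonneg (ray_nonneg _) (smul_nonneg (by norm_num) (ray_nonneg _)), ?_⟩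
  exact (add_le_add_right (smul_le_of_le_one_left (ray_nonneg e₂) (by norm_num)) (ray e₁)).trans h

/-- The three ways of splitting off a coordinate block on which `|e₁⟩⟨e₁| + ½ |e₂⟩⟨e₂|` is scalar:
off the block, coexistence reduces to a simpler relation. -/
lemma coex_ray_of_block (h₁ : ‖e₁‖ = 1) (h₂ : ‖e₂‖ = 1) (h₁₂ : inner ℂ e₁ e₂ = 0)
    {X : H →L[ℂ] H} (hX : IsEff X) (h : Coex (ray e₁ + (1 / 2 : ℝ) • ray e₂) X) :
    (Coex (ray e₂) X → Coex (ray e₁) X) ∧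
    (Coex (ray e₁) X → Coex ((1 / 2 : ℝ) • ray e₂) X) ∧
    ((∀ w : H, ‖w‖ = 1 → inner ℂ e₁ w = 0 → inner ℂ e₂ w = 0 → Coex (ray w) X) →
      Coex ((1 / 2 : ℝ) • ray e₂) X) := by
  have p₁ := ray_isStarProjection h₁
  have p₂ := ray_isStarProjection h₂
  have m₁ : ray e₁ * ray e₁ = ray e₁ := p₁.isIdempotentElem.eq
  have m₂ : ray e₂ * ray e₂ = ray e₂ := p₂.isIdempotentElem.eq
  have m₁₂ := ray_mul_ray_eq_zero h₁₂
  have m₂₁ := ray_mul_ray_eq_zero (inner_eq_zero_symm' h₁₂)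
  have c₁₂ := commute_ray_of_inner_eq_zero h₁₂
  refine ⟨fun h' => ?_, fun h' => ?_, fun h' => ?_⟩
  · have hc := commute_of_coex_projection p₂ h'
    refine Coex.change_block (a := 0) p₂ ?_ ?_ le_rfl zero_le_one
      (c₁₂.symm.add_right ((Commute.refl _).smul_right _)) hc rfl hc hX.1 hX.2 h
    · simp only [mul_sub, add_mul, mul_one, smul_mul_assoc, m₁₂, m₂]
      abel
    · rw [m₁₂, zero_smul]
  · have hc := commute_of_coex_projection p₁ h'
    refine Coex.change_block (a := 0) p₁ ?_ ?_ le_rfl zero_le_one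
      ((Commute.refl _).add_right (c₁₂.smul_right _)) hc rfl hc hX.1 hX.2 h
    · simp only [mul_sub, add_mul, mul_one, smul_mul_assoc, m₁, m₂₁]
      abel
    · rw [smul_mul_assoc, m₂₁, smul_zero, zero_smul]
  · set W := 1 - (ray e₁ + ray e₂) with hW
    have pV : IsStarProjection (ray e₁ + ray e₂) := p₁.add p₂ m₁₂
    have pW : IsStarProjection W := pV.one_sub
    obtain ⟨c, -, -, hcW⟩ := exists_eigenvalue_of_commute_ray hX
      ((ℂ ∙ e₁)ᗮ ⊓ (ℂ ∙ e₂)ᗮ) fun w hw hw1 => by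
        rw [Submodule.mem_inf, Submodule.mem_orthogonal_singleton_iff_inner_right,
          Submodule.mem_orthogonal_singleton_iff_inner_right] at hw
        exact (commute_of_coex_projection (ray_isStarProjection hw1)
          (h' w hw1 hw.1 hw.2)).symm
    have hmem : ∀ z, W z ∈ (ℂ ∙ e₁)ᗮ ⊓ (ℂ ∙ e₂)ᗮ := fun z => by
      have i₁ : inner ℂ e₁ e₁ = (1 : ℂ) := by rw [inner_self_eq_norm_sq_to_K, h₁]; simp
      have i₂ : inner ℂ e₂ e₂ = (1 : ℂ) := by rw [inner_self_eq_norm_sq_to_K, h₂]; simp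
      rw [Submodule.mem_inf, Submodule.mem_orthogonal_singleton_iff_inner_right,
        Submodule.mem_orthogonal_singleton_iff_inner_right, hW]
      simp only [sub_apply, add_apply, one_apply_eq_self, InnerProductSpace.rankOne_apply,
        inner_sub_right, inner_add_right, inner_smul_right, i₁, i₂, h₁₂,
        inner_eq_zero_symm' h₁₂]
      constructor <;> ring
    have hXW : X * W = c • W := by
      ext z
      simpa using hcW _ (hmem z)
    have hWX : W * X = c • W := by
      have := congrArg star hXW
      rwa [star_mul, pW.isSelfAdjoint.star_eq, hX.isSelfAdjoint.star_eq, star_smul,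
        pW.isSelfAdjoint.star_eq, star_trivial] at this
    have hc : Commute W X := hWX.trans hXW.symm
    rw [← coex_compl_left]
    have hWA : Commute W (ray e₁ + (1 / 2 : ℝ) • ray e₂) := by
      refine (Commute.one_left _).sub_left ?_
      have k₁ : Commute (ray e₁ + ray e₂) (ray e₁) := (Commute.refl _).add_left c₁₂.symm
      have k₂ : Commute (ray e₁ + ray e₂) (ray e₂) := c₁₂.add_left (Commute.refl _)
      exact k₁.add_right (k₂.smul_right _)
    refine Coex.change_block (a := 1) pW ?_ ?_ zero_le_one le_rfl hWA hc rfl hc hX.1 hX.2 h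
    · rw [hW, sub_sub_cancel]
      simp only [sub_mul, mul_add, add_mul, one_mul, smul_mul_assoc, m₁, m₂, m₁₂, m₂₁]
      module
    · rw [hW]
      simp only [sub_mul, mul_sub, mul_add, one_mul, mul_one, smul_mul_assoc, m₂, m₂₁]
      module

end TripleBlocks

lemma pairStr_pos {l m : ℝ} (hl : 0 ≤ l) (hl' : l ≤ 1) (hm : 0 ≤ m) (hm' : m ≤ 1)
    (h : (0 < l ∧ 0 < m) ∨ (l < 1 ∧ m < 1)) : 0 < pairStr l m 1 1 := by
  have h1 : 0 ≤ l * m / (1 * m + 1 * l) := by positivity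
  have k1 : 0 ≤ 1 - l := by linarith
  have k2 : 0 ≤ 1 - m := by linarith
  have h2 : 0 ≤ (1 - l) * (1 - m) / (1 * (1 - m) + 1 * (1 - l)) := by positivity
  rw [pairStr]
  rcases h with ⟨h3, h4⟩ | ⟨h3, h4⟩
  · have : 0 < l * m / (1 * m + 1 * l) := by positivity
    linarith
  · have k3 : 0 < 1 - l := by linarith
    have k4 : 0 < 1 - m := by linarith
    have : 0 < (1 - l) * (1 - m) / (1 * (1 - m) + 1 * (1 - l)) := by positivity
    linarith

/-- In dimension at least three, multiples of a rank-one projection cannot go to multiples of the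
complement of one. Otherwise consider the image of `|e₁⟩⟨e₁| + ½ |e₂⟩⟨e₂|`: the blocks spanned by
two of the three coordinates force its eigenvalue at `e₂'` to be `0` or `1` and different from the
eigenvalues at `e₁'` and `e₃'`, while the latter two cannot be nonzero simultaneously nor different
from `1` simultaneously. -/
lemma CoexAut.not_flip {Φ : (H →L[ℂ] H) → (H →L[ℂ] H)} (hΦ : CoexAut Φ)
    (hdim : 3 ≤ Module.rank ℂ H) {x x' : H} (hx : ‖x‖ = 1) (hx' : ‖x'‖ = 1)
    (hxx' : CoexEq (Φ (ray x)) (ray x')) {τ : ℝ} (hτ : 0 < τ) (hτ' : τ < 1)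
    (hflip : CoexEq (Φ ((1 / 2 : ℝ) • ray x)) (τ • (1 - ray x'))) : False := by
  have hdim2 : 2 ≤ Module.rank ℂ H := le_trans (by exact_mod_cast Nat.le_succ 2) hdim
  obtain ⟨e₁, h₁, hx₁⟩ := exists_unit_orthogonal_one hdim2 x
  obtain ⟨e₃, h₃, hx₃, h₁₃⟩ := exists_unit_orthogonal_two hdim x e₁
  have h₁x := inner_eq_zero_symm' hx₁
  have h₃x := inner_eq_zero_symm' hx₃
  have h₃₁ := inner_eq_zero_symm' h₁₃
  obtain ⟨e₁', h₁', hc₁⟩ := hΦ.exists_ray hdim2 h₁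
  obtain ⟨e₃', h₃', hc₃⟩ := hΦ.exists_ray hdim2 h₃
  have o₁₂ := hΦ.inner_eq_zero h₁ hx h₃ h₁' hx' h₁x h₁₃ hx₃ hc₁ hxx'
  have o₁₃ := hΦ.inner_eq_zero h₁ h₃ hx h₁' h₃' h₁₃ h₁x h₃x hc₁ hc₃
  have o₃₂ := hΦ.inner_eq_zero h₃ hx h₁ h₃' hx' h₃x h₃₁ hx₁ hc₃ hxx'
  set A := ray e₁ + (1 / 2 : ℝ) • ray x with hA
  have hAe : IsEff A := isEff_ray_add_half h₁ hx h₁x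
  have hA' := hΦ.isEff hAe
  have hhalf : IsEff ((1 / 2 : ℝ) • ray x) := (isEff_ray hx).smul (by norm_num) (by norm_num)
  have hblock := fun {X : H →L[ℂ] H} (hX : IsEff X) => coex_ray_of_block h₁ hx h₁x hX
  have eig : ∀ e e' : H, ‖e‖ = 1 → ‖e'‖ = 1 → CoexEq (Φ (ray e)) (ray e') →
      (∃ c : ℝ, A e = c • e) → Φ A e' = qf (Φ A) e' • e' := by
    rintro e e' he he' hee' ⟨c, hc⟩
    have h := coex_ray_of_apply hAe he hc
    rw [hΦ.coex _ _ hAe (isEff_ray he),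
      (CoexEq.refl _).coex_iff hee' hA' (hΦ.isEff (isEff_ray he))] at h
    exact apply_eq_of_coex_ray hA' he' h
  have d₁ := eig e₁ e₁' h₁ h₁' hc₁ ⟨1, by
    rw [hA, add_apply, ray_apply_self h₁, smul_apply, InnerProductSpace.rankOne_apply, hx₁]
    simp⟩
  have d₂ := eig x x' hx hx' hxx' ⟨1 / 2, by
    rw [hA, add_apply, smul_apply, ray_apply_self hx, InnerProductSpace.rankOne_apply, h₁x]
    simp⟩
  have d₃ := eig e₃ e₃' h₃ h₃' hc₃ ⟨0, by
    rw [hA, add_apply, smul_apply, InnerProductSpace.rankOne_apply,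
      InnerProductSpace.rankOne_apply, h₁₃, hx₃]
    simp⟩
  -- Passing between a test effect and its preimage.
  have back : ∀ {B B' X : H →L[ℂ] H}, IsEff B → IsEff B' → IsEff X → CoexEq (Φ B) B' →
      (Coex B X ↔ Coex B' (Φ X)) := fun {B B' X} hB hB' hX h => by
    rw [hΦ.coex _ _ hB hX, h.coex_iff (.refl _) hB' (hΦ.isEff hX)]
  have hτe : IsEff (τ • (1 - ray x')) := (isEff_ray hx').compl.smul hτ.le hτ'.le
  have orth : ∀ {u v : H} {s : ℝ}, ‖u‖ = 1 → IsEff (s • ray v) → inner ℂ u v = 0 →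
      Coex (ray u) (s • ray v) := fun {u v s} hu hs huv =>
    coex_of_commute (isEff_ray hu).1 (isEff_ray hu).2 hs.1 hs.2
      ((commute_ray_of_inner_eq_zero huv).smul_right s)
  have q₁ := eigenvalue_of_finer hA' (isEff_ray hx').compl h₁' hx' o₁₂ d₁ d₂
    (by simp [InnerProductSpace.rankOne_apply, inner_eq_zero_symm' o₁₂])
    (by rw [sub_apply, ray_apply_self hx', one_apply_eq_self, sub_self]) hτ hτ'.le
    fun c s hs hcoex => by
      obtain ⟨X, hX, hXe⟩ := hΦ.exists_eq hs
      rw [← hXe] at hcoex ⊢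
      rw [← back hhalf hτe hX hflip]
      refine (hblock hX ((hΦ.coex _ _ hAe hX).2 hcoex)).2.2 fun w hw hw₁ hw₂ => ?_
      obtain ⟨w', hw', hcw⟩ := hΦ.exists_ray hdim2 hw
      have k₁ := hΦ.inner_eq_zero hw h₁ hx hw' h₁' (inner_eq_zero_symm' hw₁)
        (inner_eq_zero_symm' hw₂) h₁x hcw hc₁
      have k₂ := hΦ.inner_eq_zero hw hx h₁ hw' hx' (inner_eq_zero_symm' hw₂)
        (inner_eq_zero_symm' hw₁) hx₁ hcw hxx'
      rw [back (isEff_ray hw) (isEff_ray hw') hX hcw, hXe]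
      exact orth hw' hs (by rw [inner_add_right, inner_smul_right, k₁, k₂, mul_zero, add_zero])
  have q₃ := eigenvalue_of_finer hA' (isEff_ray hx').compl h₃' hx' o₃₂ d₃ d₂
    (by simp [InnerProductSpace.rankOne_apply, inner_eq_zero_symm' o₃₂])
    (by rw [sub_apply, ray_apply_self hx', one_apply_eq_self, sub_self]) hτ hτ'.le
    fun c s hs hcoex => by
      obtain ⟨X, hX, hXe⟩ := hΦ.exists_eq hs
      rw [← hXe] at hcoex ⊢
      rw [← back hhalf hτe hX hflip]
      refine (hblock hX ((hΦ.coex _ _ hAe hX).2 hcoex)).2.1 ?_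
      rw [back (isEff_ray h₁) (isEff_ray h₁') hX hc₁, hXe]
      exact orth h₁' hs (by rw [inner_add_right, inner_smul_right, o₁₃, o₁₂, mul_zero, add_zero])
  have bound : ∀ e : H, ‖e‖ = 1 → 0 ≤ qf (Φ A) e ∧ qf (Φ A) e ≤ 1 := fun e he =>
    ⟨qf_nonneg hA'.1 e, by
      have := qf_mono hA'.2 e
      rwa [qf_one, he, one_pow] at this⟩
  have hpos : 0 < pairStr (qf (Φ A) e₁') (qf (Φ A) e₃') 1 1 := by
    obtain ⟨b₁, b₁'⟩ := bound e₁' h₁'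
    obtain ⟨b₃, b₃'⟩ := bound e₃' h₃'
    refine pairStr_pos b₁ b₁' b₃ b₃' ?_
    rcases q₁.1 with h0 | h0 <;> rw [h0] at q₁ q₃
    · exact .inl ⟨lt_of_le_of_ne b₁ (Ne.symm q₁.2), lt_of_le_of_ne b₃ (Ne.symm q₃.2)⟩
    · exact .inr ⟨lt_of_le_of_ne b₁' q₁.2, lt_of_le_of_ne b₃' q₃.2⟩
  have hv := str_add_str_eigen_add hA' h₁' h₃' o₁₃ d₁ d₃ one_ne_zero one_ne_zero
  rw [norm_one, one_pow, one_smul, one_smul] at hv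
  rw [← hv] at hpos
  have i₁ : inner ℂ e₁' e₁' = (1 : ℂ) := by rw [inner_self_eq_norm_sq_to_K, h₁']; simp
  have i₃ : inner ℂ e₃' e₃' = (1 : ℂ) := by rw [inner_self_eq_norm_sq_to_K, h₃']; simp
  have hv0 : e₁' + e₃' ≠ 0 := fun h0 => by
    have := congrArg (inner ℂ e₁') h0
    rw [inner_add_right, i₁, o₁₃] at this
    simp at this
  set s := str (Φ A) (e₁' + e₃') + str (1 - Φ A) (e₁' + e₃') with hs
  have hse : IsEff (s • ray (e₁' + e₃')) :=
    isEff_smul_ray hpos.le (str_add_str_le hA'.1 hA'.2 hv0)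
  have hcoex := (coex_smul_ray_iff_str hA'.1 hA'.2 hpos.le hv0).2 le_rfl
  obtain ⟨X, hX, hXe⟩ := hΦ.exists_eq hse
  have hXA : Coex A X := (hΦ.coex _ _ hAe hX).2 (hXe ▸ hcoex)
  have h2X : Coex (ray x) X := by
    rw [back (isEff_ray hx) (isEff_ray hx') hX hxx', hXe]
    exact orth hx' hse (by
      rw [inner_add_right, inner_eq_zero_symm' o₁₂, inner_eq_zero_symm' o₃₂, add_zero])
  have h1X := (hblock hX hXA).1 h2X
  rw [back (isEff_ray h₁) (isEff_ray h₁') hX hc₁, hXe] at h1X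
  have hcomm := commute_of_coex_projection (ray_isStarProjection h₁') h1X
  have happ := DFunLike.congr_fun hcomm.eq e₃'
  simp only [mul_apply_eq_comp, smul_apply, InnerProductSpace.rankOne_apply, o₁₃, inner_add_left,
    i₃, zero_add, one_smul, zero_smul, inner_zero_right, smul_zero] at happ
  rw [← Complex.coe_smul, inner_smul_right, inner_add_right, i₁, o₁₃, add_zero, mul_one,
    Complex.coe_smul] at happ
  exact smul_ne_zero hpos.ne' (ne_zero_of_norm_eq_one h₁') happ

/-- A coexistence preserver maps the multiples of a rank-one projection onto the multiples of a
rank-one projection, up to complements. -/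
theorem CoexAut.exists_ray_branch {Φ : (H →L[ℂ] H) → (H →L[ℂ] H)} (hΦ : CoexAut Φ)
    (hdim : 2 ≤ Module.rank ℂ H) {x : H} (hx : ‖x‖ = 1) :
    ∃ x' : H, ‖x'‖ = 1 ∧ CoexEq (Φ (ray x)) (ray x') ∧
      (∀ t : ℝ, 0 < t → t < 1 → ∃ τ : ℝ, 0 < τ ∧ τ < 1 ∧ CoexEq (Φ (t • ray x)) (τ • ray x')) ∧
      ∀ τ : ℝ, 0 < τ → τ < 1 → ∃ t : ℝ, 0 < t ∧ t < 1 ∧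
        CoexEq (Φ (t • ray x)) (τ • ray x') := by
  obtain ⟨x', Q, hx', hQ, hxx', h1, h2⟩ := hΦ.exists_branch hdim hx
  rcases hQ with rfl | rfl
  · exact ⟨x', hx', hxx', h1, h2⟩
  by_cases hdim3 : 3 ≤ Module.rank ℂ H
  · obtain ⟨τ, hτ, hτ', hflip⟩ := h1 (1 / 2) (by norm_num) (by norm_num)
    exact (hΦ.not_flip hdim3 hx hx' hxx' hτ hτ' hflip).elim
  · obtain ⟨y, hy, hxy⟩ := exists_unit_orthogonal_one hdim x'
    have he := ray_add_ray_eq_one hdim3 hx' hy hxy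
    rw [he] at h1 h2
    exact ⟨y, hy, hxx'.trans (he ▸ coexEq_compl _), h1, h2⟩

end Effect

/-! ### Overlaps of rays -/

namespace Effect

variable {H : Type*} [NormedAddCommGroup H] [InnerProductSpace ℂ H] [CompleteSpace H]

/-- The overlap `|⟨x, y⟩|²` of two vectors. -/
noncomputable def ov (x y : H) : ℝ := ‖(inner ℂ x y : ℂ)‖ ^ 2

lemma ov_comm (x y : H) : ov x y = ov y x := by rw [ov, ov, norm_inner_symm]

lemma ov_nonneg (x y : H) : 0 ≤ ov x y := by unfold ov; positivity

lemma ov_eq_zero {x y : H} : ov x y = 0 ↔ inner ℂ x y = 0 := by simp [ov]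

lemma ov_le_one {x y : H} (hx : ‖x‖ = 1) (hy : ‖y‖ = 1) : ov x y ≤ 1 := by
  have := norm_inner_le_norm (𝕜 := ℂ) x y
  rw [hx, hy, mul_one] at this
  exact pow_le_one₀ (norm_nonneg _) this

lemma ov_congr_left {x x' : H} (h : ray x = ray x') (y : H) : ov x y = ov x' y := by
  rw [ov, ov, ← qf_ray, ← qf_ray, h]

lemma inner_self_of_norm_eq_one {x : H} (hx : ‖x‖ = 1) : inner ℂ x x = (1 : ℂ) := by
  rw [inner_self_eq_norm_sq_to_K, hx]
  simp

/-- A unit vector decomposed along another one. -/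
lemma exists_decomp {x y : H} (hx : ‖x‖ = 1) (hy : ‖y‖ = 1) (h : ov x y < 1) :
    ∃ (f : H) (β : ℂ), ‖f‖ = 1 ∧ inner ℂ x f = 0 ∧ β ≠ 0 ∧ ‖β‖ ^ 2 = 1 - ov x y ∧
      y = (inner ℂ x y : ℂ) • x + β • f := by
  set w := y - (inner ℂ x y : ℂ) • x with hw
  have hxw : inner ℂ x w = 0 := by
    rw [hw, inner_sub_right, inner_smul_right, inner_self_of_norm_eq_one hx, mul_one, sub_self]
  have hnw : ‖w‖ ^ 2 = 1 - ov x y := by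
    have h1 := norm_sq_projection (ray_isStarProjection hx) y
    rw [InnerProductSpace.rankOne_apply, ← hw, hy, norm_smul, hx] at h1
    rw [ov]
    linarith
  have hw0 : w ≠ 0 := fun h0 => by
    rw [h0, norm_zero] at hnw
    linarith
  have hn : (‖w‖ : ℂ) ≠ 0 := by exact_mod_cast norm_ne_zero_iff.2 hw0
  refine ⟨((‖w‖ : ℂ)⁻¹) • w, (‖w‖ : ℂ), norm_smul_inv_norm hw0, ?_, hn, ?_, ?_⟩
  · rw [inner_smul_right, hxw, mul_zero]
  · rw [← hnw]
    simp
  · rw [smul_smul, mul_inv_cancel₀ hn, one_smul, hw]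
    abel

lemma ray_eq_of_ov_eq_one {x y : H} (hx : ‖x‖ = 1) (hy : ‖y‖ = 1) (h : ov x y = 1) :
    ray x = ray y := by
  have h1 := norm_sq_projection (ray_isStarProjection hx) y
  rw [InnerProductSpace.rankOne_apply, hy, norm_smul, hx, mul_one, ← ov, h] at h1
  have h2 : ‖y - (inner ℂ x y : ℂ) • x‖ ^ 2 = 0 := by linarith
  rw [sq_eq_zero_iff, norm_eq_zero, sub_eq_zero] at h2
  rw [h2, ray_smul, ← ov, h, one_smul]

/-- Coexistence of multiples of two rank-one projections in terms of the overlap. -/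
lemma coex_smul_ray_smul_ray {x y : H} (hx : ‖x‖ = 1) (hy : ‖y‖ = 1) (h0 : 0 < ov x y)
    (h1 : ov x y < 1) {s t : ℝ} (hs : 0 < s) (ht : 0 < t) (ht' : t < 1) :
    Coex (t • ray x) (s • ray y) ↔ s * t * ov x y ≤ (1 - s) * (1 - t) := by
  obtain ⟨f, β, hf, hxf, hβ, hβn, hye⟩ := exists_decomp hx hy h1
  have hα : (inner ℂ x y : ℂ) ≠ 0 := fun h => h0.ne' (ov_eq_zero.2 h)
  have hA := (isEff_ray hx).smul ht.le ht'.le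
  have hL := str_add_str_eigen_add hA hx hf hxf (l := t) (m := 0)
    (by rw [smul_apply, ray_apply_self hx])
    (by rw [smul_apply, InnerProductSpace.rankOne_apply, hxf, zero_smul, smul_zero, zero_smul])
    hα hβ
  rw [← hye, hβn, ← ov] at hL
  rw [coex_smul_ray_iff_str hA.1 hA.2 hs.le (ne_zero_of_norm_eq_one hy), hL, pairStr]
  have hden : 0 < ov x y * (1 - 0) + (1 - ov x y) * (1 - t) := by
    have : 0 < (1 - ov x y) * (1 - t) := mul_pos (by linarith) (by linarith)
    linarith
  rw [mul_zero, zero_div, zero_add, le_div_iff₀ hden]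
  constructor <;> intro h <;> linarith

/-- The point `a x + b e` of the real plane spanned by two orthonormal vectors. -/
noncomputable def pl (x e : H) (a b : ℝ) : H := (a : ℂ) • x + (b : ℂ) • e

lemma inner_pl {x e : H} (hx : ‖x‖ = 1) (he : ‖e‖ = 1) (hxe : inner ℂ x e = 0) (a b c d : ℝ) :
    inner ℂ (pl x e a b) (pl x e c d) = ((a * c + b * d : ℝ) : ℂ) := by
  simp only [pl, inner_add_left, inner_add_right, inner_smul_left, inner_smul_right,
    inner_self_of_norm_eq_one hx, inner_self_of_norm_eq_one he, hxe, inner_eq_zero_symm' hxe,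
    Complex.conj_ofReal]
  push_cast
  ring

lemma ov_pl {x e : H} (hx : ‖x‖ = 1) (he : ‖e‖ = 1) (hxe : inner ℂ x e = 0) (a b c d : ℝ) :
    ov (pl x e a b) (pl x e c d) = (a * c + b * d) ^ 2 := by
  rw [ov, inner_pl hx he hxe, Complex.norm_real, Real.norm_eq_abs, sq_abs]

lemma norm_pl {x e : H} (hx : ‖x‖ = 1) (he : ‖e‖ = 1) (hxe : inner ℂ x e = 0) {a b : ℝ}
    (h : a ^ 2 + b ^ 2 = 1) : ‖pl x e a b‖ = 1 := by
  have h1 := inner_self_eq_norm_sq (𝕜 := ℂ) (pl x e a b)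
  rw [inner_pl hx he hxe] at h1
  have h2 : ‖pl x e a b‖ ^ 2 = 1 := by
    rw [← h1, ← h, sq, sq]
    simp
  rwa [pow_eq_one_iff_of_nonneg (norm_nonneg _) two_ne_zero] at h2

lemma pl_one_zero (x e : H) : pl x e 1 0 = x := by simp [pl]

/-- The map on rays induced by a coexistence preserver: `t |x⟩⟨x|` goes to
`τ |ψ x⟩⟨ψ x|` up to complement, and `f x` is the map `t ↦ τ` in the parameter `1 / t - 1`, in
which coexistence of `t |x⟩⟨x|` and `s |y⟩⟨y|` reads `ov x y ≤ u v`. -/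
structure RayMap (ψ : H → H) (f : H → ℝ → ℝ) : Prop where
  norm : ∀ x, ‖x‖ = 1 → ‖ψ x‖ = 1
  ray_congr : ∀ x y, ‖x‖ = 1 → ‖y‖ = 1 → ray x = ray y → ray (ψ x) = ray (ψ y)
  surj : ∀ z, ‖z‖ = 1 → ∃ x, ‖x‖ = 1 ∧ ray (ψ x) = ray z
  orth_iff : ∀ x y, ‖x‖ = 1 → ‖y‖ = 1 → (inner ℂ x y = 0 ↔ inner ℂ (ψ x) (ψ y) = 0)
  pos : ∀ x, ‖x‖ = 1 → ∀ u, 0 < u → 0 < f x u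
  onto : ∀ x, ‖x‖ = 1 → ∀ c, 0 < c → ∃ u, 0 < u ∧ f x u = c
  le_iff : ∀ x y, ‖x‖ = 1 → ‖y‖ = 1 → 0 < ov x y → ov x y < 1 → ∀ u v, 0 < u → 0 < v →
    (ov x y ≤ u * v ↔ ov (ψ x) (ψ y) ≤ f x u * f y v)

lemma odds_inv (u : ℝ) : 1 / (1 / (1 + u)) - 1 = u := by
  field_simp
  ring

lemma odds_pos {t : ℝ} (ht : 0 < t) (ht' : t < 1) : 0 < 1 / t - 1 := by
  rw [sub_pos, lt_div_iff₀ ht]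
  linarith

lemma inv_odds {t : ℝ} (ht : 0 < t) : 1 / (1 + (1 / t - 1)) = t := by
  field_simp
  ring

lemma ov_le_odds_iff {s t p : ℝ} (hs : 0 < s) (ht : 0 < t) :
    s * t * p ≤ (1 - s) * (1 - t) ↔ p ≤ (1 / t - 1) * (1 / s - 1) := by
  have h : (1 / t - 1) * (1 / s - 1) = (1 - s) * (1 - t) / (s * t) := by
    field_simp
  rw [h, le_div_iff₀ (mul_pos hs ht), mul_comm p]

theorem CoexAut.exists_rayMap {Φ : (H →L[ℂ] H) → (H →L[ℂ] H)} (hΦ : CoexAut Φ)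
    (hdim : 2 ≤ Module.rank ℂ H) : ∃ (ψ : H → H) (τ : H → ℝ → ℝ),
      RayMap ψ (fun x u => 1 / τ x (1 / (1 + u)) - 1) ∧
      (∀ x, ‖x‖ = 1 → CoexEq (Φ (ray x)) (ray (ψ x))) ∧
      ∀ x t, ‖x‖ = 1 → 0 < t → t < 1 → 0 < τ x t ∧ τ x t < 1 ∧
        CoexEq (Φ (t • ray x)) (τ x t • ray (ψ x)) := by
  have hex : ∀ x : H, ∃ (x' : H) (τ : ℝ → ℝ), ‖x‖ = 1 → ‖x'‖ = 1 ∧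
      CoexEq (Φ (ray x)) (ray x') ∧ (∀ t : ℝ, 0 < t → t < 1 → 0 < τ t ∧ τ t < 1 ∧
        CoexEq (Φ (t • ray x)) (τ t • ray x')) ∧
      ∀ s : ℝ, 0 < s → s < 1 → ∃ t : ℝ, 0 < t ∧ t < 1 ∧ τ t = s := fun x => by
    by_cases hx : ‖x‖ = 1
    · obtain ⟨x', hx', h0, h1, h2⟩ := hΦ.exists_ray_branch hdim hx
      have h1' : ∀ t : ℝ, ∃ τ : ℝ, 0 < t → t < 1 → 0 < τ ∧ τ < 1 ∧
          CoexEq (Φ (t • ray x)) (τ • ray x') := fun t => by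
        by_cases h : 0 < t ∧ t < 1
        · obtain ⟨τ, hτ⟩ := h1 t h.1 h.2
          exact ⟨τ, fun _ _ => hτ⟩
        · exact ⟨0, fun h3 h4 => (h ⟨h3, h4⟩).elim⟩
      choose τ hτ using h1'
      refine ⟨x', τ, fun _ => ⟨hx', h0, hτ, fun s hs hs' => ?_⟩⟩
      obtain ⟨t, ht, ht', h3⟩ := h2 s hs hs'
      obtain ⟨h4, h5, h6⟩ := hτ t ht ht'
      exact ⟨t, ht, ht', (smul_ray_eq_of_coexEq hx' hx' (exists_unit_orthogonal_one hdim x') hs hs'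
        h4 h5 (h6.symm.trans h3)).2⟩
    · exact ⟨0, fun _ => 0, fun h => (hx h).elim⟩
  choose ψ τ hψ using hex
  have heff : ∀ {x : H} {t : ℝ}, ‖x‖ = 1 → 0 < t → t < 1 → IsEff (t • ray x) :=
    fun hx h h' => (isEff_ray hx).smul h.le h'.le
  have hcongr : ∀ x y, ‖x‖ = 1 → ‖y‖ = 1 → ray x = ray y → ray (ψ x) = ray (ψ y) := by
    intro x y hx hy h
    obtain ⟨hx', -, h1, -⟩ := hψ x hx
    obtain ⟨hy', -, h2, -⟩ := hψ y hy
    obtain ⟨a1, a2, a3⟩ := h1 (1 / 2) (by norm_num) (by norm_num)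
    obtain ⟨b1, b2, b3⟩ := h2 (1 / 2) (by norm_num) (by norm_num)
    rw [h] at a3
    exact (smul_ray_eq_of_coexEq hy' hx' (exists_unit_orthogonal_one hdim _) b1 b2 a1 a2
      (a3.symm.trans b3)).1
  have hinj : ∀ x y, ‖x‖ = 1 → ‖y‖ = 1 → ray (ψ x) = ray (ψ y) → ray x = ray y := by
    intro x y hx hy h
    obtain ⟨hx', -, h1, -⟩ := hψ x hx
    obtain ⟨hy', -, h2, h3⟩ := hψ y hy
    obtain ⟨a1, a2, a3⟩ := h1 (1 / 2) (by norm_num) (by norm_num)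
    obtain ⟨t, ht, ht', hts⟩ := h3 _ a1 a2
    obtain ⟨-, -, b3⟩ := h2 t ht ht'
    rw [hts, ← h] at b3
    have := (hΦ.coexEq_iff (heff hx (by norm_num) (by norm_num)) (heff hy ht ht')).2
      (a3.trans b3.symm)
    exact (smul_ray_eq_of_coexEq hy hx (exists_unit_orthogonal_one hdim _) ht ht' (by norm_num)
      (by norm_num) this).1
  have hcomm : ∀ x y, ‖x‖ = 1 → ‖y‖ = 1 →
      (Commute (ray x) (ray y) ↔ Commute (ray (ψ x)) (ray (ψ y))) := by
    intro x y hx hy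
    obtain ⟨hx', h1, -⟩ := hψ x hx
    obtain ⟨hy', h2, -⟩ := hψ y hy
    have ex := isEff_ray hx
    have ey := isEff_ray hy
    have ex' := isEff_ray hx'
    have ey' := isEff_ray hy'
    rw [← coex_projection_iff (ray_isStarProjection hx) ey.1 ey.2,
      ← coex_projection_iff (ray_isStarProjection hx') ey'.1 ey'.2, hΦ.coex _ _ ex ey,
      h1.coex_iff h2 ex' (hΦ.isEff ey)]
  have hov : ∀ {x : H}, ‖x‖ = 1 → ov x x = 1 := fun hx => by
    rw [ov, inner_self_of_norm_eq_one hx]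
    simp
  have horth : ∀ x y, ‖x‖ = 1 → ‖y‖ = 1 →
      (inner ℂ x y = 0 ↔ inner ℂ (ψ x) (ψ y) = 0) := by
    intro x y hx hy
    obtain ⟨hx', -⟩ := hψ x hx
    obtain ⟨hy', -⟩ := hψ y hy
    constructor
    · intro h
      refine (inner_eq_zero_or_of_commute_ray hx' hy' ((hcomm x y hx hy).1
        (commute_ray_of_inner_eq_zero h))).resolve_right fun h1 => ?_
      rw [← ov_eq_zero, ov_congr_left (hinj x y hx hy h1), hov hy] at h
      exact one_ne_zero h
    · intro h
      refine (inner_eq_zero_or_of_commute_ray hx hy ((hcomm x y hx hy).2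
        (commute_ray_of_inner_eq_zero h))).resolve_right fun h1 => ?_
      rw [← ov_eq_zero, ov_congr_left (hcongr x y hx hy h1), hov hy'] at h
      exact one_ne_zero h
  have hlt : ∀ x y, ‖x‖ = 1 → ‖y‖ = 1 → ov x y < 1 → ov (ψ x) (ψ y) < 1 := by
    intro x y hx hy h
    obtain ⟨hx', -⟩ := hψ x hx
    obtain ⟨hy', -⟩ := hψ y hy
    refine lt_of_le_of_ne (ov_le_one hx' hy') fun h1 => ?_
    rw [ov_congr_left (hinj x y hx hy (ray_eq_of_ov_eq_one hx' hy' h1)), hov hy] at h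
    exact lt_irrefl _ h
  have hinv : ∀ {u : ℝ}, 0 < u → 0 < 1 / (1 + u) ∧ 1 / (1 + u) < 1 := fun {u} hu =>
    ⟨by positivity, by rw [div_lt_one (by linarith)]; linarith⟩
  refine ⟨ψ, τ, ⟨fun x hx => (hψ x hx).1, hcongr, fun z hz => ?_, horth, fun x hx u hu => ?_,
    fun x hx c hc => ?_, fun x y hx hy h0 h1 u v hu hv => ?_⟩, fun x hx => (hψ x hx).2.1,
    fun x t hx => (hψ x hx).2.2.1 t⟩
  · obtain ⟨Ψ, hΨ, -, k2⟩ := hΦ.exists_inv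
    obtain ⟨x, hx, -, h1, -⟩ := hΨ.exists_ray_branch hdim hz
    obtain ⟨t, ht, ht', h2⟩ := h1 (1 / 2) (by norm_num) (by norm_num)
    have hze := heff hz (t := 1 / 2) (by norm_num) (by norm_num)
    rw [hΦ.coexEq_iff (hΨ.isEff hze) (heff hx ht ht'), k2 _ hze] at h2
    obtain ⟨hx', -, h3, -⟩ := hψ x hx
    obtain ⟨b1, b2, b3⟩ := h3 t ht ht'
    exact ⟨x, hx, (smul_ray_eq_of_coexEq hz hx' (exists_unit_orthogonal_one hdim _) (by norm_num)
      (by norm_num) b1 b2 (b3.symm.trans h2.symm)).1⟩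
  · obtain ⟨h1, h2⟩ := hinv hu
    obtain ⟨h3, h4, -⟩ := (hψ x hx).2.2.1 _ h1 h2
    exact odds_pos h3 h4
  · obtain ⟨h1, h2⟩ := hinv hc
    obtain ⟨t, ht, ht', h3⟩ := (hψ x hx).2.2.2 _ h1 h2
    exact ⟨1 / t - 1, odds_pos ht ht', by rw [inv_odds ht, h3, odds_inv c]⟩
  · obtain ⟨hx', -, hxτ, -⟩ := hψ x hx
    obtain ⟨hy', -, hyτ, -⟩ := hψ y hy
    obtain ⟨t0, t1⟩ := hinv hu
    obtain ⟨s0, s1⟩ := hinv hv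
    obtain ⟨a1, a2, a3⟩ := hxτ _ t0 t1
    obtain ⟨b1, b2, b3⟩ := hyτ _ s0 s1
    have h0' : 0 < ov (ψ x) (ψ y) := lt_of_le_of_ne (ov_nonneg _ _) fun h => h0.ne'
      (ov_eq_zero.2 ((horth x y hx hy).2 (ov_eq_zero.1 h.symm)))
    conv_lhs => rw [← odds_inv u, ← odds_inv v]
    rw [← ov_le_odds_iff s0 t0, ← ov_le_odds_iff b1 a1,
      ← coex_smul_ray_smul_ray hx hy h0 h1 s0 t0 t1,
      ← coex_smul_ray_smul_ray hx' hy' h0' (hlt x y hx hy h1) b1 a1 a2,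
      hΦ.coex _ _ (heff hx t0 t1) (heff hy s0 s1),
      a3.coex_iff b3 (heff hx' a1 a2) (hΦ.isEff (heff hy s0 s1))]

/-! ### The functional equation for the overlap -/

/-- Two surjections of `(0, ∞)` related through the sign of `p - u v` satisfy a functional
equation, and are monotone. -/
lemma mul_eq_of_le_iff {f g : ℝ → ℝ} {p P : ℝ} (hP : 0 < P) (hf : ∀ u, 0 < u → 0 < f u)
    (hg : ∀ u, 0 < u → 0 < g u) (hfs : ∀ c, 0 < c → ∃ u, 0 < u ∧ f u = c)
    (hgs : ∀ c, 0 < c → ∃ u, 0 < u ∧ g u = c) (hp : 0 < p)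
    (h : ∀ u v, 0 < u → 0 < v → (p ≤ u * v ↔ P ≤ f u * g v)) :
    (∀ v w, 0 < v → v ≤ w → g v ≤ g w) ∧ ∀ u, 0 < u → f u * g (p / u) = P := by
  have hmono : ∀ v w, 0 < v → v ≤ w → g v ≤ g w := fun v w hv hvw => by
    obtain ⟨u, hu, hfu⟩ := hfs (P / g v) (div_pos hP (hg v hv))
    have h1 : p ≤ u * v := (h u v hu hv).2 (by rw [hfu, div_mul_cancel₀ _ (hg v hv).ne'])
    have h2 := (h u w hu (hv.trans_le hvw)).1 (h1.trans (by gcongr))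
    rw [hfu, div_mul_eq_mul_div, le_div_iff₀ (hg v hv)] at h2
    exact le_of_mul_le_mul_left h2 hP
  refine ⟨hmono, fun u hu => le_antisymm ?_ ?_⟩
  · obtain ⟨v, hv, hgv⟩ := hgs (P / f u) (div_pos hP (hf u hu))
    have h1 : p ≤ u * v := (h u v hu hv).2 (by rw [hgv, mul_div_cancel₀ _ (hf u hu).ne'])
    have h2 : p / u ≤ v := by rwa [div_le_iff₀' hu]
    have h3 := hmono _ _ (div_pos hp hu) h2
    rw [hgv] at h3
    calc f u * g (p / u) ≤ f u * (P / f u) := by gcongr; exact (hf u hu).le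
      _ = P := mul_div_cancel₀ _ (hf u hu).ne'
  · exact (h u (p / u) hu (div_pos hp hu)).1 (by rw [mul_div_cancel₀ _ hu.ne'])

/-- A monotone surjection `f` of `(0, ∞)` for which `f(u) f(α/u)` does not depend on `u` is a
power function up to a constant. -/
lemma exists_rpow_of_mul {f : ℝ → ℝ} (hf : ∀ u, 0 < u → 0 < f u)
    (hfs : ∀ c, 0 < c → ∃ u, 0 < u ∧ f u = c) (hmono : ∀ v w, 0 < v → v ≤ w → f v ≤ f w)
    (h : ∀ α, 0 < α → ∃ K, ∀ u, 0 < u → f u * f (α / u) = K) :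
    ∃ k : ℝ, 0 < k ∧ ∀ u, 0 < u → f u = f 1 * u ^ k := by
  have h1 : 0 < f 1 := hf 1 one_pos
  have hmul : ∀ u v, 0 < u → 0 < v → f u * f v = f (u * v) * f 1 := fun u v hu hv => by
    obtain ⟨K, hK⟩ := h (u * v) (mul_pos hu hv)
    have k1 := hK u hu
    have k2 := hK (u * v) (mul_pos hu hv)
    rw [mul_div_cancel_left₀ _ hu.ne'] at k1
    rw [div_self (mul_pos hu hv).ne'] at k2
    rw [k1, k2]
  let F : ℝ →+ ℝ := AddMonoidHom.mk' (fun s => Real.log (f (Real.exp s) / f 1)) fun s t => by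
    have e1 := hf _ (Real.exp_pos s)
    have e2 := hf _ (Real.exp_pos t)
    rw [← Real.log_mul (div_pos e1 h1).ne' (div_pos e2 h1).ne', Real.exp_add]
    congr 1
    have := hmul _ _ (Real.exp_pos s) (Real.exp_pos t)
    field_simp
    linarith
  have hF : ∀ s, F s = Real.log (f (Real.exp s) / f 1) := fun s => rfl
  have hFm : Monotone F := fun s t hst => by
    rw [hF, hF]
    refine Real.log_le_log (div_pos (hf _ (Real.exp_pos s)) h1) ?_
    gcongr
    exact hmono _ _ (Real.exp_pos s) (Real.exp_le_exp.2 hst)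
  have hFs : Function.Surjective F := fun c => by
    obtain ⟨u, hu, hfu⟩ := hfs (f 1 * Real.exp c) (mul_pos h1 (Real.exp_pos c))
    refine ⟨Real.log u, ?_⟩
    rw [hF, Real.exp_log hu, hfu, mul_div_cancel_left₀ _ h1.ne', Real.log_exp]
  have hFc : Continuous F := hFm.continuous_of_surjective hFs
  have hlin : ∀ s, F s = s * F 1 := fun s => by
    have := map_real_smul F hFc s 1
    simpa using this
  refine ⟨F 1, ?_, fun u hu => ?_⟩
  · have h0 : 0 ≤ F 1 := by
      have := hFm (zero_le_one (α := ℝ))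
      rwa [map_zero] at this
    refine lt_of_le_of_ne h0 fun h0 => ?_
    obtain ⟨s, hs⟩ := hFs 1
    rw [hlin, ← h0, mul_zero] at hs
    exact zero_ne_one hs
  · have h2 := hlin (Real.log u)
    rw [hF, Real.exp_log hu] at h2
    have h3 := congrArg Real.exp h2
    rw [Real.exp_log (div_pos (hf u hu) h1), ← Real.rpow_def_of_pos hu, div_eq_iff h1.ne'] at h3
    rw [h3, mul_comm]

end Effect

namespace Effect

variable {H : Type*} [NormedAddCommGroup H] [InnerProductSpace ℂ H] [CompleteSpace H]

lemma exists_sq_add_sq (n : ℝ) : ∃ a : ℝ, a ≠ 0 ∧ a ^ 2 * (1 + n ^ 2) = 1 := by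
  have h : 0 < 1 + n ^ 2 := by positivity
  refine ⟨(Real.sqrt (1 + n ^ 2))⁻¹, inv_ne_zero (Real.sqrt_pos.2 h).ne', ?_⟩
  rw [inv_pow, Real.sq_sqrt h.le, inv_mul_cancel₀ h.ne']

/-- Every positive number is a cross-ratio of the overlaps of three rays in general position in a
real plane; the slopes of the rays are `0`, `1` and `-1 - 1 / √α`. -/
lemma exists_triple {x e : H} (hx : ‖x‖ = 1) (he : ‖e‖ = 1) (hxe : inner ℂ x e = 0) {α : ℝ}
    (hα : 0 < α) : ∃ y z : H, ‖y‖ = 1 ∧ ‖z‖ = 1 ∧ 0 < ov x y ∧ ov x y < 1 ∧ 0 < ov x z ∧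
      ov x z < 1 ∧ 0 < ov y z ∧ ov y z < 1 ∧ ov x y * ov x z = α * ov y z := by
  obtain ⟨s, hs, hs1⟩ := exists_sq_add_sq 1
  set r := (Real.sqrt α)⁻¹ with hr
  have hr0 : 0 < r := inv_pos.2 (Real.sqrt_pos.2 hα)
  have hr2 : α * r ^ 2 = 1 := by
    rw [hr, inv_pow, Real.sq_sqrt hα.le, mul_inv_cancel₀ hα.ne']
  obtain ⟨a, ha, ha1⟩ := exists_sq_add_sq (-1 - r)
  have hs2 : 0 < s ^ 2 := by positivity
  have ha2 : 0 < a ^ 2 := by positivity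
  have e1 : ov x (pl x e s s) = s ^ 2 := by
    have := ov_pl hx he hxe 1 0 s s
    rw [pl_one_zero] at this
    rw [this]
    ring
  have e2 : ov x (pl x e a (a * (-1 - r))) = a ^ 2 := by
    have := ov_pl hx he hxe 1 0 a (a * (-1 - r))
    rw [pl_one_zero] at this
    rw [this]
    ring
  have e3 : ov (pl x e s s) (pl x e a (a * (-1 - r))) = s ^ 2 * a ^ 2 * r ^ 2 := by
    rw [ov_pl hx he hxe]
    ring
  refine ⟨pl x e s s, pl x e a (a * (-1 - r)), norm_pl hx he hxe (by linarith),
    norm_pl hx he hxe (by linarith), ?_⟩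
  rw [e1, e2, e3]
  refine ⟨hs2, by linarith, ha2, by nlinarith, by positivity, ?_, ?_⟩
  · have h1 : s ^ 2 = 1 / 2 := by linarith
    rw [h1]
    nlinarith
  · linear_combination (-(s ^ 2 * a ^ 2)) * hr2

lemma isStarProjection_ray_add {a b : H} (ha : ‖a‖ = 1) (hb : ‖b‖ = 1) (hab : inner ℂ a b = 0) :
    IsStarProjection (ray a + ray b) :=
  (ray_isStarProjection ha).add (ray_isStarProjection hb) (ray_mul_ray_eq_zero hab)

namespace RayMap

variable {ψ : H → H} {f : H → ℝ → ℝ}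

lemma img_pos (hR : RayMap ψ f) {x y : H} (hx : ‖x‖ = 1) (hy : ‖y‖ = 1) (h : 0 < ov x y) :
    0 < ov (ψ x) (ψ y) :=
  lt_of_le_of_ne (ov_nonneg _ _) fun h0 =>
    h.ne' (ov_eq_zero.2 ((hR.orth_iff x y hx hy).2 (ov_eq_zero.1 h0.symm)))

lemma functional_equation (hR : RayMap ψ f) {x y : H} (hx : ‖x‖ = 1) (hy : ‖y‖ = 1)
    (h0 : 0 < ov x y) (h1 : ov x y < 1) :
    (∀ v w, 0 < v → v ≤ w → f y v ≤ f y w) ∧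
      ∀ u, 0 < u → f x u * f y (ov x y / u) = ov (ψ x) (ψ y) :=
  mul_eq_of_le_iff (hR.img_pos hx hy h0) (hR.pos x hx) (hR.pos y hy) (hR.onto x hx)
    (hR.onto y hy) h0 (hR.le_iff x y hx hy h0 h1)

lemma exists_rpow (hR : RayMap ψ f) (hdim : 2 ≤ Module.rank ℂ H) {x : H} (hx : ‖x‖ = 1) :
    ∃ k : ℝ, 0 < k ∧ ∀ u, 0 < u → f x u = f x 1 * u ^ k := by
  obtain ⟨e, he, hxe⟩ := exists_unit_orthogonal_one hdim x
  refine exists_rpow_of_mul (hR.pos x hx) (hR.onto x hx) ?_ fun α hα => ?_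
  · obtain ⟨y, -, hy, -, h0, h1, -⟩ := exists_triple hx he hxe one_pos
    rw [ov_comm] at h0 h1
    exact (hR.functional_equation hy hx h0 h1).1
  · obtain ⟨y, z, hy, hz, a0, a1, b0, b1, c0, c1, hcross⟩ := exists_triple hx he hxe hα
    have hxy := (hR.functional_equation hx hy a0 a1).2
    have hxz := (hR.functional_equation hx hz b0 b1).2
    have hyz := (hR.functional_equation hy hz c0 c1).2
    refine ⟨ov (ψ x) (ψ y) * ov (ψ x) (ψ z) / ov (ψ y) (ψ z), fun u hu => ?_⟩
    have k1 := hxy u hu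
    have k2 := hxz (α / u) (div_pos hα hu)
    have k3 := hyz (ov x y / u) (div_pos a0 hu)
    have e1 : ov x z / (α / u) = ov y z / (ov x y / u) := by
      field_simp
      linear_combination hcross
    rw [e1] at k2
    rw [eq_div_iff (hR.img_pos hy hz c0).ne', ← k1, ← k2, ← k3]
    ring

/-- All the maps of parameters are power functions up to constants, two rays that are neither equal
nor orthogonal have the same exponent, and the overlaps transform by the same power. -/
lemma exists_const (hR : RayMap ψ f) (hdim : 2 ≤ Module.rank ℂ H) : ∃ k : H → ℝ,
    (∀ x, ‖x‖ = 1 → 0 < k x ∧ ∀ u, 0 < u → f x u = f x 1 * u ^ k x) ∧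
    ∀ x y, ‖x‖ = 1 → ‖y‖ = 1 → 0 < ov x y → ov x y < 1 →
      k y = k x ∧ ov (ψ x) (ψ y) = f x 1 * f y 1 * ov x y ^ k x := by
  have hex : ∀ x : H, ∃ k : ℝ, ‖x‖ = 1 → 0 < k ∧ ∀ u, 0 < u → f x u = f x 1 * u ^ k := fun x => by
    by_cases hx : ‖x‖ = 1
    · obtain ⟨k, hk⟩ := hR.exists_rpow hdim hx
      exact ⟨k, fun _ => hk⟩
    · exact ⟨0, fun h => (hx h).elim⟩
  choose k hk using hex
  refine ⟨k, hk, fun x y hx hy h0 h1 => ?_⟩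
  have hfe := (hR.functional_equation hx hy h0 h1).2
  have e1 := hfe 1 one_pos
  have e2 := hfe _ h0
  rw [div_one, (hk y hy).2 _ h0] at e1
  rw [div_self h0.ne', (hk x hx).2 _ h0] at e2
  have hx1 := hR.pos x hx 1 one_pos
  have hy1 := hR.pos y hy 1 one_pos
  have e3 : ov x y ^ k y = ov x y ^ k x := by
    have h2 : f x 1 * f y 1 * ov x y ^ k y = f x 1 * f y 1 * ov x y ^ k x := by linarith
    exact mul_left_cancel₀ (mul_pos hx1 hy1).ne' h2
  exact ⟨(Real.rpow_right_inj h0 h1.ne).1 e3, by rw [← e2]; ring⟩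

/-- The images of two orthogonal rays span the images of the rays in their plane. -/
lemma ov_add_ov (hR : RayMap ψ f) {a b v : H} (ha : ‖a‖ = 1) (hb : ‖b‖ = 1) (hv : ‖v‖ = 1)
    (hab : inner ℂ a b = 0) (h : ov a v + ov b v = 1) :
    ov (ψ a) (ψ v) + ov (ψ b) (ψ v) = 1 := by
  have ha' := hR.norm a ha
  have hb' := hR.norm b hb
  have hv' := hR.norm v hv
  have hab' := (hR.orth_iff a b ha hb).1 hab
  have key : ∀ {a b v : H}, ‖a‖ = 1 → ‖b‖ = 1 → ‖v‖ = 1 → inner ℂ a b = 0 →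
      ‖v - (ray a + ray b) v‖ ^ 2 = 1 - (ov a v + ov b v) := fun {a b v} ha hb hv hab => by
    have hP := isStarProjection_ray_add ha hb hab
    have h1 := norm_sq_projection hP v
    rw [← qf_projection hP, qf_add, qf_ray, qf_ray, hv, ← ov, ← ov] at h1
    linarith
  set w := ψ v - (ray (ψ a) + ray (ψ b)) (ψ v) with hw
  have hwn := key ha' hb' hv' hab'
  rw [← hw] at hwn
  suffices hw0 : w = 0 by
    rw [hw0, norm_zero] at hwn
    linarith
  by_contra hw0
  have ia := inner_self_of_norm_eq_one ha'
  have ib := inner_self_of_norm_eq_one hb'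
  have hwa : inner ℂ (ψ a) w = 0 := by
    simp only [hw, inner_sub_right, add_apply, inner_add_right, InnerProductSpace.rankOne_apply,
      inner_smul_right, ia, hab']
    ring
  have hwb : inner ℂ (ψ b) w = 0 := by
    simp only [hw, inner_sub_right, add_apply, inner_add_right, InnerProductSpace.rankOne_apply,
      inner_smul_right, ib, inner_eq_zero_symm' hab']
    ring
  obtain ⟨z, hz, hzr⟩ := hR.surj (((‖w‖ : ℂ)⁻¹) • w) (norm_smul_inv_norm hw0)
  have hn : (‖w‖ : ℂ) ≠ 0 := by exact_mod_cast norm_ne_zero_iff.2 hw0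
  have hzi : ∀ y, inner ℂ (ψ z) y = 0 ↔ inner ℂ w y = 0 := fun y => by
    rw [← ov_eq_zero, ov_congr_left hzr, ov_eq_zero, inner_smul_left, mul_eq_zero,
      or_iff_right (by simpa using hn)]
  have hza := (hR.orth_iff z a hz ha).2 ((hzi _).2 (inner_eq_zero_symm' hwa))
  have hzb := (hR.orth_iff z b hz hb).2 ((hzi _).2 (inner_eq_zero_symm' hwb))
  have hvP := key ha hb hv hab
  rw [h, sub_self, sq_eq_zero_iff, norm_eq_zero, sub_eq_zero] at hvP
  have hzv : inner ℂ z v = 0 := by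
    rw [hvP, add_apply, inner_add_right, InnerProductSpace.rankOne_apply,
      InnerProductSpace.rankOne_apply, inner_smul_right, inner_smul_right, hza, hzb]
    ring
  have hwv := (hzi _).1 ((hR.orth_iff z v hz hv).1 hzv)
  have hvw : ψ v = w + (ray (ψ a) + ray (ψ b)) (ψ v) := by rw [hw]; abel
  rw [hvw, inner_add_right, add_apply, inner_add_right, InnerProductSpace.rankOne_apply,
    InnerProductSpace.rankOne_apply, inner_smul_right, inner_smul_right,
    inner_eq_zero_symm' hwa, inner_eq_zero_symm' hwb, mul_zero, mul_zero, add_zero, add_zero,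
    inner_self_eq_zero] at hwv
  exact hw0 hwv

/-- The sum rule for two pairs of orthogonal rays in a plane, seen from both sides. -/
lemma const_mul_const (hR : RayMap ψ f) {k : H → ℝ} (hk : ∀ x y, ‖x‖ = 1 → ‖y‖ = 1 →
      0 < ov x y → ov x y < 1 → k y = k x ∧ ov (ψ x) (ψ y) = f x 1 * f y 1 * ov x y ^ k x)
    {x e : H} (hx : ‖x‖ = 1) (he : ‖e‖ = 1) (hxe : inner ℂ x e = 0) {a b c d : ℝ}
    (hab : a ^ 2 + b ^ 2 = 1) (hcd : c ^ 2 + d ^ 2 = 1) (h0 : a * c + b * d ≠ 0)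
    (h1 : b * c - a * d ≠ 0) :
    k (pl x e c d) = k (pl x e a b) ∧ f (pl x e a b) 1 * f (pl x e c d) 1 *
      (((a * c + b * d) ^ 2) ^ k (pl x e a b) + ((b * c - a * d) ^ 2) ^ k (pl x e a b)) = 1 := by
  have nA := norm_pl hx he hxe hab
  have nC := norm_pl hx he hxe hcd
  have nA' : ‖pl x e (-b) a‖ = 1 := norm_pl hx he hxe (by linarith)
  have nC' : ‖pl x e (-d) c‖ = 1 := norm_pl hx he hxe (by linarith)
  have oA : inner ℂ (pl x e a b) (pl x e (-b) a) = 0 := by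
    rw [inner_pl hx he hxe]
    norm_cast
    ring
  have oC : inner ℂ (pl x e c d) (pl x e (-d) c) = 0 := by
    rw [inner_pl hx he hxe]
    norm_cast
    ring
  set p := (a * c + b * d) ^ 2 with hp
  set q := (b * c - a * d) ^ 2 with hq
  have hpq : p + q = 1 := by
    have : p + q = (a ^ 2 + b ^ 2) * (c ^ 2 + d ^ 2) := by rw [hp, hq]; ring
    rw [this, hab, hcd, one_mul]
  have hp0 : 0 < p := by positivity
  have hq0 : 0 < q := by positivity
  have vAC : ov (pl x e a b) (pl x e c d) = p := by rw [ov_pl hx he hxe]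
  have vAC' : ov (pl x e a b) (pl x e (-d) c) = q := by rw [ov_pl hx he hxe, hq]; ring
  have vA'C : ov (pl x e (-b) a) (pl x e c d) = q := by rw [ov_pl hx he hxe, hq]; ring
  have vA'C' : ov (pl x e (-b) a) (pl x e (-d) c) = p := by rw [ov_pl hx he hxe, hp]; ring
  generalize pl x e a b = A at *
  generalize pl x e c d = C at *
  generalize pl x e (-b) a = A' at *
  generalize pl x e (-d) c = C' at *
  obtain ⟨k1, w1⟩ := hk A C nA nC (by rw [vAC]; exact hp0) (by rw [vAC]; linarith)
  obtain ⟨k2, w2⟩ := hk A C' nA nC' (by rw [vAC']; exact hq0) (by rw [vAC']; linarith)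
  obtain ⟨k3, w3⟩ := hk A' C nA' nC (by rw [vA'C]; exact hq0) (by rw [vA'C]; linarith)
  obtain ⟨k4, w4⟩ := hk A' C' nA' nC' (by rw [vA'C']; exact hp0) (by rw [vA'C']; linarith)
  have s1 := hR.ov_add_ov nA nA' nC oA (by rw [vAC, vA'C, hpq])
  have s2 := hR.ov_add_ov nC nC' nA oC (by rw [ov_comm, vAC, ov_comm, vAC', hpq])
  have s3 := hR.ov_add_ov nC nC' nA' oC (by rw [ov_comm, vA'C, ov_comm, vA'C', add_comm, hpq])
  rw [ov_comm (ψ C), ov_comm (ψ C')] at s2 s3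
  have kA' : k A' = k A := by rw [← k3, k1]
  rw [w1, w3, vAC, vA'C, kA'] at s1
  rw [w1, w2, vAC, vAC'] at s2
  rw [w3, w4, vA'C, vA'C', kA'] at s3
  refine ⟨k1, ?_⟩
  have P0 : 0 < p ^ k A := Real.rpow_pos_of_pos hp0 _
  have Q0 : 0 < q ^ k A := Real.rpow_pos_of_pos hq0 _
  have pA := hR.pos A nA 1 one_pos
  have pA' := hR.pos A' nA' 1 one_pos
  have pC := hR.pos C nC 1 one_pos
  have pC' := hR.pos C' nC' 1 one_pos
  generalize p ^ k A = P at *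
  generalize q ^ k A = Q at *
  have d1 : f A' 1 * f C 1 = f A 1 * f C' 1 := mul_right_cancel₀ Q0.ne' (by linarith)
  have d2 : f A 1 * f C 1 = f A' 1 * f C' 1 := mul_right_cancel₀ P0.ne' (by linarith)
  have d3 : f A 1 = f A' 1 := by
    have d4 : f A 1 ^ 2 * f C' 1 = f A' 1 ^ 2 * f C' 1 := by
      linear_combination (-f A 1) * d1 + f A' 1 * d2
    have d5 := mul_right_cancel₀ pC'.ne' d4
    exact (pow_left_inj₀ pA.le pA'.le two_ne_zero).1 d5
  rw [← d3] at s1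
  linear_combination s1

/-- Three rays in a plane with pairwise overlaps `1/4` determine the constant. -/
lemma const_sq (hR : RayMap ψ f) (hdim : 2 ≤ Module.rank ℂ H) {k : H → ℝ}
    (hk : ∀ x y, ‖x‖ = 1 → ‖y‖ = 1 → 0 < ov x y → ov x y < 1 →
      k y = k x ∧ ov (ψ x) (ψ y) = f x 1 * f y 1 * ov x y ^ k x) {x : H} (hx : ‖x‖ = 1) :
    f x 1 ^ 2 * ((1 / 4 : ℝ) ^ k x + (3 / 4 : ℝ) ^ k x) = 1 := by
  obtain ⟨e, he, hxe⟩ := exists_unit_orthogonal_one hdim x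
  set r := Real.sqrt 3 / 2 with hr
  have hr2 : r ^ 2 = 3 / 4 := by
    rw [hr, div_pow, Real.sq_sqrt (by norm_num)]
    norm_num
  have hr0 : r ≠ 0 := fun h => by rw [h] at hr2; norm_num at hr2
  have n1 : (1 / 2 : ℝ) ^ 2 + r ^ 2 = 1 := by rw [hr2]; norm_num
  have n2 : (1 / 2 : ℝ) ^ 2 + (-r) ^ 2 = 1 := by rw [neg_sq]; exact n1
  have n0 : (1 : ℝ) ^ 2 + 0 ^ 2 = 1 := by norm_num
  have c1 := hR.const_mul_const hk hx he hxe n0 n1 (by norm_num) (by simpa using hr0)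
  have c2 := hR.const_mul_const hk hx he hxe n0 n2 (by norm_num) (by simpa using hr0)
  have c3 := hR.const_mul_const hk hx he hxe n1 n2 (by nlinarith) (by
    intro h
    apply hr0
    linarith)
  have e1 : (1 * (1 / 2) + 0 * r) ^ 2 = 1 / 4 := by norm_num
  have e2 : (0 * (1 / 2) - 1 * r) ^ 2 = 3 / 4 := by rw [← hr2]; ring
  have e3 : (1 * (1 / 2) + 0 * -r) ^ 2 = 1 / 4 := by norm_num
  have e4 : (0 * (1 / 2) - 1 * -r) ^ 2 = 3 / 4 := by rw [← hr2]; ring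
  have e5 : (1 / 2 * (1 / 2) + r * -r) ^ 2 = 1 / 4 := by
    have : 1 / 2 * (1 / 2) + r * -r = 1 / 4 - r ^ 2 := by ring
    rw [this, hr2]
    norm_num
  have e6 : (r * (1 / 2) - 1 / 2 * -r) ^ 2 = 3 / 4 := by rw [← hr2]; ring
  rw [e1, e2, pl_one_zero] at c1
  rw [e3, e4, pl_one_zero] at c2
  rw [e5, e6, c1.1] at c3
  have pM : 0 < (1 / 4 : ℝ) ^ k x + (3 / 4 : ℝ) ^ k x := by positivity
  have p0 := hR.pos x hx 1 one_pos
  have p1 := hR.pos _ (norm_pl hx he hxe n1) 1 one_pos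
  have c1' := c1.2
  have c2' := c2.2
  have c3' := c3.2
  generalize f (pl x e (1 / 2) r) 1 = u at *
  generalize f (pl x e (1 / 2) (-r)) 1 = v at *
  generalize (1 / 4 : ℝ) ^ k x + (3 / 4 : ℝ) ^ k x = M at *
  have huv : u = v := by
    have : f x 1 * M * u = f x 1 * M * v := by linarith
    exact mul_left_cancel₀ (mul_pos p0 pM).ne' this
  rw [← huv] at c3'
  have hxu : f x 1 = u := by
    have : f x 1 * (u * M) = u * (u * M) := by linarith
    exact mul_right_cancel₀ (mul_pos p1 pM).ne' this
  rw [hxu]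
  linear_combination c3'

/-- The map on rays preserves overlaps, and does not change the factors. -/
theorem ov_eq (hR : RayMap ψ f) (hdim : 2 ≤ Module.rank ℂ H) :
    (∀ x, ‖x‖ = 1 → ∀ u, 0 < u → f x u = u) ∧
      ∀ x y, ‖x‖ = 1 → ‖y‖ = 1 → ov (ψ x) (ψ y) = ov x y := by
  obtain ⟨k, hk, hk'⟩ := hR.exists_const hdim
  have hkc : ∀ x, ‖x‖ = 1 → k x = 1 ∧ f x 1 = 1 := by
    intro x hx
    obtain ⟨e, he, hxe⟩ := exists_unit_orthogonal_one hdim x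
    obtain ⟨s, hs, hs1⟩ := exists_sq_add_sq 1
    have hs2 : s ^ 2 = 1 / 2 := by linarith
    have n0 : (1 : ℝ) ^ 2 + 0 ^ 2 = 1 := by norm_num
    have n1 : s ^ 2 + s ^ 2 = 1 := by linarith
    obtain ⟨c1, c2⟩ := hR.const_mul_const hk' hx he hxe n0 n1 (by simpa using hs)
      (by simpa using hs)
    have e1 : (1 * s + 0 * s) ^ 2 = 1 / 2 := by rw [← hs2]; ring
    have e2 : (0 * s - 1 * s) ^ 2 = 1 / 2 := by rw [← hs2]; ring
    rw [e1, e2, pl_one_zero] at c2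
    rw [pl_one_zero] at c1
    have q1 := hR.const_sq hdim hk' hx
    have q2 := hR.const_sq hdim hk' (norm_pl hx he hxe n1)
    rw [c1] at q2
    have p0 := hR.pos x hx 1 one_pos
    have p1 := hR.pos _ (norm_pl hx he hxe n1) 1 one_pos
    have pM : 0 < (1 / 4 : ℝ) ^ k x + (3 / 4 : ℝ) ^ k x := by positivity
    have hc : f x 1 = f (pl x e s s) 1 := by
      have := mul_right_cancel₀ pM.ne' (q1.trans q2.symm)
      exact (pow_left_inj₀ p0.le p1.le two_ne_zero).1 this
    rw [← hc, ← sq] at c2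
    have hM : (1 / 2 : ℝ) ^ k x + (1 / 2 : ℝ) ^ k x = (1 / 4 : ℝ) ^ k x + (3 / 4 : ℝ) ^ k x :=
      mul_left_cancel₀ (pow_pos p0 2).ne' (c2.trans q1.symm)
    have hkx := (hk x hx).1
    have hmem : ∀ {t : ℝ}, 0 ≤ t → t ∈ Set.Ici (0 : ℝ) := fun h => h
    have hmid : (1 / 2 : ℝ) • (1 / 4 : ℝ) + (1 / 2 : ℝ) • (3 / 4 : ℝ) = 1 / 2 := by norm_num
    have hk1 : k x = 1 := by
      -- At `1/4`, `1/2` and `3/4` the power function is neither strictly convex nor strictly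
      -- concave.
      rcases lt_trichotomy (k x) 1 with hlt | heq | hgt
      · obtain ⟨-, h⟩ := Real.strictConcaveOn_rpow hkx hlt
        have := h (hmem (t := 1 / 4) (by norm_num)) (hmem (t := 3 / 4) (by norm_num))
          (by norm_num) (show (0 : ℝ) < 1 / 2 by norm_num) (show (0 : ℝ) < 1 / 2 by norm_num)
          (by norm_num)
        rw [hmid] at this
        simp only [smul_eq_mul] at this
        linarith
      · exact heq
      · obtain ⟨-, h⟩ := strictConvexOn_rpow hgt
        have := h (hmem (t := 1 / 4) (by norm_num)) (hmem (t := 3 / 4) (by norm_num))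
          (by norm_num) (show (0 : ℝ) < 1 / 2 by norm_num) (show (0 : ℝ) < 1 / 2 by norm_num)
          (by norm_num)
        rw [hmid] at this
        simp only [smul_eq_mul] at this
        linarith
    refine ⟨hk1, ?_⟩
    rw [hk1, Real.rpow_one, Real.rpow_one] at q1
    have : f x 1 ^ 2 = 1 := by linarith
    rwa [pow_eq_one_iff_of_nonneg p0.le two_ne_zero] at this
  refine ⟨fun x hx u hu => ?_, fun x y hx hy => ?_⟩
  · rw [(hk x hx).2 u hu, (hkc x hx).1, (hkc x hx).2, Real.rpow_one, one_mul]
  · rcases (ov_nonneg x y).eq_or_lt with h0 | h0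
    · rw [← h0, ov_eq_zero, ← hR.orth_iff x y hx hy, ← ov_eq_zero, h0]
    rcases (ov_le_one hx hy).eq_or_lt with h1 | h1
    · rw [h1, ov_congr_left (hR.ray_congr x y hx hy (ray_eq_of_ov_eq_one hx hy h1)), ov,
        inner_self_of_norm_eq_one (hR.norm y hy)]
      simp
    · rw [(hk' x y hx hy h0 h1).2, (hkc x hx).1, (hkc x hx).2, (hkc y hy).2, Real.rpow_one]
      ring

end RayMap

end Effect

/-! ### Wigner's theorem -/

namespace Effect

variable {H : Type*} [NormedAddCommGroup H] [InnerProductSpace ℂ H] [CompleteSpace H]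

lemma exists_eq_smul_of_norm_inner {a b : H} (h : ‖a‖ = ‖b‖) (h' : ‖(inner ℂ b a : ℂ)‖ = ‖b‖ ^ 2) :
    ∃ c : ℂ, ‖c‖ = 1 ∧ a = c • b := by
  by_cases hb : b = 0
  · rw [hb, norm_zero, norm_eq_zero] at h
    exact ⟨1, norm_one, by rw [h, hb, smul_zero]⟩
  have ha : a ≠ 0 := fun ha => hb (by rw [ha, norm_zero] at h; exact norm_eq_zero.1 h.symm)
  obtain ⟨c, -, hc⟩ := (norm_inner_eq_norm_iff (𝕜 := ℂ) hb ha).1 (by rw [h', h, sq])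
  refine ⟨c, ?_, hc⟩
  rw [hc, norm_smul] at h
  exact (mul_eq_right₀ (norm_ne_zero_iff.2 hb)).1 h

/-- Maps preserving the absolute value of the inner product; the values are only meaningful up to
phases. -/
def PreservesAbsInner (T : H → H) : Prop :=
  ∀ v w, ‖(inner ℂ (T v) (T w) : ℂ)‖ = ‖(inner ℂ v w : ℂ)‖

namespace PreservesAbsInner

variable {T : H → H}

lemma norm_map (hT : PreservesAbsInner T) (v : H) : ‖T v‖ = ‖v‖ := by
  have := hT v v
  rw [norm_inner_self_eq, norm_inner_self_eq] at this
  exact (pow_left_inj₀ (norm_nonneg _) (norm_nonneg _) two_ne_zero).1 this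

lemma map_smul (hT : PreservesAbsInner T) (c : ℂ) (v : H) :
    ∃ d : ℂ, T (c • v) = d • T v := by
  by_cases hc : c = 0
  · refine ⟨0, ?_⟩
    rw [zero_smul, ← norm_eq_zero, hT.norm_map, hc, zero_smul, norm_zero]
  obtain ⟨d, -, hd⟩ := exists_eq_smul_of_norm_inner (a := T (c • v)) (b := (‖c‖ : ℂ) • T v)
    (by rw [hT.norm_map, norm_smul, norm_smul, hT.norm_map]; simp) (by
      rw [inner_smul_left, norm_mul, hT, inner_smul_right, norm_mul, norm_inner_self_eq, norm_smul,
        hT.norm_map]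
      simp only [Complex.conj_ofReal, Complex.norm_real, norm_norm]
      ring)
  exact ⟨d * ‖c‖, by rw [hd, smul_smul]⟩

/-- For `z` orthogonal to `e`, the value of `T` at `e + z`, normalized to have the component `T e`
along `T e`, is `T e + orthPart T e z`. -/
noncomputable def orthPart (T : H → H) (e z : H) : H :=
  (inner ℂ (T e) (T (e + z)) : ℂ)⁻¹ • T (e + z) - T e

variable {e : H}

lemma norm_phase (hT : PreservesAbsInner T) (he : ‖e‖ = 1) {z : H} (hz : inner ℂ e z = 0) :
    ‖(inner ℂ (T e) (T (e + z)) : ℂ)‖ = 1 := by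
  rw [hT, inner_add_right, hz, inner_self_of_norm_eq_one he, add_zero, norm_one]

lemma inner_orthPart (hT : PreservesAbsInner T) (he : ‖e‖ = 1) {z : H} (hz : inner ℂ e z = 0) :
    inner ℂ (T e) (orthPart T e z) = 0 := by
  have h : (inner ℂ (T e) (T (e + z)) : ℂ) ≠ 0 := fun h => by
    have := hT.norm_phase he hz
    rw [h, norm_zero] at this
    exact zero_ne_one this
  rw [orthPart, inner_sub_right, inner_smul_right, inv_mul_cancel₀ h,
    inner_self_of_norm_eq_one (by rw [hT.norm_map, he]), sub_self]

lemma norm_inner_add_orthPart (hT : PreservesAbsInner T) (he : ‖e‖ = 1) {z w : H}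
    (hz : inner ℂ e z = 0) (hw : inner ℂ e w = 0) :
    ‖1 + (inner ℂ (orthPart T e z) (orthPart T e w) : ℂ)‖ = ‖1 + (inner ℂ z w : ℂ)‖ := by
  have he' : ‖T e‖ = 1 := by rw [hT.norm_map, he]
  have h1 : ∀ x y : H, inner ℂ e x = 0 → inner ℂ e y = 0 → ‖e‖ = 1 →
      inner ℂ (e + x) (e + y) = 1 + (inner ℂ x y : ℂ) := fun x y hx hy he => by
    rw [inner_add_left, inner_add_right, inner_add_right, hy, inner_eq_zero_symm' hx,
      inner_self_of_norm_eq_one he, zero_add, add_zero]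
  have h2 : ∀ z, T e + orthPart T e z = (inner ℂ (T e) (T (e + z)) : ℂ)⁻¹ • T (e + z) := fun z => by
    rw [orthPart]; abel
  have h3 : inner ℂ (T e + orthPart T e z) (T e + orthPart T e w)
      = 1 + (inner ℂ (orthPart T e z) (orthPart T e w) : ℂ) := by
    rw [inner_add_left, inner_add_right, inner_add_right, hT.inner_orthPart he hw,
      inner_eq_zero_symm' (hT.inner_orthPart he hz), inner_self_of_norm_eq_one he', zero_add,
      add_zero]
  rw [← h3, ← h1 z w hz hw he, h2, h2, inner_smul_left, inner_smul_right, norm_mul, norm_mul, hT,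
    RCLike.norm_conj, norm_inv, norm_inv, hT.norm_phase he hz, hT.norm_phase he hw]
  simp

lemma norm_orthPart (hT : PreservesAbsInner T) (he : ‖e‖ = 1) {z : H} (hz : inner ℂ e z = 0) :
    ‖orthPart T e z‖ = ‖z‖ := by
  have h := hT.norm_inner_add_orthPart he hz hz
  have k : ∀ x : H, ‖1 + (inner ℂ x x : ℂ)‖ = 1 + ‖x‖ ^ 2 := fun x => by
    rw [inner_self_eq_norm_sq_to_K]
    have : (1 : ℂ) + ((‖x‖ : ℝ) : ℂ) ^ 2 = ((1 + ‖x‖ ^ 2 : ℝ) : ℂ) := by push_cast; ring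
    exact (congrArg norm this).trans (by
      rw [Complex.norm_real, Real.norm_of_nonneg (by positivity)])
  rw [k, k] at h
  exact (pow_left_inj₀ (norm_nonneg _) (norm_nonneg _) two_ne_zero).1 (by linarith)

lemma exists_eq_smul_orthPart (hT : PreservesAbsInner T) (he : ‖e‖ = 1) {z : H}
    (hz : inner ℂ e z = 0) : ∃ c : ℂ, ‖c‖ = 1 ∧ T z = c • orthPart T e z := by
  refine exists_eq_smul_of_norm_inner (by rw [hT.norm_map, hT.norm_orthPart he hz]) ?_
  have h1 : (inner ℂ (T e) (T z) : ℂ) = 0 := by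
    rw [← norm_eq_zero, hT, hz, norm_zero]
  rw [orthPart, inner_sub_left, h1, sub_zero, inner_smul_left, norm_mul, hT, RCLike.norm_conj,
    norm_inv, hT.norm_phase he hz, inner_add_left, hz, zero_add, norm_inner_self_eq, ← orthPart,
    hT.norm_orthPart he hz, inv_one, one_mul]

lemma norm_inner_orthPart (hT : PreservesAbsInner T) (he : ‖e‖ = 1) {z w : H}
    (hz : inner ℂ e z = 0) (hw : inner ℂ e w = 0) :
    ‖(inner ℂ (orthPart T e z) (orthPart T e w) : ℂ)‖ = ‖(inner ℂ z w : ℂ)‖ := by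
  obtain ⟨c, hc, h1⟩ := hT.exists_eq_smul_orthPart he hz
  obtain ⟨d, hd, h2⟩ := hT.exists_eq_smul_orthPart he hw
  rw [← hT z w, h1, h2, inner_smul_left, inner_smul_right, norm_mul, norm_mul, RCLike.norm_conj,
    hc, hd, one_mul, one_mul]

lemma re_inner_orthPart (hT : PreservesAbsInner T) (he : ‖e‖ = 1) {z w : H}
    (hz : inner ℂ e z = 0) (hw : inner ℂ e w = 0) :
    (inner ℂ (orthPart T e z) (orthPart T e w) : ℂ).re = (inner ℂ z w : ℂ).re := by
  have h1 := hT.norm_inner_add_orthPart he hz hw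
  have h2 := hT.norm_inner_orthPart he hz hw
  have k : ∀ a : ℂ, ‖1 + a‖ ^ 2 = 1 + 2 * a.re + ‖a‖ ^ 2 := fun a => by
    rw [← Complex.normSq_eq_norm_sq, ← Complex.normSq_eq_norm_sq, Complex.normSq_apply,
      Complex.normSq_apply]
    simp only [Complex.add_re, Complex.one_re, Complex.add_im, Complex.one_im]
    ring
  have h3 := k (inner ℂ (orthPart T e z) (orthPart T e w))
  rw [h1, h2, k] at h3
  linarith

lemma eq_zero_of_re_inner_self {x : H} (h : (inner ℂ x x : ℂ).re = 0) : x = 0 := by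
  have h1 := inner_self_eq_norm_sq (𝕜 := ℂ) x
  change (inner ℂ x x : ℂ).re = _ at h1
  rw [h1] at h
  simpa using h

lemma orthPart_add (hT : PreservesAbsInner T) (he : ‖e‖ = 1) {z w : H}
    (hz : inner ℂ e z = 0) (hw : inner ℂ e w = 0) :
    orthPart T e (z + w) = orthPart T e z + orthPart T e w := by
  have hzw : inner ℂ e (z + w) = 0 := by rw [inner_add_right, hz, hw, add_zero]
  have g := fun {x y : H} (hx : inner ℂ e x = 0) (hy : inner ℂ e y = 0) =>
    hT.re_inner_orthPart he hx hy
  refine sub_eq_zero.1 (eq_zero_of_re_inner_self ?_)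
  simp only [inner_sub_left, inner_sub_right, inner_add_left, inner_add_right, Complex.sub_re,
    Complex.add_re, g hz hz, g hz hw, g hw hz, g hw hw, g hzw hz, g hzw hw, g hz hzw, g hw hzw,
    g hzw hzw]
  ring

lemma orthPart_real_smul (hT : PreservesAbsInner T) (he : ‖e‖ = 1) {z : H}
    (hz : inner ℂ e z = 0) (t : ℝ) : orthPart T e ((t : ℂ) • z) = (t : ℂ) • orthPart T e z := by
  have htz : inner ℂ e ((t : ℂ) • z) = 0 := by rw [inner_smul_right, hz, mul_zero]
  have g := fun {x y : H} (hx : inner ℂ e x = 0) (hy : inner ℂ e y = 0) =>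
    hT.re_inner_orthPart he hx hy
  have g1 := g hz htz
  have g2 := g htz htz
  simp only [inner_smul_left z, inner_smul_right _ z, Complex.conj_ofReal, Complex.re_ofReal_mul]
    at g1 g2
  refine sub_eq_zero.1 (eq_zero_of_re_inner_self ?_)
  have g3 : (inner ℂ (orthPart T e ((t : ℂ) • z)) (orthPart T e z)).re
      = (inner ℂ (orthPart T e z) (orthPart T e ((t : ℂ) • z))).re :=
    inner_re_symm (𝕜 := ℂ) _ _
  simp only [inner_sub_left, inner_sub_right, inner_smul_left _ (orthPart T e z),
    inner_smul_left (orthPart T e z),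
    inner_smul_right _ (orthPart T e z), Complex.conj_ofReal, Complex.sub_re,
    Complex.re_ofReal_mul, g hz hz, g1, g2, g3]
  ring

lemma orthPart_I_smul (hT : PreservesAbsInner T) (he : ‖e‖ = 1) {z : H}
    (hz : inner ℂ e z = 0) :
    orthPart T e (Complex.I • z) = Complex.I • orthPart T e z ∨
      orthPart T e (Complex.I • z) = -Complex.I • orthPart T e z := by
  by_cases hz0 : z = 0
  · have h0 : orthPart T e (0 : H) = 0 := by
      rw [← norm_eq_zero, hT.norm_orthPart he (inner_zero_right e), norm_zero]
    left
    rw [hz0, smul_zero, h0, smul_zero]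
  have hiz : inner ℂ e (Complex.I • z) = 0 := by rw [inner_smul_right, hz, mul_zero]
  have hV0 : orthPart T e z ≠ 0 := fun h => hz0 (by
    rw [← norm_eq_zero, ← hT.norm_orthPart he hz, h, norm_zero])
  obtain ⟨c, hc, h⟩ := exists_eq_smul_of_norm_inner (a := orthPart T e (Complex.I • z))
    (b := orthPart T e z)
    (by rw [hT.norm_orthPart he hiz, hT.norm_orthPart he hz, norm_smul, Complex.norm_I, one_mul])
    (by rw [hT.norm_inner_orthPart he hz hiz, inner_smul_right, norm_mul, Complex.norm_I, one_mul,
          norm_inner_self_eq, hT.norm_orthPart he hz])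
  have hre := hT.re_inner_orthPart he hz hiz
  rw [h, inner_smul_right, inner_smul_right, inner_self_eq_norm_sq_to_K,
    inner_self_eq_norm_sq_to_K] at hre
  have hpos : ‖orthPart T e z‖ ^ 2 ≠ 0 := pow_ne_zero 2 (norm_ne_zero_iff.2 hV0)
  have k : ∀ (c : ℂ) (r : ℝ), (c * ((r : ℝ) : ℂ) ^ 2).re = c.re * r ^ 2 := fun c r => by
    rw [← Complex.ofReal_pow, Complex.re_mul_ofReal]
  have hre' : c.re * ‖orthPart T e z‖ ^ 2 = 0 :=
    (k c _).symm.trans (hre.trans ((k _ _).trans (by rw [Complex.I_re, zero_mul])))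
  have hc0 : c.re = 0 := (mul_eq_zero.1 hre').resolve_right hpos
  have hc1 : c.im ^ 2 = 1 := by
    have h1 := Complex.sq_norm c
    rw [hc, Complex.normSq_apply, hc0] at h1
    linarith
  rw [h]
  rcases mul_self_eq_one_iff.1 ((sq _).symm.trans hc1) with h1 | h1
  · left
    congr 1
    exact Complex.ext (by simp [hc0]) (by simp [h1])
  · right
    congr 1
    exact Complex.ext (by simp [hc0]) (by simp [h1])

lemma orthPart_smul_of_I (hT : PreservesAbsInner T) (he : ‖e‖ = 1) {σ : ℂ →+* ℂ}
    (hσ : ∀ t : ℝ, σ t = t)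
    (h : ∀ z, inner ℂ e z = 0 → orthPart T e (Complex.I • z) = σ Complex.I • orthPart T e z)
    {z : H} (hz : inner ℂ e z = 0) (c : ℂ) :
    orthPart T e (c • z) = σ c • orthPart T e z := by
  have ho : ∀ d : ℂ, inner ℂ e (d • z) = 0 := fun d => by rw [inner_smul_right, hz, mul_zero]
  have hc : c • z = (c.re : ℂ) • z + (c.im : ℂ) • (Complex.I • z) := by
    rw [smul_smul, ← add_smul, Complex.re_add_im]
  have hσc : σ c = c.re + c.im * σ Complex.I := by
    conv_lhs => rw [← Complex.re_add_im c]
    rw [map_add, map_mul, hσ, hσ]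
  rw [hc, hT.orthPart_add he (ho _) (by rw [inner_smul_right, ho, mul_zero]),
    hT.orthPart_real_smul he hz, hT.orthPart_real_smul he (ho _), h z hz, hσc, add_smul, smul_smul]

/-- The orthogonal part is either linear or antilinear: which of the two cannot change from one
vector to another, by additivity. -/
lemma orthPart_linear_or (hT : PreservesAbsInner T) (he : ‖e‖ = 1) :
    (∀ z, inner ℂ e z = 0 → ∀ c : ℂ, orthPart T e (c • z) = c • orthPart T e z) ∨
      ∀ z, inner ℂ e z = 0 → ∀ c : ℂ,
        orthPart T e (c • z) = (starRingEnd ℂ) c • orthPart T e z := by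
  by_cases hall : ∀ z, inner ℂ e z = 0 →
      orthPart T e (Complex.I • z) = Complex.I • orthPart T e z
  · left
    intro z hz c
    exact hT.orthPart_smul_of_I (σ := RingHom.id ℂ) he (fun _ => rfl) hall hz c
  · right
    push Not at hall
    obtain ⟨x, hx, hxI⟩ := hall
    have hxI' := (hT.orthPart_I_smul he hx).resolve_left hxI
    intro z hz c
    refine hT.orthPart_smul_of_I he (fun t => Complex.conj_ofReal t) (fun w hw => ?_) hz c
    rw [Complex.conj_I]
    rcases hT.orthPart_I_smul he hw with hwI | hwI
    swap
    · exact hwI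
    have hsum : inner ℂ e (x + w) = 0 := by rw [inner_add_right, hx, hw, add_zero]
    have hix : inner ℂ e (Complex.I • x) = 0 := by rw [inner_smul_right, hx, mul_zero]
    have hiw : inner ℂ e (Complex.I • w) = 0 := by rw [inner_smul_right, hw, mul_zero]
    have h1 := hT.orthPart_I_smul he hsum
    rw [smul_add, hT.orthPart_add he hix hiw, hxI', hwI, hT.orthPart_add he hx hw, smul_add,
      smul_add] at h1
    have hI : (2 * Complex.I : ℂ) ≠ 0 := mul_ne_zero two_ne_zero Complex.I_ne_zero
    rcases h1 with h1 | h1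
    · have h2 : (2 * Complex.I) • orthPart T e x = 0 := by
        rw [add_left_inj] at h1
        rw [mul_smul, two_smul]
        nth_rewrite 1 [← h1]
        rw [neg_smul, neg_add_cancel]
      have h3 := (smul_eq_zero.1 h2).resolve_left hI
      refine absurd ?_ hxI
      rw [hxI', h3, smul_zero, smul_zero]
    · have h2 : (2 * Complex.I) • orthPart T e w = 0 := by
        rw [add_right_inj] at h1
        rw [mul_smul, two_smul]
        nth_rewrite 1 [h1]
        rw [neg_smul, neg_add_cancel]
      have h3 := (smul_eq_zero.1 h2).resolve_left hI
      rw [hwI, h3, smul_zero, smul_zero]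

/-- Assembling a (semilinear) isometry from the orthogonal part. -/
lemma exists_equiv (hT : PreservesAbsInner T) (he : ‖e‖ = 1)
    (hs : ∀ z, ∃ (v : H) (c : ℂ), z = c • T v) {σ : ℂ →+* ℂ} [RingHomInvPair σ σ]
    (hσ : ∀ c, ‖σ c‖ = ‖c‖)
    (h : ∀ z, inner ℂ e z = 0 → ∀ c : ℂ, orthPart T e (c • z) = σ c • orthPart T e z) :
    ∃ U : H ≃ₛₗᵢ[σ] H, ∀ v, ∃ c : ℂ, T v = c • U v := by
  have he' : ‖T e‖ = 1 := by rw [hT.norm_map, he]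
  have ie := inner_self_of_norm_eq_one he
  have ie' := inner_self_of_norm_eq_one he'
  have hP : ∀ v, inner ℂ e (v - (inner ℂ e v : ℂ) • e) = 0 := fun v => by
    rw [inner_sub_right, inner_smul_right, ie, mul_one, sub_self]
  let L : H →ₛₗ[σ] H :=
    { toFun := fun v => σ (inner ℂ e v) • T e + orthPart T e (v - (inner ℂ e v : ℂ) • e)
      map_add' := fun v w => by
        have h1 : v + w - (inner ℂ e (v + w) : ℂ) • e
            = (v - (inner ℂ e v : ℂ) • e) + (w - (inner ℂ e w : ℂ) • e) := by
          rw [inner_add_right, add_smul]; abel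
        rw [h1, hT.orthPart_add he (hP v) (hP w), inner_add_right, map_add, add_smul]
        abel
      map_smul' := fun c v => by
        have h1 : c • v - (inner ℂ e (c • v) : ℂ) • e = c • (v - (inner ℂ e v : ℂ) • e) := by
          rw [inner_smul_right, smul_sub, smul_smul]
        rw [h1, h _ (hP v), inner_smul_right, map_mul, smul_add, smul_smul] }
  have hL : ∀ v, L v = σ (inner ℂ e v) • T e + orthPart T e (v - (inner ℂ e v : ℂ) • e) :=
    fun v => rfl
  have hnorm : ∀ v, ‖L v‖ = ‖v‖ := fun v => by
    have h1 := norm_sq_projection (ray_isStarProjection he) v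
    have h2 := norm_sq_projection (ray_isStarProjection he') (L v)
    have h3 : inner ℂ (T e) (L v) = σ (inner ℂ e v) := by
      rw [hL, inner_add_right, inner_smul_right, ie', hT.inner_orthPart he (hP v), mul_one,
        add_zero]
    rw [InnerProductSpace.rankOne_apply, h3] at h2
    rw [InnerProductSpace.rankOne_apply] at h1
    have h4 : L v - σ (inner ℂ e v) • T e = orthPart T e (v - (inner ℂ e v : ℂ) • e) := by
      rw [hL]; abel
    rw [h4, hT.norm_orthPart he (hP v), norm_smul, hσ, he', ← he, ← norm_smul, ← h1] at h2
    exact (pow_left_inj₀ (norm_nonneg _) (norm_nonneg _) two_ne_zero).1 h2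
  have hphase : ∀ v, ∃ c : ℂ, T v = c • L v := fun v => by
    by_cases hl : (inner ℂ e v : ℂ) = 0
    · obtain ⟨c, -, hc⟩ := hT.exists_eq_smul_orthPart he hl
      refine ⟨c, ?_⟩
      rw [hc, hL, hl, map_zero, zero_smul, zero_smul, sub_zero, zero_add]
    · set l : ℂ := inner ℂ e v with hldef
      have hσl : σ l ≠ 0 := fun h0 => hl (by
        rw [← norm_eq_zero, ← hσ, h0, norm_zero])
      set z := l⁻¹ • (v - l • e) with hz
      have hze : inner ℂ e z = 0 := by rw [hz, inner_smul_right, hP, mul_zero]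
      have hv : v = l • (e + z) := by
        rw [hz, smul_add, smul_smul, mul_inv_cancel₀ hl, one_smul]
        abel
      obtain ⟨c, hc⟩ := hT.map_smul l (e + z)
      have hμ : (inner ℂ (T e) (T (e + z)) : ℂ) ≠ 0 := fun h0 => by
        have := hT.norm_phase he hze
        rw [h0, norm_zero] at this
        exact zero_ne_one this
      have hW : T (e + z) = (inner ℂ (T e) (T (e + z)) : ℂ) • (T e + orthPart T e z) := by
        rw [orthPart, add_sub_cancel, smul_smul, mul_inv_cancel₀ hμ, one_smul]
      have hLv : L v = σ l • (T e + orthPart T e z) := by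
        rw [hL, ← hldef, smul_add, ← h z hze, hz, smul_smul, mul_inv_cancel₀ hl, one_smul]
      refine ⟨c * (inner ℂ (T e) (T (e + z)) : ℂ) * (σ l)⁻¹, ?_⟩
      rw [hLv, smul_smul, mul_assoc, inv_mul_cancel₀ hσl, mul_one, mul_smul, ← hW, ← hc, ← hv]
  refine ⟨LinearIsometryEquiv.ofSurjective ⟨L, hnorm⟩ fun z => ?_, hphase⟩
  obtain ⟨v, c, hz⟩ := hs z
  obtain ⟨d, hd⟩ := hphase v
  refine ⟨σ (c * d) • v, ?_⟩
  change L (σ (c * d) • v) = z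
  rw [LinearMap.map_smulₛₗ, RingHomInvPair.comp_apply_eq, hz, hd, smul_smul]

end PreservesAbsInner

/-- **Wigner's theorem**: a map preserving absolute values of inner products, and surjective up to
scalars, is unitary or antiunitary up to scalars. -/
theorem PreservesAbsInner.exists_unitary {T : H → H} (hT : PreservesAbsInner T)
    (hs : ∀ z, ∃ (v : H) (c : ℂ), z = c • T v) {e : H} (he : ‖e‖ = 1) :
    (∃ U : H ≃ₗᵢ[ℂ] H, ∀ v, ∃ c : ℂ, T v = c • U v) ∨
      ∃ U : H ≃ₗᵢ⋆[ℂ] H, ∀ v, ∃ c : ℂ, T v = c • U v := by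
  rcases hT.orthPart_linear_or he with h | h
  · exact .inl (hT.exists_equiv he hs (σ := RingHom.id ℂ) (fun _ => rfl) h)
  · exact .inr (hT.exists_equiv he hs (fun c => RCLike.norm_conj c) h)

end Effect

/-! ### Conjugation by unitary and antiunitary operators -/

namespace Effect

section Conj

variable {H : Type*} [NormedAddCommGroup H] [InnerProductSpace ℂ H] [CompleteSpace H]
  {σ σ' : ℂ →+* ℂ} [RingHomInvPair σ σ'] [RingHomInvPair σ' σ]

lemma conjBy_apply (U : H ≃ₛₗᵢ[σ] H) (T : H →L[ℂ] H) (z : H) :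
    conjBy U T z = U (T (U.symm z)) := rfl

lemma conjBy_symm_conjBy (U : H ≃ₛₗᵢ[σ] H) (T : H →L[ℂ] H) : conjBy U.symm (conjBy U T) = T := by
  ext z
  simp [conjBy_apply]

lemma conjBy_conjBy_symm (U : H ≃ₛₗᵢ[σ] H) (T : H →L[ℂ] H) : conjBy U (conjBy U.symm T) = T :=
  conjBy_symm_conjBy U.symm T

lemma conjBy_add (U : H ≃ₛₗᵢ[σ] H) (S T : H →L[ℂ] H) :
    conjBy U (S + T) = conjBy U S + conjBy U T := by
  ext z
  simp [conjBy_apply]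

lemma conjBy_sub (U : H ≃ₛₗᵢ[σ] H) (S T : H →L[ℂ] H) :
    conjBy U (S - T) = conjBy U S - conjBy U T := by
  ext z
  simp [conjBy_apply]

lemma conjBy_one (U : H ≃ₛₗᵢ[σ] H) : conjBy U (1 : H →L[ℂ] H) = 1 := by
  ext z
  simp [conjBy_apply]

lemma conjBy_real_smul (U : H ≃ₛₗᵢ[σ] H) (t : ℝ) (T : H →L[ℂ] H) :
    conjBy U (t • T) = t • conjBy U T := by
  ext z
  exact map_real_smul U U.continuous t _

/-- A surjective semilinear isometry preserves real parts of inner products, by polarization. -/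
lemma re_inner_map (U : H ≃ₛₗᵢ[σ] H) (x y : H) :
    (inner ℂ (U x) (U y)).re = (inner ℂ x y).re := by
  have h1 := norm_add_sq (𝕜 := ℂ) (U x) (U y)
  have h2 := norm_add_sq (𝕜 := ℂ) x y
  rw [← map_add, U.norm_map, U.norm_map, U.norm_map] at h1
  simp only [RCLike.re_eq_complex_re] at h1 h2
  linarith

lemma re_inner_map_left (U : H ≃ₛₗᵢ[σ] H) (x y : H) :
    (inner ℂ (U x) y).re = (inner ℂ x (U.symm y)).re := by
  rw [← re_inner_map U x, U.apply_symm_apply]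

lemma qf_conjBy (U : H ≃ₛₗᵢ[σ] H) (T : H →L[ℂ] H) (z : H) :
    qf (conjBy U T) z = qf T (U.symm z) :=
  re_inner_map_left U _ _

lemma isSelfAdjoint_conjBy (U : H ≃ₛₗᵢ[σ] H) {T : H →L[ℂ] H} (hT : IsSelfAdjoint T) :
    IsSelfAdjoint (conjBy U T) := by
  have hre : ∀ x y, (inner ℂ (conjBy U T x) y).re = (inner ℂ x (conjBy U T y)).re := fun x y => by
    have h := re_inner_map U (U.symm x) (T (U.symm y))
    rw [U.apply_symm_apply] at h
    rw [conjBy_apply, conjBy_apply, re_inner_map_left, inner_apply_comm hT, h]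
  rw [ContinuousLinearMap.isSelfAdjoint_iff_isSymmetric]
  intro x y
  refine Complex.ext (hre x y) ?_
  have h := hre (Complex.I • x) y
  rw [map_smul, inner_smul_left, inner_smul_left, Complex.conj_I] at h
  simpa using h

lemma conjBy_nonneg (U : H ≃ₛₗᵢ[σ] H) {T : H →L[ℂ] H} (hT : 0 ≤ T) : 0 ≤ conjBy U T := by
  rw [nonneg_iff_qf (isSelfAdjoint_conjBy U (.of_nonneg hT))]
  intro z
  rw [qf_conjBy]
  exact qf_nonneg hT _

lemma conjBy_mono (U : H ≃ₛₗᵢ[σ] H) {S T : H →L[ℂ] H} (h : S ≤ T) : conjBy U S ≤ conjBy U T := by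
  rw [← sub_nonneg, ← conjBy_sub]
  exact conjBy_nonneg U (sub_nonneg.2 h)

lemma isEff_conjBy (U : H ≃ₛₗᵢ[σ] H) {T : H →L[ℂ] H} (hT : IsEff T) : IsEff (conjBy U T) :=
  ⟨conjBy_nonneg U hT.1, (conjBy_mono U hT.2).trans_eq (conjBy_one U)⟩

lemma Coex.conjBy (U : H ≃ₛₗᵢ[σ] H) {A B : H →L[ℂ] H} (h : Coex A B) :
    Coex (conjBy U A) (conjBy U B) := by
  obtain ⟨F, G, hF, hF', hG, hG', rfl⟩ := h
  refine ⟨Effect.conjBy U F, Effect.conjBy U G, conjBy_nonneg U hF, ?_, conjBy_nonneg U hG,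
    conjBy_mono U hG', conjBy_add U F G⟩
  rw [← conjBy_one U, ← conjBy_sub]
  exact conjBy_mono U hF'

lemma coex_conjBy_iff (U : H ≃ₛₗᵢ[σ] H) {A B : H →L[ℂ] H} :
    Coex (conjBy U A) (conjBy U B) ↔ Coex A B := by
  refine ⟨fun h => ?_, Coex.conjBy U⟩
  have h1 := h.conjBy U.symm
  rwa [conjBy_symm_conjBy, conjBy_symm_conjBy] at h1

lemma conjBy_ray (U : H ≃ₛₗᵢ[σ] H)
    (hU : ∀ x y, ‖(inner ℂ (U x) (U y) : ℂ)‖ = ‖(inner ℂ x y : ℂ)‖) (x : H) :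
    conjBy U (ray x) = ray (U x) := by
  refine ext_qf (isSelfAdjoint_conjBy U (ray_isSelfAdjoint x)) (ray_isSelfAdjoint _) fun z => ?_
  rw [qf_conjBy, qf_ray, qf_ray, ← hU, U.apply_symm_apply]

end Conj

variable {H : Type*} [NormedAddCommGroup H] [InnerProductSpace ℂ H] [CompleteSpace H]

lemma norm_inner_map_linear (U : H ≃ₗᵢ[ℂ] H) (x y : H) :
    ‖(inner ℂ (U x) (U y) : ℂ)‖ = ‖(inner ℂ x y : ℂ)‖ := by
  rw [U.inner_map_map]

lemma norm_inner_map_antilinear (U : H ≃ₗᵢ⋆[ℂ] H) (x y : H) :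
    ‖(inner ℂ (U x) (U y) : ℂ)‖ = ‖(inner ℂ x y : ℂ)‖ := by
  have h : (inner ℂ (U x) (U y) : ℂ) = (starRingEnd ℂ) (inner ℂ x y) := by
    refine Complex.ext ?_ ?_
    · rw [re_inner_map, Complex.conj_re]
    · have h := re_inner_map U (Complex.I • x) y
      rw [U.map_smulₛₗ, inner_smul_left, inner_smul_left, Complex.conj_I] at h
      simp at h
      rw [Complex.conj_im, ← h, neg_neg]
  rw [h, RCLike.norm_conj]

/-! ### The automorphisms fixing the multiples of the rank-one projections -/

/-- If the coexistence relations of multiples of rank-one projections are unchanged, then the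
function `str A + str (1 - A)` is unchanged, and so are the commutation relations with
projections. -/
theorem CoexAut.eq_or_eq_compl {Φ : (H →L[ℂ] H) → (H →L[ℂ] H)} (hΦ : CoexAut Φ)
    (h : ∀ (x : H) (t : ℝ), ‖x‖ = 1 → 0 < t → t ≤ 1 → CoexEq (Φ (t • ray x)) (t • ray x))
    {A : H →L[ℂ] H} (hA : IsEff A) (hns : ¬ IsScalarOp A) : Φ A = A ∨ Φ A = 1 - A := by
  have hcoex : ∀ (x : H) (t : ℝ), ‖x‖ = 1 → 0 ≤ t → t ≤ 1 → ∀ {B : H →L[ℂ] H}, IsEff B →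
      (Coex B (t • ray x) ↔ Coex (Φ B) (t • ray x)) := by
    intro x t hx ht ht' B hB
    rcases ht.eq_or_lt with rfl | ht
    · have h0 : ∀ {C : H →L[ℂ] H}, IsEff C → Coex C ((0 : ℝ) • ray x) := fun {C} hC => by
        rw [zero_smul]
        exact coex_of_commute hC.1 hC.2 le_rfl zero_le_one (Commute.zero_right C)
      exact ⟨fun _ => h0 (hΦ.isEff hB), fun _ => h0 hB⟩
    · have he := (isEff_ray hx).smul ht.le ht'
      rw [hΦ.coex _ _ hB he]
      exact (CoexEq.refl _).coex_iff (h x t hx ht ht') (hΦ.isEff hB) (hΦ.isEff he)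
  have hL : ∀ {B : H →L[ℂ] H}, IsEff B → ∀ x : H, x ≠ 0 →
      str B x + str (1 - B) x = str (Φ B) x + str (1 - Φ B) x := by
    intro B hB x hx
    have hB' := hΦ.isEff hB
    refine str_add_eq_of_coex hB.1 hB.2 hB'.1 hB'.2 hx fun s hs hs' => ?_
    have hn : ‖x‖ ≠ 0 := norm_ne_zero_iff.2 hx
    have hy : ‖((‖x‖⁻¹ : ℝ) : ℂ) • x‖ = 1 := by
      rw [norm_smul, Complex.norm_real, norm_inv, norm_norm, inv_mul_cancel₀ hn]
    have hr : s • ray x = (s * ‖x‖ ^ 2) • ray (((‖x‖⁻¹ : ℝ) : ℂ) • x) := by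
      rw [ray_smul, smul_smul, Complex.norm_real, norm_inv, norm_norm, inv_pow, mul_assoc,
        mul_inv_cancel₀ (pow_ne_zero 2 hn), mul_one]
    rw [hr]
    exact hcoex _ _ hy (by positivity) hs' hB
  have hproj : ∀ E : H →L[ℂ] H, IsStarProjection E → Commute E A → Commute E (Φ A) := by
    intro E hE hEA
    have hEe := hE.isEff
    by_cases h1 : ∃ x, invForm E x = ⊤
    swap
    · have : E = 1 := by
        ext x
        exact (invForm_projection_ne_top_iff hE).1 fun hx => h1 ⟨x, hx⟩
      rw [this]
      exact Commute.one_left _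
    by_cases h2 : ∃ x, invForm (1 - E) x = ⊤
    swap
    · have : 1 - E = 1 := by
        ext x
        exact (invForm_projection_ne_top_iff hE.one_sub).1 fun hx => h2 ⟨x, hx⟩
      rw [sub_eq_self.1 this]
      exact Commute.zero_left _
    have hE' := hΦ.isEff hEe
    have hA' := hΦ.isEff hA
    have h3 : Coex (Φ E) (Φ A) := (hΦ.coex _ _ hEe hA).1
      (coex_of_commute hEe.1 hEe.2 hA.1 hA.2 hEA)
    rcases eq_or_eq_compl_of_not_finite hEe.1 hEe.2 hE'.1 hE'.2 (hL hEe) h1 h2 with h4 | h4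
    · rw [h4] at h3
      exact commute_of_coex_projection hE h3
    · rw [h4, coex_compl_left] at h3
      exact commute_of_coex_projection hE h3
  have hA' := hΦ.isEff hA
  exact eq_or_eq_compl_of_str_add hA.1 hA.2 hA'.1 hA'.2 hns (hL hA) hproj

/-- The rays are transformed by a unitary or antiunitary operator. -/
theorem RayMap.exists_unitary {ψ : H → H} {f : H → ℝ → ℝ} (hR : RayMap ψ f)
    (hdim : 2 ≤ Module.rank ℂ H) :
    (∃ U : H ≃ₗᵢ[ℂ] H, ∀ x, ‖x‖ = 1 → ray (ψ x) = ray (U x)) ∨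
      ∃ U : H ≃ₗᵢ⋆[ℂ] H, ∀ x, ‖x‖ = 1 → ray (ψ x) = ray (U x) := by
  obtain ⟨e, he, -⟩ := exists_unit_orthogonal_one hdim (0 : H)
  have hov := (hR.ov_eq hdim).2
  have hunit : ∀ {v : H}, v ≠ 0 → ‖((‖v‖⁻¹ : ℝ) : ℂ) • v‖ = 1 := fun {v} hv => by
    rw [norm_smul, Complex.norm_real, norm_inv, norm_norm, inv_mul_cancel₀ (norm_ne_zero_iff.2 hv)]
  let T : H → H := fun v => (‖v‖ : ℂ) • ψ (((‖v‖⁻¹ : ℝ) : ℂ) • v)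
  have hT1 : ∀ x, ‖x‖ = 1 → T x = ψ x := fun x hx => by simp [T, hx]
  have hT : PreservesAbsInner T := by
    intro v w
    by_cases hv : v = 0
    · simp [T, hv]
    by_cases hw : w = 0
    · simp [T, hw]
    have h1 := hov _ _ (hunit hv) (hunit hw)
    have h2 := (pow_left_inj₀ (norm_nonneg _) (norm_nonneg _) two_ne_zero).1 h1
    simp only [T]
    rw [inner_smul_left, inner_smul_right, norm_mul, norm_mul, h2, inner_smul_left,
      inner_smul_right, norm_mul, norm_mul]
    have hv' : ‖v‖ ≠ 0 := norm_ne_zero_iff.2 hv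
    have hw' : ‖w‖ ≠ 0 := norm_ne_zero_iff.2 hw
    simp only [RCLike.norm_conj, Complex.norm_real, norm_norm, norm_inv]
    field_simp
  have hs : ∀ z, ∃ (v : H) (c : ℂ), z = c • T v := by
    intro z
    by_cases hz : z = 0
    · exact ⟨0, 0, by rw [hz, zero_smul]⟩
    obtain ⟨x, hx, hxz⟩ := hR.surj _ (hunit hz)
    have hz1 := ray_apply_self (hunit hz)
    rw [← hxz, InnerProductSpace.rankOne_apply] at hz1
    have hz2 : z = (‖z‖ : ℂ) • ((‖z‖⁻¹ : ℝ) : ℂ) • z := by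
      rw [smul_smul, ← Complex.ofReal_mul, mul_inv_cancel₀ (norm_ne_zero_iff.2 hz),
        Complex.ofReal_one, one_smul]
    refine ⟨x, (‖z‖ : ℂ) * inner ℂ (ψ x) (((‖z‖⁻¹ : ℝ) : ℂ) • z), ?_⟩
    rw [hT1 x hx, mul_smul, hz1, ← hz2]
  have hphase : ∀ {x y : H} {c : ℂ}, ‖x‖ = 1 → ‖y‖ = 1 → T x = c • y → ray (ψ x) = ray y := by
    intro x y c hx hy h
    have hc : ‖c‖ = 1 := by
      have := hR.norm x hx
      rwa [← hT1 x hx, h, norm_smul, hy, mul_one] at this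
    rw [← hT1 x hx, h, ray_smul, hc, one_pow, one_smul]
  rcases hT.exists_unitary hs he with ⟨U, hU⟩ | ⟨U, hU⟩
  · refine .inl ⟨U, fun x hx => ?_⟩
    obtain ⟨c, hc⟩ := hU x
    exact hphase hx (by rw [U.norm_map, hx]) hc
  · refine .inr ⟨U, fun x hx => ?_⟩
    obtain ⟨c, hc⟩ := hU x
    exact hphase hx (by rw [U.norm_map, hx]) hc

/-- Composing with a conjugation reduces to an automorphism fixing the multiples of rank-one
projections. -/
lemma CoexAut.eq_conjBy_or {σ σ' : ℂ →+* ℂ} [RingHomInvPair σ σ'] [RingHomInvPair σ' σ]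
    {Φ : (H →L[ℂ] H) → (H →L[ℂ] H)} (hΦ : CoexAut Φ) (U : H ≃ₛₗᵢ[σ] H)
    (hU : ∀ x y, ‖(inner ℂ (U x) (U y) : ℂ)‖ = ‖(inner ℂ x y : ℂ)‖)
    (h : ∀ (x : H) (t : ℝ), ‖x‖ = 1 → 0 < t → t ≤ 1 → CoexEq (Φ (t • ray x)) (t • ray (U x)))
    {A : H →L[ℂ] H} (hA : IsEff A) (hns : ¬ IsScalarOp A) :
    Φ A = conjBy U A ∨ Φ A = 1 - conjBy U A := by
  have hΦ' : CoexAut fun A => conjBy U.symm (Φ A) := by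
    refine ⟨⟨fun A hA => isEff_conjBy U.symm (hΦ.isEff hA), fun A hA B hB hAB => ?_,
      fun A hA => ?_⟩, fun A B hA hB => ?_⟩
    · have h1 := congrArg (conjBy U) hAB
      simp only [conjBy_conjBy_symm] at h1
      exact hΦ.bij.injOn hA hB h1
    · obtain ⟨B, hB, hBA⟩ := hΦ.exists_eq (isEff_conjBy U hA)
      exact ⟨B, hB, by simp only [hBA, conjBy_symm_conjBy]⟩
    · rw [hΦ.coex A B hA hB, coex_conjBy_iff]
  have hUsymm : ∀ x y, ‖(inner ℂ (U.symm x) (U.symm y) : ℂ)‖ = ‖(inner ℂ x y : ℂ)‖ := fun x y => by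
    rw [← hU, U.apply_symm_apply, U.apply_symm_apply]
  have hfiner : ∀ {B C : H →L[ℂ] H}, Finer B C → Finer (conjBy U.symm B) (conjBy U.symm C) := by
    intro B C h X hX hBX
    rw [← coex_conjBy_iff U, conjBy_conjBy_symm] at hBX ⊢
    exact h _ (isEff_conjBy U hX) hBX
  have key := hΦ'.eq_or_eq_compl (fun x t hx ht ht' => by
    have h1 := h x t hx ht ht'
    have h2 : conjBy U.symm (t • ray (U x)) = t • ray x := by
      rw [conjBy_real_smul, conjBy_ray U.symm hUsymm, U.symm_apply_apply]
    have h3 : CoexEq (conjBy U.symm (Φ (t • ray x))) (conjBy U.symm (t • ray (U x))) :=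
      ⟨hfiner h1.1, hfiner h1.2⟩
    rwa [h2] at h3) hA hns
  have hinv := conjBy_conjBy_symm U (Φ A)
  rcases key with h1 | h1
  · left
    rw [← hinv, h1]
  · right
    rw [← hinv, h1, conjBy_sub, conjBy_one]

/-- A coexistence automorphism is implemented, up to complements, by a unitary or antiunitary
operator. -/
theorem CoexAut.exists_conjBy {Φ : (H →L[ℂ] H) → (H →L[ℂ] H)} (hΦ : CoexAut Φ)
    (hdim : 2 ≤ Module.rank ℂ H) :
    (∃ U : H ≃ₗᵢ[ℂ] H, ∀ A, IsEff A → ¬ IsScalarOp A →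
      Φ A = conjBy U A ∨ Φ A = 1 - conjBy U A) ∨
      ∃ U : H ≃ₗᵢ⋆[ℂ] H, ∀ A, IsEff A → ¬ IsScalarOp A →
        Φ A = conjBy U A ∨ Φ A = 1 - conjBy U A := by
  obtain ⟨ψ, τ, hR, hray, hτ⟩ := hΦ.exists_rayMap hdim
  have hfix := (hR.ov_eq hdim).1
  have hmult : ∀ (x : H) (t : ℝ), ‖x‖ = 1 → 0 < t → t ≤ 1 → CoexEq (Φ (t • ray x)) (t • ray (ψ x)) := by
    intro x t hx ht ht'
    rcases ht'.eq_or_lt with rfl | ht'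
    · rw [one_smul, one_smul]
      exact hray x hx
    · obtain ⟨h1, -, h3⟩ := hτ x t hx ht ht'
      have h4 := hfix x hx _ (odds_pos ht ht')
      rw [inv_odds ht, sub_left_inj] at h4
      rw [one_div, one_div, inv_inj] at h4
      rwa [h4] at h3
  rcases hR.exists_unitary hdim with ⟨U, hU⟩ | ⟨U, hU⟩
  · exact .inl ⟨U, fun A hA hns => hΦ.eq_conjBy_or U (norm_inner_map_linear U)
      (fun x t hx ht ht' => hU x hx ▸ hmult x t hx ht ht') hA hns⟩
  · exact .inr ⟨U, fun A hA hns => hΦ.eq_conjBy_or U (norm_inner_map_antilinear U)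
      (fun x t hx ht ht' => hU x hx ▸ hmult x t hx ht ht') hA hns⟩

end Effect

/-! ### Passing to the effect algebra -/

namespace Effect

variable {H : Type*} [NormedAddCommGroup H] [InnerProductSpace ℂ H] [CompleteSpace H]

lemma ext_op {A B : Effect H} (h : A.op = B.op) : A = B := Subtype.ext h

lemma isEff_op (A : Effect H) : IsEff A.op := A.2

lemma ortho_op (A : Effect H) : A.ortho.op = 1 - A.op := rfl

lemma isScalar_iff_op (A : Effect H) : IsScalar A ↔ IsScalarOp A.op := by
  constructor
  · rintro ⟨t, rfl⟩
    exact ⟨t, t.2.1, t.2.2, rfl⟩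
  · rintro ⟨t, ht, ht', h⟩
    exact ⟨⟨t, ht, ht'⟩, ext_op h⟩

lemma IsScalar.ortho {A : Effect H} (h : IsScalar A) : IsScalar A.ortho := by
  rw [isScalar_iff_op] at h ⊢
  obtain ⟨t, ht, ht', h⟩ := h
  exact ⟨1 - t, by linarith, by linarith, by rw [ortho_op, h, sub_smul, one_smul]⟩

lemma ortho_ortho (A : Effect H) : A.ortho.ortho = A :=
  ext_op (by rw [ortho_op, ortho_op, sub_sub_cancel])

lemma ortho_ne_self {A : Effect H} (h : ¬ IsScalar A) : A.ortho ≠ A := by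
  intro h1
  refine h ((isScalar_iff_op A).2 ⟨1 / 2, by norm_num, by norm_num, ?_⟩)
  have h2 := congrArg op h1
  rw [ortho_op, sub_eq_iff_eq_add, ← two_smul ℝ] at h2
  rw [h2, smul_smul]
  norm_num

lemma scalar_injective [Nontrivial H] : Function.Injective (scalar : unitInterval → Effect H) := by
  intro s t h
  obtain ⟨x, hx⟩ := exists_ne (0 : H)
  have h1 : (s : ℝ) • x = (t : ℝ) • x := congrArg (fun A : Effect H => A.op x) h
  exact Subtype.ext (smul_left_injective ℝ hx h1)

lemma IsScalar.coexistent {A : Effect H} (h : IsScalar A) (B : Effect H) : Coexistent A B := by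
  obtain ⟨t, rfl⟩ := h
  exact (coexistent_iff _ _).2 (coex_scalar t.2.1 t.2.2 B.2.1 B.2.2)

lemma coexistent_comm {A B : Effect H} : Coexistent A B ↔ Coexistent B A := by
  rw [coexistent_iff, coexistent_iff, coex_comm]

/-- The extension to all bounded operators, by the identity, of a map on effects. -/
noncomputable def extend (φ : Effect H → Effect H) (T : H →L[ℂ] H) : H →L[ℂ] H :=
  open Classical in if h : 0 ≤ T ∧ T ≤ 1 then (φ ⟨T, h⟩).op else T

lemma extend_op (φ : Effect H → Effect H) (A : Effect H) : extend φ A.op = (φ A).op :=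
  dif_pos A.2

lemma coexAut_extend {φ : Effect H → Effect H} (hφ : Function.Bijective φ)
    (hco : PreservesCoexistence φ) : CoexAut (extend φ) := by
  have hlift : ∀ {T : H →L[ℂ] H}, IsEff T → ∃ A : Effect H, A.op = T := fun {T} hT =>
    ⟨⟨T, hT⟩, rfl⟩
  refine ⟨⟨fun T hT => ?_, fun S hS T hT hST => ?_, fun T hT => ?_⟩, fun S T hS hT => ?_⟩
  · obtain ⟨A, rfl⟩ := hlift hT
    rw [extend_op]
    exact isEff_op _
  · obtain ⟨A, rfl⟩ := hlift hS
    obtain ⟨B, rfl⟩ := hlift hT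
    rw [extend_op, extend_op] at hST
    rw [hφ.1 (ext_op hST)]
  · obtain ⟨A, rfl⟩ := hlift hT
    obtain ⟨B, rfl⟩ := hφ.2 A
    exact ⟨B.op, isEff_op B, extend_op φ B⟩
  · obtain ⟨A, rfl⟩ := hlift hS
    obtain ⟨B, rfl⟩ := hlift hT
    rw [extend_op, extend_op, ← coexistent_iff, ← coexistent_iff]
    exact hco A B

section Implemented

variable {σ σ' : ℂ →+* ℂ} [RingHomInvPair σ σ'] [RingHomInvPair σ' σ]

lemma implementedOffScalars_of_eq_or {φ : Effect H → Effect H} (hφ : Function.Injective φ)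
    {U : H ≃ₛₗᵢ[σ] H} (h : ∀ A : Effect H, ¬ IsScalar A →
      (φ A).op = conjBy U A.op ∨ (φ A).op = 1 - conjBy U A.op) :
    ImplementedOffScalars φ U := by
  intro A hA
  have hA' : ¬ IsScalar A.ortho := fun h => hA (by simpa only [ortho_ortho] using h.ortho)
  have hne : (φ A).op ≠ (φ A.ortho).op := fun h => ortho_ne_self hA (hφ (ext_op h)).symm
  have h1 := h A hA
  have h2 := h _ hA'
  have h3 : conjBy U A.ortho.op = 1 - conjBy U A.op := by rw [ortho_op, conjBy_sub, conjBy_one]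
  rw [h3, sub_sub_cancel] at h2
  rw [h3]
  -- Two distinct elements of a set of at most two elements exhaust it.
  rcases h1 with h1 | h1 <;> rcases h2 with h2 | h2
  · rw [h1, h2]
  · exact absurd (h1.trans h2.symm) hne
  · exact absurd (h1.trans h2.symm) hne
  · rw [h1, h2, Set.pair_comm]

lemma ImplementedOffScalars.preservesCoexistence {φ : Effect H → Effect H} {U : H ≃ₛₗᵢ[σ] H}
    (h : ImplementedOffScalars φ U) (hs : ∀ A : Effect H, IsScalar A → IsScalar (φ A)) :
    PreservesCoexistence φ := by
  intro A B
  by_cases hA : IsScalar A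
  · exact iff_of_true (hA.coexistent B) ((hs A hA).coexistent _)
  by_cases hB : IsScalar B
  · rw [coexistent_comm, coexistent_comm (A := φ A)]
    exact iff_of_true (hB.coexistent A) ((hs B hB).coexistent _)
  have hmem : ∀ C : Effect H, ¬ IsScalar C →
      (φ C).op = conjBy U C.op ∨ (φ C).op = 1 - conjBy U C.op := fun C hC => by
    have h1 : (φ C).op ∈ ({(φ C).op, (φ C.ortho).op} : Set (H →L[ℂ] H)) := Set.mem_insert _ _
    rw [h C hC, ortho_op, conjBy_sub, conjBy_one] at h1
    exact h1
  rw [coexistent_iff, coexistent_iff, ← coex_conjBy_iff U]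
  rcases hmem A hA with h1 | h1 <;> rcases hmem B hB with h2 | h2 <;>
    simp only [h1, h2, coex_compl_left, coex_compl_right]

end Implemented

lemma exists_bijective_scalar [Nontrivial H] {φ : Effect H → Effect H} (hφ : Function.Bijective φ)
    (hs : ∀ A : Effect H, IsScalar A ↔ IsScalar (φ A)) :
    ∃ g : unitInterval → unitInterval, Function.Bijective g ∧
      ∀ t : unitInterval, φ (scalar t) = scalar (g t) := by
  have hex : ∀ t : unitInterval, ∃ s : unitInterval, φ (scalar t) = scalar s := fun t =>
    (hs _).1 ⟨t, rfl⟩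
  choose g hg using hex
  refine ⟨g, ⟨fun s t hst => ?_, fun t => ?_⟩, hg⟩
  · refine scalar_injective (H := H) (hφ.1 ?_)
    rw [hg, hg, hst]
  · obtain ⟨A, hA⟩ := hφ.2 (scalar t)
    obtain ⟨s, rfl⟩ := (hs A).2 ⟨t, hA⟩
    exact ⟨s, scalar_injective (H := H) ((hg s).symm.trans hA)⟩

end Effect

theorem theorem1p3 {H : Type*} [NormedAddCommGroup H] [InnerProductSpace ℂ H] [CompleteSpace H]
    (hdim : 2 ≤ Module.rank ℂ H) :
    (∀ φ : Effect H → Effect H, Function.Bijective φ → Effect.PreservesCoexistence φ →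
      ((∃ U : H ≃ₗᵢ[ℂ] H, Effect.ImplementedOffScalars φ U) ∨
        (∃ U : H ≃ₗᵢ⋆[ℂ] H, Effect.ImplementedOffScalars φ U)) ∧
      ∃ g : unitInterval → unitInterval, Function.Bijective g ∧
        ∀ t : unitInterval, φ (Effect.scalar t) = Effect.scalar (g t)) ∧
    (∀ φ : Effect H → Effect H,
      ((∃ U : H ≃ₗᵢ[ℂ] H, Effect.ImplementedOffScalars φ U) ∨
        (∃ U : H ≃ₗᵢ⋆[ℂ] H, Effect.ImplementedOffScalars φ U)) →
      (∃ g : unitInterval → unitInterval, Function.Bijective g ∧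
        ∀ t : unitInterval, φ (Effect.scalar t) = Effect.scalar (g t)) →
      Effect.PreservesCoexistence φ) := by
  refine ⟨fun φ hφ hco => ?_, fun φ hU hg => ?_⟩
  · have hΦ := Effect.coexAut_extend hφ hco
    obtain ⟨e, he, -⟩ := Effect.exists_unit_orthogonal_one hdim (0 : H)
    have : Nontrivial H := ⟨e, 0, Effect.ne_zero_of_norm_eq_one he⟩
    constructor
    · rcases hΦ.exists_conjBy hdim with ⟨U, hU⟩ | ⟨U, hU⟩
      · refine .inl ⟨U, Effect.implementedOffScalars_of_eq_or hφ.1 fun A hA => ?_⟩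
        rw [← Effect.extend_op]
        exact hU A.op A.isEff_op ((Effect.isScalar_iff_op A).not.1 hA)
      · refine .inr ⟨U, Effect.implementedOffScalars_of_eq_or hφ.1 fun A hA => ?_⟩
        rw [← Effect.extend_op]
        exact hU A.op A.isEff_op ((Effect.isScalar_iff_op A).not.1 hA)
    · refine Effect.exists_bijective_scalar hφ fun A => ?_
      rw [Effect.isScalar_iff_op, Effect.isScalar_iff_op, hΦ.isScalarOp_iff A.isEff_op,
        Effect.extend_op]
  · obtain ⟨g, -, hg⟩ := hg
    have hs : ∀ A : Effect H, A.IsScalar → (φ A).IsScalar := by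
      rintro _ ⟨t, rfl⟩
      exact ⟨g t, hg t⟩
    rcases hU with ⟨U, hU⟩ | ⟨U, hU⟩
    · exact hU.preservesCoexistence hs
    · exact hU.preservesCoexistence hs
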